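/- Let $\Theta\in M_d(\mathbb R)$ be an invertible skew-symmetric matrix (so $d$ is even), let $\tilde\Omega>0$ and $t>0$, and put $g:=\big(1-\tfrac14\tilde\Omega^2\Theta^2\big)^{-1}$. On $L^2(\mathbb R^d)$ let $H$ be the self-adjoint harmonic oscillator $H=-\partial_\mu\partial^\mu+\tilde\Omega^2x_\mu x^\mu$ (the closure of this operator on Schwartz functions), and let $\nabla_\mu:=\partial_\mu+\tfrac i2\tilde\Omega^2\Theta_{\mu\nu}x^\nu$, $\mu=1,\dots,d$ (summation over repeated indices, which are raised and lowered with the Euclidean metric). Let $\mathcal B_\star$ be the space of smooth bounded functions $f:\mathbb R^d\to\mathbb C$ all of whose partial derivatives are bounded. For $f\in\mathcal B_\star$ let $L_\star(f)$ be the operator $\psi\mapsto f\star\psi$ on $L^2(\mathbb R^d)$, the closure (that is, the continuous extension) of the Moyal product on Schwartz functions $$(f\star\psi)(x)=\frac1{(2\pi)^d}\int_{\mathbb R^d}dk\int_{\mathbb R^d}dy\; f\big(x+\tfrac12\Theta k\big)\,\psi(x+y)\,e^{i\langle k,y\rangle}.$$ Then for all $f\in\mathcal B_\star$, $k\ge 0$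 and $\mu_1,\dots,\mu_k\in\{1,\dots,d\}$ the operator $L_\star(f)\nabla_{\mu_1}\cdots\nabla_{\mu_k}e^{-tH}$ is an everywhere defined trace-class operator on $L^2(\mathbb R^d)$, and $$\mathrm{Tr}\big(L_\star(f)\nabla_{\mu_1}\cdots\nabla_{\mu_k}e^{-tH}\big)=\sum_{P}\Big(\frac{\tilde\Omega}{2\pi\sinh(2\tilde\Omega t)}\Big)^{d/2}\int_{\mathbb R^d}dz\,\sqrt{\det g}\;f(z)\,e^{-\tilde\Omega\tanh(\tilde\Omega t)\langle z,gz\rangle}\prod_{i\notin\bigcup P}\mathcal Z_{\mu_i}(z)\prod_{\{i<j\}\in P}\mathcal N_{\mu_i\mu_j},$$ where $P$ runs over all sets (including the empty one) of pairwise disjoint two-element subsets $\{i<j\}$ of $\{1,\dots,k\}$, $\bigcup P$ is the set of the indices that occur in these pairs, and $$\mathcal Z_\mu(z):=-\tilde\Omega\tanh(\tilde\Omega t)\,z_\mu+i\tilde\Omega^2(\Theta gz)_\mu,$$ $$\mathcal N_{\mu\nu}:=-\tfrac12\tilde\Omega\big(\coth(\tilde\Omega t)+\tanh(\tilde\Omega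 t)\big)(g^{-1})_{\mu\nu}-\tfrac12\tilde\Omega^3\coth(\tilde\Omega t)(\Theta g\Theta)_{\mu\nu}-\tfrac12i\tilde\Omega^2\,\Theta_{\mu\nu}.$$ In particular $e^{-tH}$ is trace class and $\mathrm{Tr}(e^{-tH})=\big(2\sinh(\tilde\Omega t)\big)^{-d}$. -/

import Mathlib

open MeasureTheory Matrix Filter Topology
open scoped SchwartzMap InnerProductSpace ContDiff

noncomputable section

/-! ### Operators on a complex Hilbert space -/

section Hilbert

variable {H : Type} [NormedAddCommGroup H] [InnerProductSpace ℂ H] [CompleteSpace H]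

/-- A bounded operator `T` is trace class if the (nonnegative) series `∑ ⟨b i, |T| b i⟩` converges
for a Hilbert basis `b`, where `|T| = √(T* T)`; the choice of the basis does not matter. -/
def IsTraceClass (T : H →L[ℂ] H) : Prop :=
  ∃ (ι : Type) (b : HilbertBasis ι ℂ H), Summable fun i => (⟪b i, CFC.abs T (b i)⟫_ℂ).re

/-- `T` is trace class and its trace, computed in any Hilbert basis, is `τ`. -/
def HasTrace (T : H →L[ℂ] H) (τ : ℂ) : Prop :=
  IsTraceClass T ∧
    ∀ (ι : Type) (b : HilbertBasis ι ℂ H), HasSum (fun i => ⟪b i, T (b i)⟫_ℂ) τ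

/-- The product `B A` of two unbounded operators, on its natural domain
`{x ∈ dom A | A x ∈ dom B}`. -/
def pcomp (B A : H →ₗ.[ℂ] H) : H →ₗ.[ℂ] H where
  domain := (B.domain.comap A.toFun).map A.domain.subtype
  toFun := B.toFun ∘ₗ
    (A.toFun.restrict (p := B.domain.comap A.toFun) (q := B.domain) fun _ hx => hx) ∘ₗ
      ((B.domain.comap A.toFun).equivMapOfInjective A.domain.subtype
        A.domain.injective_subtype).symm.toLinearMap

theorem mem_graph_pcomp (B A : H →ₗ.[ℂ] H) (x z : H) :
    (x, z) ∈ (pcomp B A).graph ↔ ∃ y, (x, y) ∈ A.graph ∧ (y, z) ∈ B.graph := by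
  have key : ∀ (u : A.domain) (hu : A u ∈ B.domain) (hu' : (u : H) ∈ (pcomp B A).domain),
      pcomp B A ⟨u, hu'⟩ = B ⟨A u, hu⟩ := by
    intro u hu hu'
    have h : ((B.domain.comap A.toFun).equivMapOfInjective A.domain.subtype
        A.domain.injective_subtype).symm ⟨u, hu'⟩ = ⟨u, hu⟩ := by
      rw [LinearEquiv.symm_apply_eq]
      rfl
    change B.toFun (A.toFun.restrict (p := B.domain.comap A.toFun) (q := B.domain)
      (fun _ hx => hx) (((B.domain.comap A.toFun).equivMapOfInjective
      A.domain.subtype A.domain.injective_subtype).symm ⟨u, hu'⟩)) = _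
    rw [h]
    rfl
  constructor
  · intro h
    obtain ⟨w, hw, hz⟩ := (LinearPMap.mem_graph_iff _).1 h
    obtain ⟨u, hu, huw⟩ := w.2
    refine ⟨A u, ?_, ?_⟩
    · exact (LinearPMap.mem_graph_iff _).2 ⟨u, huw.trans hw, rfl⟩
    · refine (LinearPMap.mem_graph_iff _).2 ⟨⟨A u, hu⟩, rfl, ?_⟩
      rw [← key u hu ⟨u, hu, rfl⟩]
      exact (congrArg _ (Subtype.ext huw)).trans hz
  · rintro ⟨y, hA, hB⟩
    obtain ⟨u, hux, huy⟩ := (LinearPMap.mem_graph_iff _).1 hA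
    obtain ⟨v, hvy, hvz⟩ := (LinearPMap.mem_graph_iff _).1 hB
    have hu : A u ∈ B.domain := by
      have h : A u = v := huy.trans hvy.symm
      rw [h]
      exact v.2
    have hu' : (u : H) ∈ (pcomp B A).domain := ⟨u, hu, rfl⟩
    refine (LinearPMap.mem_graph_iff _).2 ⟨⟨u, hu'⟩, hux, (key u hu hu').trans ?_⟩
    exact (congrArg _ (Subtype.ext (huy.trans hvy.symm))).trans hvz

/-- `S` is a strongly continuous one-parameter semigroup (in the parameter `t ≥ 0`) whose
generator is exactly `-A`. -/
structure IsSemigroupOf (A : H →ₗ.[ℂ] H) (S : ℝ → H →L[ℂ] H) : Prop where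
  map_zero : S 0 = ContinuousLinearMap.id ℂ H
  map_add : ∀ s t : ℝ, 0 ≤ s → 0 ≤ t → S (s + t) = (S s).comp (S t)
  continuousOn : ∀ ψ : H, ContinuousOn (fun t => S t ψ) (Set.Ici 0)
  generator : ∀ ψ φ : H, (ψ, φ) ∈ A.graph ↔
    Tendsto (fun h : ℝ => ((h⁻¹ : ℝ) : ℂ) • (ψ - S h ψ)) (𝓝[>] 0) (𝓝 φ)

open Classical in
/-- The operator `e^{-tA}`, `t ≥ 0`: the value at `t` of the strongly continuous semigroup generated
by `-A`, which is unique if it exists (and a default value `0` if there is none). -/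
def expNeg (A : H →ₗ.[ℂ] H) (t : ℝ) : H →L[ℂ] H :=
  if h : ∃ S, IsSemigroupOf A S then h.choose t else 0

end Hilbert

/-! ### The Hilbert space `L²(ℝ^d)` and operators given on Schwartz functions -/

/-- Euclidean space `ℝ^d`. -/
abbrev Rd (d : ℕ) : Type := EuclideanSpace ℝ (Fin d)

/-- The Hilbert space `L²(ℝ^d)`. -/
abbrev L2 (d : ℕ) : Type := Lp ℂ 2 (volume : Measure (Rd d))

/-- The inclusion of the Schwartz space into `L²(ℝ^d)`. -/
def schwartzToL2 (d : ℕ) : 𝓢(Rd d, ℂ) →ₗ[ℂ] L2 d :=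
  (SchwartzMap.toLpCLM ℂ ℂ 2 (volume : Measure (Rd d))).toLinearMap

theorem schwartzToL2_injective (d : ℕ) : Function.Injective (schwartzToL2 d) :=
  SchwartzMap.injective_toLp 2 volume

/-- The operator on `L²(ℝ^d)` obtained from a linear map defined on (a subspace of) the Schwartz
space: first regarded as an operator with that domain in `L²(ℝ^d)`, then closed. -/
def closedOp {d : ℕ} (P : 𝓢(Rd d, ℂ) →ₗ.[ℂ] L2 d) : L2 d →ₗ.[ℂ] L2 d :=
  LinearPMap.closure
    { domain := P.domain.map (schwartzToL2 d)
      toFun := P.toFun ∘ₗ (P.domain.equivMapOfInjective (schwartzToL2 d)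
        (schwartzToL2_injective d)).symm.toLinearMap }

/-- The closed operator on `L²(ℝ^d)` with core the Schwartz space, given there by `A`. -/
def closedOpOfEnd {d : ℕ} (A : 𝓢(Rd d, ℂ) →L[ℂ] 𝓢(Rd d, ℂ)) : L2 d →ₗ.[ℂ] L2 d :=
  closedOp ((schwartzToL2 d ∘ₗ A.toLinearMap).toPMap ⊤)

/-- The matrix `M` acting on `z ∈ ℝ^d`. -/
def matVec {d : ℕ} (M : Matrix (Fin d) (Fin d) ℝ) (z : Rd d) : Rd d :=
  WithLp.toLp 2 (M *ᵥ z.ofLp)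

/-! ### The harmonic oscillator and the operators `∇_μ` -/

/-- `-∂_μ ∂^μ + Ω² x_μ x^μ` on Schwartz functions. -/
def oscillatorS (d : ℕ) (Ω : ℝ) : 𝓢(Rd d, ℂ) →L[ℂ] 𝓢(Rd d, ℂ) :=
  -LineDeriv.laplacianCLM ℂ (Rd d) 𝓢(Rd d, ℂ)
    + ((Ω ^ 2 : ℝ) : ℂ) • SchwartzMap.smulLeftCLM ℂ (fun x : Rd d => ((‖x‖ ^ 2 : ℝ) : ℂ))

/-- The self-adjoint harmonic oscillator Hamiltonian `H` of frequency `Ω` on `L²(ℝ^d)`. -/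
def oscillator (d : ℕ) (Ω : ℝ) : L2 d →ₗ.[ℂ] L2 d := closedOpOfEnd (oscillatorS d Ω)

/-- `∇_μ = ∂_μ + (i/2) Ω² Θ_{μν} x^ν` on Schwartz functions. -/
def nablaS {d : ℕ} (Θ : Matrix (Fin d) (Fin d) ℝ) (Ω : ℝ) (μ : Fin d) :
    𝓢(Rd d, ℂ) →L[ℂ] 𝓢(Rd d, ℂ) :=
  LineDeriv.lineDerivOpCLM ℂ 𝓢(Rd d, ℂ) (EuclideanSpace.single μ (1 : ℝ))
    + (Complex.I / 2 * ((Ω ^ 2 : ℝ) : ℂ)) •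
      SchwartzMap.smulLeftCLM ℂ (fun x : Rd d => ((matVec Θ x μ : ℝ) : ℂ))

/-- The closed operator `∇_μ` on `L²(ℝ^d)`. -/
def nabla {d : ℕ} (Θ : Matrix (Fin d) (Fin d) ℝ) (Ω : ℝ) (μ : Fin d) : L2 d →ₗ.[ℂ] L2 d :=
  closedOpOfEnd (nablaS Θ Ω μ)

theorem oscillatorS_apply (d : ℕ) (Ω : ℝ) (ψ : 𝓢(Rd d, ℂ)) (x : Rd d) :
    oscillatorS d Ω ψ x =
      -Laplacian.laplacian (ψ : Rd d → ℂ) x + ((Ω ^ 2 * ‖x‖ ^ 2 : ℝ) : ℂ) * ψ x := by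
  have h : Function.HasTemperateGrowth (fun x : Rd d => ((‖x‖ ^ 2 : ℝ) : ℂ)) := by fun_prop
  simp only [oscillatorS, _root_.add_apply, _root_.neg_apply, _root_.smul_apply]
  rw [SchwartzMap.laplacianCLM_eq, SchwartzMap.laplacian_apply,
    SchwartzMap.smulLeftCLM_apply_apply h]
  push_cast
  simp only [smul_eq_mul, mul_assoc]

theorem nablaS_apply {d : ℕ} (Θ : Matrix (Fin d) (Fin d) ℝ) (Ω : ℝ) (μ : Fin d)
    (ψ : 𝓢(Rd d, ℂ)) (x : Rd d) :
    nablaS Θ Ω μ ψ x = lineDeriv ℝ ψ x (EuclideanSpace.single μ 1) +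
      Complex.I / 2 * ((Ω ^ 2 : ℝ) : ℂ) * ((∑ ν, Θ μ ν * x ν : ℝ) : ℂ) * ψ x := by
  have h : Function.HasTemperateGrowth (fun x : Rd d => ((matVec Θ x μ : ℝ) : ℂ)) := by
    have h1 : (fun x : Rd d => ((matVec Θ x μ : ℝ) : ℂ)) =
        (Complex.ofRealCLM ∘L EuclideanSpace.proj μ ∘L
          (Matrix.toEuclideanLin Θ).toContinuousLinearMap : Rd d →L[ℝ] ℂ) := by
      funext x
      simp [matVec, Matrix.toEuclideanLin]
    rw [h1]
    exact ContinuousLinearMap.hasTemperateGrowth _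
  simp only [nablaS, _root_.add_apply, _root_.smul_apply, LineDeriv.lineDerivOpCLM_apply]
  rw [SchwartzMap.lineDerivOp_apply, SchwartzMap.smulLeftCLM_apply_apply h]
  simp only [smul_eq_mul, mul_assoc]
  rfl

/-! ### The Moyal product -/

/-- The algebra `B_⋆` as a space: smooth bounded complex functions on `ℝ^d` with all partial
derivatives bounded. -/
structure BStar (d : ℕ) where
  toFun : Rd d → ℂ
  smooth : ContDiff ℝ ∞ toFun
  bounded : ∀ n : ℕ, ∃ C : ℝ, ∀ x, ‖iteratedFDeriv ℝ n toFun x‖ ≤ C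

/-- The Moyal product
`(f ⋆ ψ)(x) = (2π)^{-d} ∫ dk ∫ dy f(x + ½ Θ k) ψ(x + y) e^{i⟨k, y⟩}`
as an iterated integral, in which the inner and the outer integral converge absolutely for `f` in
`B_⋆` and `ψ` a Schwartz function. -/
def moyal {d : ℕ} (Θ : Matrix (Fin d) (Fin d) ℝ) (f ψ : Rd d → ℂ) (x : Rd d) : ℂ :=
  ((((2 * Real.pi) ^ d)⁻¹ : ℝ) : ℂ) * ∫ k : Rd d, ∫ y : Rd d,
    f (x + (1 / 2 : ℝ) • matVec Θ k) * ψ (x + y) * Complex.exp (Complex.I * ((⟪k, y⟫_ℝ : ℝ) : ℂ))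

section linearity

variable {d : ℕ} (Θ : Matrix (Fin d) (Fin d) ℝ) (f : BStar d)

theorem moyal_inner_integrable (ψ : 𝓢(Rd d, ℂ)) (x k : Rd d) :
    Integrable fun y : Rd d => f.toFun (x + (1 / 2 : ℝ) • matVec Θ k) * ψ (x + y) *
      Complex.exp (Complex.I * ((⟪k, y⟫_ℝ : ℝ) : ℂ)) := by
  have h : Integrable fun y : Rd d => ψ (x + y) := ψ.integrable.comp_add_left x
  refine (h.const_mul (f.toFun (x + (1 / 2 : ℝ) • matVec Θ k))).mul_bdd (c := 1) ?_ ?_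
  · exact Continuous.aestronglyMeasurable (by fun_prop)
  · refine Eventually.of_forall fun y => ?_
    rw [mul_comm, Complex.norm_exp_ofReal_mul_I]

theorem moyal_outer_integrable (ψ : 𝓢(Rd d, ℂ)) (x : Rd d) :
    Integrable fun k : Rd d => ∫ y : Rd d, f.toFun (x + (1 / 2 : ℝ) • matVec Θ k) * ψ (x + y) *
      Complex.exp (Complex.I * ((⟪k, y⟫_ℝ : ℝ) : ℂ)) := by
  obtain ⟨C, hC⟩ := f.bounded 0
  have hc : Continuous fun k : Rd d => f.toFun (x + (1 / 2 : ℝ) • matVec Θ k) := by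
    have h1 : Continuous fun k : Rd d => matVec Θ k :=
      (Matrix.toEuclideanLin Θ).toContinuousLinearMap.continuous
    exact f.smooth.continuous.comp (by fun_prop)
  have hF := ((FourierTransform.fourier
    (SchwartzMap.compSubConstCLM ℂ (-x) ψ)).integrable (μ := volume)).comp_smul
    (R := -(2 * Real.pi)⁻¹) (by simp [Real.pi_ne_zero])
  refine (hF.bdd_mul (c := C) hc.aestronglyMeasurable (Eventually.of_forall fun k => ?_)).congr
    (Eventually.of_forall fun k => ?_)
  · simpa using hC (x + (1 / 2 : ℝ) • matVec Θ k)
  · simp only [SchwartzMap.fourier_coe, Real.fourier_eq', smul_eq_mul]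
    rw [← integral_const_mul]
    congr 1
    funext y
    rw [SchwartzMap.compSubConstCLM_apply, sub_neg_eq_add, add_comm y x, real_inner_smul_right,
      real_inner_comm k y]
    have h2 : ((-2 * Real.pi * (-(2 * Real.pi)⁻¹ * ⟪k, y⟫_ℝ) : ℝ) : ℂ) * Complex.I
        = Complex.I * ((⟪k, y⟫_ℝ : ℝ) : ℂ) := by
      rw [mul_comm]
      congr 2
      field_simp
    rw [h2]
    ring

theorem moyal_add (ψ φ : 𝓢(Rd d, ℂ)) :
    moyal Θ f.toFun (ψ + φ : 𝓢(Rd d, ℂ)) = moyal Θ f.toFun ψ + moyal Θ f.toFun φ := by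
  funext x
  simp only [moyal, Pi.add_apply]
  rw [← mul_add, ← integral_add (moyal_outer_integrable Θ f ψ x) (moyal_outer_integrable Θ f φ x)]
  congr 2
  funext k
  rw [← integral_add (moyal_inner_integrable Θ f ψ x k) (moyal_inner_integrable Θ f φ x k)]
  congr 1
  funext y
  rw [_root_.add_apply]
  ring

theorem moyal_smul (c : ℂ) (ψ : 𝓢(Rd d, ℂ)) :
    moyal Θ f.toFun (c • ψ : 𝓢(Rd d, ℂ)) = c • moyal Θ f.toFun ψ := by
  funext x
  simp only [moyal, Pi.smul_apply, smul_eq_mul]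
  rw [mul_left_comm, ← integral_const_mul c]
  congr 2
  funext k
  rw [← integral_const_mul]
  congr 1
  funext y
  rw [_root_.smul_apply, smul_eq_mul]
  ring

end linearity

/-- The map `ψ ↦ f ⋆ ψ` from the Schwartz functions `ψ` with `f ⋆ ψ ∈ L²(ℝ^d)` (which are in fact all
Schwartz functions) to `L²(ℝ^d)`. -/
def moyalS {d : ℕ} (Θ : Matrix (Fin d) (Fin d) ℝ) (f : BStar d) : 𝓢(Rd d, ℂ) →ₗ.[ℂ] L2 d where
  domain :=
    { carrier := {ψ | MemLp (moyal Θ f.toFun ψ) 2 volume}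
      add_mem' := fun {ψ φ} hψ hφ => by
        simpa only [Set.mem_ofPred_eq, moyal_add] using MemLp.add hψ hφ
      zero_mem' := by
        have h : moyal Θ f.toFun (0 : 𝓢(Rd d, ℂ)) = 0 := by
          simpa using moyal_smul Θ f 0 0
        simp only [Set.mem_ofPred_eq, h]
        exact MemLp.zero
      smul_mem' := fun c ψ hψ => by
        simpa only [Set.mem_ofPred_eq, moyal_smul] using MemLp.const_smul hψ c }
  toFun :=
    { toFun := fun ψ => MemLp.toLp (moyal Θ f.toFun ψ.1) ψ.2
      map_add' := fun ψ φ => by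
        rw [← MemLp.toLp_add]
        exact MemLp.toLp_congr _ _ (by
          rw [show ((ψ + φ : _).1 : 𝓢(Rd d, ℂ)) = ψ.1 + φ.1 from rfl, moyal_add])
      map_smul' := fun c ψ => by
        rw [RingHom.id_apply, ← MemLp.toLp_const_smul]
        exact MemLp.toLp_congr _ _ (by
          rw [show ((c • ψ : _).1 : 𝓢(Rd d, ℂ)) = c • ψ.1 from rfl, moyal_smul]) }

/-- The operator `L_⋆(f)` of left Moyal multiplication by `f` on `L²(ℝ^d)`: the closure of
`ψ ↦ f ⋆ ψ` on Schwartz functions (that is, its continuous extension to `L²(ℝ^d)`). -/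
def leftMoyal {d : ℕ} (Θ : Matrix (Fin d) (Fin d) ℝ) (f : BStar d) : L2 d →ₗ.[ℂ] L2 d :=
  closedOp (moyalS Θ f)

/-- The operator `L_⋆(f) ∇_{μ_1} ⋯ ∇_{μ_k} e^{-tH}` on its natural domain. -/
def tracedOp {d k : ℕ} (Θ : Matrix (Fin d) (Fin d) ℝ) (Ω t : ℝ) (f : BStar d)
    (μ : Fin k → Fin d) : L2 d →ₗ.[ℂ] L2 d :=
  pcomp (leftMoyal Θ f)
    ((List.ofFn μ).foldr (fun ν A => pcomp (nabla Θ Ω ν) A)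
      ((expNeg (oscillator d Ω) t).toLinearMap.toPMap ⊤))

/-! ### The ingredients of the trace formula -/

/-- The effective metric `g = (1 - ¼ Ω² Θ²)⁻¹`. -/
def metricG {d : ℕ} (Θ : Matrix (Fin d) (Fin d) ℝ) (Ω : ℝ) : Matrix (Fin d) (Fin d) ℝ :=
  (1 - (Ω ^ 2 / 4) • (Θ * Θ))⁻¹

/-- The hyperbolic cotangent. -/
def coth (s : ℝ) : ℝ := Real.cosh s / Real.sinh s

/-- `Z_μ(z) = -Ω tanh(Ωt) z_μ + i Ω² (Θ g z)_μ`. -/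
def Zfac {d : ℕ} (Θ : Matrix (Fin d) (Fin d) ℝ) (Ω t : ℝ) (z : Rd d) (μ : Fin d) : ℂ :=
  ((-(Ω * Real.tanh (Ω * t) * z μ) : ℝ) : ℂ)
    + Complex.I * ((Ω ^ 2 * matVec (Θ * metricG Θ Ω) z μ : ℝ) : ℂ)

/-- `N_{μν} = -½ Ω (coth(Ωt) + tanh(Ωt)) (g⁻¹)_{μν} - ½ Ω³ coth(Ωt) (Θ g Θ)_{μν} - ½ i Ω² Θ_{μν}`. -/
def Nfac {d : ℕ} (Θ : Matrix (Fin d) (Fin d) ℝ) (Ω t : ℝ) (μ ν : Fin d) : ℂ :=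
  ((-(1 / 2 * Ω * (coth (Ω * t) + Real.tanh (Ω * t)) * (metricG Θ Ω)⁻¹ μ ν)
      - 1 / 2 * Ω ^ 3 * coth (Ω * t) * (Θ * metricG Θ Ω * Θ) μ ν : ℝ) : ℂ)
    - Complex.I * ((1 / 2 * Ω ^ 2 * Θ μ ν : ℝ) : ℂ)

/-- The sets of disjoint pairs in `{1, …, k}` (not necessarily covering everything), encoded as
involutions: the pairs are the two-element orbits, the unpaired indices are the fixed points. -/
def pairings (k : ℕ) : Finset (Equiv.Perm (Fin k)) :=
  Finset.univ.filter fun σ => ∀ i, σ (σ i) = i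

/-- The right-hand side of the trace formula. -/
def traceFormula {d k : ℕ} (Θ : Matrix (Fin d) (Fin d) ℝ) (Ω t : ℝ) (f : BStar d)
    (μ : Fin k → Fin d) : ℂ :=
  ∑ σ ∈ pairings k,
    (((Ω / (2 * Real.pi * Real.sinh (2 * Ω * t))) ^ ((d : ℝ) / 2) : ℝ) : ℂ) *
      ∫ z : Rd d, ((Real.sqrt (metricG Θ Ω).det : ℝ) : ℂ) * f.toFun z *
        ((Real.exp (-(Ω * Real.tanh (Ω * t) * ⟪z, matVec (metricG Θ Ω) z⟫_ℝ)) : ℝ) : ℂ) *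
        (∏ i ∈ Finset.univ.filter (fun i => σ i = i), Zfac Θ Ω t z (μ i)) *
        ∏ i ∈ Finset.univ.filter (fun i => i < σ i), Nfac Θ Ω t (μ i) (μ (σ i))

end

/-! The operator `e^{-tH}` is an integral operator with Mehler's Gaussian kernel `(b/2π)^{d/2}
exp(-a|x|² + b⟨x,y⟩ - a|y|²)`, where `a = (Ω/2) coth(2Ωt)` and `b = Ω/sinh(2Ωt)`, so that `4a² - b²
= Ω²`. It is built as a product of a Gaussian multiplication, a Gaussian Fourier multiplier and the
same multiplication (`heat`). On the coherent states `exp(-Ω|x|²/2 + ⟨u,x⟩)`, which are total in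
`L²`, its action is explicit: `u` is multiplied by `q = e^{-2Ωt}` and a scalar comes out
(`heat_coherent`). The semigroup law, symmetry, strong continuity and the kernel (`heat_apply`) are
verified there. The Schwartz functions are dense and invariant, hence a core of the generator
(`mem_closure_graph_iff_generator`). Thus the generator is minus the closed oscillator, and a
contraction semigroup is determined by its generator (`IsSemigroupOf.eq_of_contraction`).

Since `e^{-tH/2}` maps `L²` continuously into Schwartz functions, and `x ↦ (f ⋆ ∇⋯∇ψ)(x)` decays
rapidly with bounds that are continuous seminorms of `ψ`, the operator is a product of two
Hilbert–Schmidt operators, `(L_⋆(f)∇⋯∇ e^{-tH/2}) e^{-tH/2}`. It is therefore trace class, and by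
cyclicity and Parseval its trace is the integral of its kernel over the diagonal
(`exists_hasTrace_of_isRapid`).

To evaluate this integral, the Moyal product is written as `∫ f(x + ½Θκ) e^{-i⟨κ,x⟩} ψ^(κ) dκ`
(`moyal_eq`). On the Fourier side the derivatives `∇` turn a Gaussian into a Wick polynomial times
that Gaussian (`hatS_nablaProd_gauss`). The shear `z = x + ½Θκ` frees the argument of `f`. The
quadratic form left in `κ` is `(|κ|² + ¼Ω²|Θκ|²)/(4a) = ⟨κ, g⁻¹κ⟩/(4a)`, and the substitution `y =
(1 + ½ΩΘ)κ` makes it round at the price of the factor `√det g`. Wick's theorem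
(`integral_wick_gauss`) then shifts the linear factors and the contractions, and matrix identities
among `Θ`, `g` and `g⁻¹` (`linear_eq`, `contraction_eq`, `exponent_shear`) show that the results are
`Z`, `N` and the stated Gaussian. -/

noncomputable section

/-! ### Hilbert–Schmidt operators and traces -/

section HilbertSchmidt

variable {H : Type} [NormedAddCommGroup H] [InnerProductSpace ℂ H] {ι : Type}

theorem HilbertBasis.hasSum_norm_inner_sq (b : HilbertBasis ι ℂ H) (x : H) :
    HasSum (fun i => ‖⟪b i, x⟫_ℂ‖ ^ 2) (‖x‖ ^ 2) := by
  have h := b.hasSum_inner_mul_inner x x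
  have h2 := (Complex.hasSum_re h)
  rw [show ((⟪x, x⟫_ℂ).re) = ‖x‖ ^ 2 from by
    rw [inner_self_eq_norm_sq_to_K]; norm_cast] at h2
  refine h2.congr_fun fun i => ?_
  rw [← inner_conj_symm x (b i), ← Complex.normSq_eq_conj_mul_self, Complex.ofReal_re,
    Complex.normSq_eq_norm_sq]

/-- Square summability of the matrix coefficients of a Hilbert–Schmidt operator. -/
theorem summable_norm_inner_sq_prod (b : HilbertBasis ι ℂ H) (A : H →L[ℂ] H)
    (hA : Summable fun i => ‖A (b i)‖ ^ 2) :
    Summable fun p : ι × ι => ‖⟪b p.1, A (b p.2)⟫_ℂ‖ ^ 2 := by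
  have h : Summable fun p : ι × ι => ‖⟪b p.2, A (b p.1)⟫_ℂ‖ ^ 2 := by
    have hnn : (0 : ι × ι → ℝ) ≤ fun p : ι × ι => ‖⟪b p.2, A (b p.1)⟫_ℂ‖ ^ 2 :=
      fun p => sq_nonneg _
    refine (summable_prod_of_nonneg hnn).2
      ⟨fun i => (b.hasSum_norm_inner_sq (A (b i))).summable, ?_⟩
    exact hA.congr fun i => (b.hasSum_norm_inner_sq (A (b i))).tsum_eq.symm
  exact (Equiv.prodComm ι ι).summable_iff.1 h

variable [CompleteSpace H]

/-- Both series are the double series of `|⟨b i, A (b j)⟩|²`, summed by rows or by columns. -/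
theorem hasSum_norm_adjoint_sq (b : HilbertBasis ι ℂ H) (A : H →L[ℂ] H) {s : ℝ}
    (hA : HasSum (fun i => ‖A (b i)‖ ^ 2) s) :
    HasSum (fun i => ‖A.adjoint (b i)‖ ^ 2) s := by
  have h := summable_norm_inner_sq_prod b A hA.summable
  have h1 := h.hasSum
  have h2 : HasSum (fun p : ι × ι => ‖⟪b p.2, A (b p.1)⟫_ℂ‖ ^ 2)
      (∑' p : ι × ι, ‖⟪b p.1, A (b p.2)⟫_ℂ‖ ^ 2) := (Equiv.prodComm ι ι).hasSum_iff.2 h1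
  have h3 := h2.prod_fiberwise fun i => b.hasSum_norm_inner_sq (A (b i))
  rw [h3.unique hA] at h1
  refine h1.prod_fiberwise fun i => ?_
  refine (b.hasSum_norm_inner_sq (A.adjoint (b i))).congr_fun fun j => ?_
  rw [ContinuousLinearMap.adjoint_inner_right, ← inner_conj_symm, Complex.norm_conj]

/-- Cyclicity of the trace for products of two Hilbert–Schmidt operators. -/
theorem hasSum_inner_comp_comm (b : HilbertBasis ι ℂ H) (A B : H →L[ℂ] H)
    (hA : Summable fun i => ‖A (b i)‖ ^ 2) (hB : Summable fun i => ‖B (b i)‖ ^ 2) {τ : ℂ}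
    (h : HasSum (fun i => ⟪b i, B (A (b i))⟫_ℂ) τ) :
    HasSum (fun i => ⟪b i, A (B (b i))⟫_ℂ) τ := by
  -- Products of matrix coefficients are dominated by sums of squares, so the double series
  -- converges absolutely. Its two iterated sums are the two traces.
  have hs : Summable fun p : ι × ι => ⟪b p.1, A (b p.2)⟫_ℂ * ⟪b p.2, B (b p.1)⟫_ℂ := by
    refine Summable.of_norm_bounded ((summable_norm_inner_sq_prod b A hA).add
      ((Equiv.prodComm ι ι).summable_iff.2 (summable_norm_inner_sq_prod b B hB))) fun p => ?_
    simp only [norm_mul, Function.comp_apply, Equiv.prodComm_apply, Prod.fst_swap, Prod.snd_swap]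
    nlinarith [sq_nonneg (‖⟪b p.1, A (b p.2)⟫_ℂ‖ - ‖⟪b p.2, B (b p.1)⟫_ℂ‖),
      norm_nonneg ⟪b p.1, A (b p.2)⟫_ℂ, norm_nonneg ⟪b p.2, B (b p.1)⟫_ℂ]
  have hf : ∀ (A B : H →L[ℂ] H) i, HasSum (fun j => ⟪b i, A (b j)⟫_ℂ * ⟪b j, B (b i)⟫_ℂ)
      ⟪b i, A (B (b i))⟫_ℂ := fun A B i => by
    simpa only [ContinuousLinearMap.adjoint_inner_left] using
      b.hasSum_inner_mul_inner (A.adjoint (b i)) (B (b i))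
  have h2 := ((Equiv.prodComm ι ι).hasSum_iff.2 hs.hasSum).prod_fiberwise fun i =>
    (hf B A i).congr_fun fun j => by simp [mul_comm]
  rw [h.unique h2]
  exact hs.hasSum.prod_fiberwise (hf A B)

/-- A bounded substitute for the partial isometry in the polar decomposition. -/
theorem exists_approx_polar (T : H →L[ℂ] H) {ε : ℝ} (hε : 0 < ε) :
    ∃ U : H →L[ℂ] H, ‖U‖ ≤ 1 ∧ ‖CFC.abs T - star U * T‖ ≤ ε := by
  set P := CFC.abs T with hP
  have hP0 : 0 ≤ P := CFC.abs_nonneg T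
  have hsa : IsSelfAdjoint P := hP0.isSelfAdjoint
  have hspec : ∀ x ∈ spectrum ℝ P, 0 ≤ x := fun x hx => spectrum_nonneg_of_nonneg hP0 hx
  have hne : ∀ x ∈ spectrum ℝ P, x + ε ≠ 0 := fun x hx => by have := hspec x hx; positivity
  have hc : ContinuousOn (fun x : ℝ => (x + ε)⁻¹) (spectrum ℝ P) :=
    (by fun_prop : ContinuousOn (fun x : ℝ => x + ε) _).inv₀ hne
  -- With `P = |T|`, the operator `T (P + ε)⁻¹` stands in for the partial isometry `T P⁻¹`; no care
  -- about the kernel of `P` is needed.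
  set R := cfc (fun x : ℝ => (x + ε)⁻¹) P with hR
  have hRsa : IsSelfAdjoint R := cfc_predicate _ _
  have hPid : cfc (fun x : ℝ => x) P = P := cfc_id' ℝ P
  have hRP : R * P = cfc (fun x : ℝ => (x + ε)⁻¹ * x) P := by
    rw [cfc_mul (fun x : ℝ => (x + ε)⁻¹) (fun x => x) P hc (by fun_prop), hPid]
  have hnorm : ‖R * P‖ ≤ 1 := by
    rw [hRP]
    refine norm_cfc_le zero_le_one fun x hx => ?_
    have := hspec x hx
    rw [Real.norm_of_nonneg (by positivity), inv_mul_le_one₀ (by positivity)]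
    linarith
  refine ⟨T * R, ?_, ?_⟩
  · have h1 : ‖star (T * R) * (T * R)‖ = ‖T * R‖ * ‖T * R‖ := CStarRing.norm_star_mul_self
    have h2 : star (T * R) * (T * R) = (R * P) * star (R * P) := by
      rw [star_mul, star_mul, hRsa.star_eq, hsa.star_eq]
      have h3 : P * P = star T * T := CFC.abs_mul_abs T
      calc R * star T * (T * R) = R * (star T * T) * R := by noncomm_ring
        _ = R * (P * P) * R := by rw [h3]
        _ = _ := by noncomm_ring
    rw [h2, CStarRing.norm_self_mul_star] at h1
    nlinarith [norm_nonneg (R * P), norm_nonneg (T * R)]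
  · have h3 : star (T * R) * T = cfc (fun x : ℝ => (x + ε)⁻¹ * x) P * P := by
      rw [star_mul, hRsa.star_eq, ← hRP, mul_assoc, mul_assoc, CFC.abs_mul_abs T]
    have hc2 : ContinuousOn (fun x : ℝ => (x + ε)⁻¹ * x) (spectrum ℝ P) :=
      hc.mul continuousOn_id
    have h4 : cfc (fun x : ℝ => (x + ε)⁻¹ * x) P * P =
        cfc (fun x : ℝ => (x + ε)⁻¹ * x * x) P := by
      rw [cfc_mul (fun x : ℝ => (x + ε)⁻¹ * x) (fun x => x) P hc2 (by fun_prop), hPid]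
    have h5 : P - cfc (fun x : ℝ => (x + ε)⁻¹ * x * x) P =
        cfc (fun x : ℝ => x - (x + ε)⁻¹ * x * x) P := by
      rw [cfc_sub (fun x : ℝ => x) (fun x => (x + ε)⁻¹ * x * x) P (by fun_prop)
        (hc2.mul continuousOn_id), hPid]
    rw [h3, h4, h5]
    refine norm_cfc_le hε.le fun x hx => ?_
    have := hspec x hx
    -- On the spectrum the error is `ε x/(x + ε)`, which is at most `ε`.
    have h6 : x - (x + ε)⁻¹ * x * x = ε * (x / (x + ε)) := by
      field_simp
      ring
    rw [h6, Real.norm_of_nonneg (by positivity)]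
    exact mul_le_of_le_one_right hε.le (div_le_one_of_le₀ (by linarith) (by positivity))

/-- The product of two Hilbert–Schmidt operators is trace class. -/
theorem isTraceClass_comp (b : HilbertBasis ι ℂ H) (A B : H →L[ℂ] H)
    (hA : Summable fun i => ‖A (b i)‖ ^ 2) (hB : Summable fun i => ‖B (b i)‖ ^ 2) :
    IsTraceClass (A.comp B) := by
  obtain ⟨α, hα⟩ := hA
  obtain ⟨β, hβ⟩ := hB
  set T := A.comp B with hT
  have hnn : ∀ i, 0 ≤ (⟪b i, CFC.abs T (b i)⟫_ℂ).re := fun i => by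
    have h := (ContinuousLinearMap.nonneg_iff_isPositive (CFC.abs T)).1 (CFC.abs_nonneg T)
    exact h.re_inner_nonneg_right (b i)
  refine ⟨ι, b, summable_of_sum_le (c := 1 + (α + β)) hnn fun F => ?_⟩
  -- The accuracy depends on the finite set `F`, so that the errors of its terms add up to at most
  -- 1. The remaining bound `α + β` is independent of `F` and of `U`, because `star U * A` and its
  -- adjoint have the same Hilbert–Schmidt norm.
  have hε : (0 : ℝ) < 1 / (F.card + 1) := by positivity
  obtain ⟨U, hU, hU2⟩ := exists_approx_polar T hε
  have hAU : HasSum (fun i => ‖(star U * A).adjoint (b i)‖ ^ 2) (∑' i, ‖(star U * A) (b i)‖ ^ 2) :=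
    hasSum_norm_adjoint_sq b _ (Summable.hasSum (Summable.of_nonneg_of_le (fun i => by positivity)
      (fun i => by
        have : ‖star U (A (b i))‖ ≤ ‖A (b i)‖ :=
          ((star U).le_opNorm _).trans (mul_le_of_le_one_left (norm_nonneg _)
            (by rwa [norm_star]))
        exact pow_le_pow_left₀ (norm_nonneg _) this 2) hα.summable))
  have hle : ∑' i, ‖(star U * A) (b i)‖ ^ 2 ≤ α := by
    have h1 : ∀ i, ‖(star U * A) (b i)‖ ^ 2 ≤ ‖A (b i)‖ ^ 2 := fun i => by
      have : ‖star U (A (b i))‖ ≤ ‖A (b i)‖ :=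
          ((star U).le_opNorm _).trans (mul_le_of_le_one_left (norm_nonneg _)
            (by rwa [norm_star]))
      exact pow_le_pow_left₀ (norm_nonneg _) this 2
    rw [← hα.tsum_eq]
    exact (Summable.of_nonneg_of_le (fun i => by positivity) h1 hα.summable).tsum_le_tsum h1
      hα.summable
  have hterm : ∀ i, (⟪b i, CFC.abs T (b i)⟫_ℂ).re ≤ 1 / (F.card + 1) +
      (‖(star U * A).adjoint (b i)‖ ^ 2 + ‖B (b i)‖ ^ 2) := fun i => by
    have h1 : CFC.abs T (b i) = (CFC.abs T - star U * T) (b i) + (star U * A) (B (b i)) := by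
      simp [hT]
    rw [h1, inner_add_right, Complex.add_re]
    have hb1 : ‖b i‖ = 1 := b.orthonormal.1 i
    have h2 : (⟪b i, (CFC.abs T - star U * T) (b i)⟫_ℂ).re ≤ 1 / (F.card + 1) := by
      refine (Complex.re_le_norm _).trans ((norm_inner_le_norm _ _).trans ?_)
      rw [hb1, one_mul]
      refine ((CFC.abs T - star U * T).le_opNorm _).trans ?_
      rw [hb1, mul_one]
      exact hU2
    have h3 : (⟪b i, (star U * A) (B (b i))⟫_ℂ).re ≤
        ‖(star U * A).adjoint (b i)‖ ^ 2 + ‖B (b i)‖ ^ 2 := by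
      rw [← ContinuousLinearMap.adjoint_inner_left]
      refine (Complex.re_le_norm _).trans ((norm_inner_le_norm _ _).trans ?_)
      nlinarith [sq_nonneg (‖(star U * A).adjoint (b i)‖ - ‖B (b i)‖),
        norm_nonneg ((star U * A).adjoint (b i)), norm_nonneg (B (b i))]
    linarith
  calc ∑ i ∈ F, (⟪b i, CFC.abs T (b i)⟫_ℂ).re
      ≤ ∑ i ∈ F, (1 / ((F.card : ℝ) + 1) +
        (‖(star U * A).adjoint (b i)‖ ^ 2 + ‖B (b i)‖ ^ 2)) := Finset.sum_le_sum fun i _ => hterm i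
    _ ≤ 1 + (α + β) := by
      rw [Finset.sum_add_distrib, Finset.sum_add_distrib, Finset.sum_const, nsmul_eq_mul]
      have h1 : (F.card : ℝ) * (1 / ((F.card : ℝ) + 1)) ≤ 1 := by
        rw [mul_one_div]
        exact div_le_one_of_le₀ (by linarith) (by positivity)
      have h2 := sum_le_hasSum F (fun i _ => by positivity) hAU
      have h3 := sum_le_hasSum F (fun i _ => by positivity) hβ
      linarith

end HilbertSchmidt

/-! ### Contraction semigroups and their generators -/

section Semigroup

variable {H : Type} [NormedAddCommGroup H] [InnerProductSpace ℂ H]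

/-- A strongly continuous family of contractions is jointly continuous. -/
theorem tendsto_contraction_apply {α : Type*} {l : Filter α} {S : ℝ → H →L[ℂ] H}
    (hcontr : ∀ t, 0 ≤ t → ‖S t‖ ≤ 1) {τ : α → ℝ} (hτ : ∀ᶠ a in l, 0 ≤ τ a) {x : α → H} {x₀ y : H}
    (hx : Tendsto x l (𝓝 x₀)) (hy : Tendsto (fun a => S (τ a) x₀) l (𝓝 y)) :
    Tendsto (fun a => S (τ a) (x a)) l (𝓝 y) := by
  have h : Tendsto (fun a => S (τ a) (x a - x₀)) l (𝓝 0) := by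
    refine squeeze_zero_norm' (hτ.mono fun a ha => ?_)
      (tendsto_norm_zero.comp (tendsto_sub_nhds_zero_iff.2 hx))
    exact ((S (τ a)).le_opNorm _).trans (mul_le_of_le_one_left (norm_nonneg _) (hcontr _ ha))
  simpa using h.add hy

theorem hasDerivWithinAt_Ici_of_tendsto {E : Type*} [NormedAddCommGroup E] [NormedSpace ℝ E]
    {f : ℝ → E} {f' : E} {s : ℝ}
    (h : Tendsto (fun u : ℝ => u⁻¹ • (f (u + s) - f s)) (𝓝[>] 0) (𝓝 f')) :
    HasDerivWithinAt f f' (Set.Ici s) s := by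
  rw [← hasDerivWithinAt_Ioi_iff_Ici, hasDerivWithinAt_iff_tendsto_slope' (by simp)]
  have h1 : Tendsto (fun y : ℝ => y - s) (𝓝[>] s) (𝓝[>] 0) := by
    refine tendsto_nhdsWithin_iff.2 ⟨?_, eventually_nhdsWithin_of_forall fun y hy => Set.mem_Ioi.2 (sub_pos.2 hy)⟩
    have : Tendsto (fun y : ℝ => y - s) (𝓝 s) (𝓝 (s - s)) := tendsto_id.sub_const s
    rw [sub_self] at this
    exact this.mono_left nhdsWithin_le_nhds
  refine (h.comp h1).congr fun y => ?_
  simp [slope_def_module]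

/-- A contraction semigroup is the only semigroup with its generator. -/
theorem IsSemigroupOf.eq_of_contraction [CompleteSpace H] {A : H →ₗ.[ℂ] H} {S S' : ℝ → H →L[ℂ] H}
    (hS : IsSemigroupOf A S) (hS' : IsSemigroupOf A S') (hcontr : ∀ t, 0 ≤ t → ‖S t‖ ≤ 1)
    (hdense : Dense (A.domain : Set H)) {t : ℝ} (ht : 0 ≤ t) : S' t = S t := by
  suffices h : ∀ ψ ∈ A.domain, S' t ψ = S t ψ from
    ContinuousLinearMap.ext fun x => Continuous.ext_on hdense (S' t).continuous (S t).continuous h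
      |> fun h => congrFun h x
  intro ψ hψ
  have hgr : (ψ, A ⟨ψ, hψ⟩) ∈ A.graph := (LinearPMap.mem_graph_iff _).2 ⟨⟨ψ, hψ⟩, rfl, rfl⟩
  set φ := A ⟨ψ, hψ⟩
  -- The curve `s ↦ S (t - s) (S' s ψ)` joins `S t ψ` to `S' t ψ`. For `ψ` in the domain its right
  -- derivative vanishes, because the two generators agree.
  have hcont : ContinuousOn (fun s => S (t - s) (S' s ψ)) (Set.Icc 0 t) := by
    intro s hs
    refine tendsto_contraction_apply hcontr
      (eventually_nhdsWithin_of_forall fun a ha => sub_nonneg.2 ha.2)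
      (((hS'.continuousOn ψ) s hs.1).mono Set.Icc_subset_Ici_self) ?_
    have h1 := (hS.continuousOn (S' s ψ)) (t - s) (sub_nonneg.2 hs.2)
    exact h1.tendsto.comp (tendsto_nhdsWithin_iff.2
      ⟨(tendsto_const_nhds.sub tendsto_id).mono_left nhdsWithin_le_nhds,
        eventually_nhdsWithin_of_forall fun a ha => sub_nonneg.2 ha.2⟩)
  have hder : ∀ s ∈ Set.Ico 0 t, HasDerivWithinAt (fun s => S (t - s) (S' s ψ)) 0 (Set.Ici s) s := by
    intro s hs
    set χ := S' s ψ with hχ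
    have hadd : ∀ u, 0 ≤ u → S' (u + s) ψ = S' u χ := fun u hu => by
      rw [hS'.map_add u s hu hs.1]; rfl
    have hg' : Tendsto (fun u : ℝ => ((u⁻¹ : ℝ) : ℂ) • (χ - S' u χ)) (𝓝[>] 0) (𝓝 (S' s φ)) := by
      refine (((S' s).continuous.tendsto _).comp ((hS'.generator ψ φ).1 hgr)).congr' ?_
      filter_upwards [self_mem_nhdsWithin] with u hu
      rw [Function.comp_apply, map_smul, map_sub, ← hadd u (le_of_lt hu), add_comm u s,
        hS'.map_add s u hs.1 (le_of_lt hu)]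
      rfl
    -- The domain is invariant under `S'`, and `A` commutes with `S' s` there. The common generator
    -- then gives the quotients of `S` and of `S'` at `χ` the same limit.
    have hg := (hS.generator χ (S' s φ)).1 ((hS'.generator χ (S' s φ)).2 hg')
    have hdiff := hg.sub hg'
    rw [sub_self] at hdiff
    refine hasDerivWithinAt_Ici_of_tendsto ?_
    refine squeeze_zero_norm' ?_ (tendsto_norm_zero.comp hdiff)
    filter_upwards [Ioc_mem_nhdsGT (sub_pos.2 hs.2)] with u hu
    have h1 : S (t - s) χ = S (t - (u + s)) (S u χ) := by
      have h3 := hS.map_add (t - (u + s)) u (by linarith [hu.2]) hu.1.le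
      rw [show t - (u + s) + u = t - s by ring] at h3
      rw [h3]
      rfl
    have h2 : u⁻¹ • (S (t - (u + s)) (S' (u + s) ψ) - S (t - s) χ) =
        S (t - (u + s)) (((u⁻¹ : ℝ) : ℂ) • (χ - S u χ) - ((u⁻¹ : ℝ) : ℂ) • (χ - S' u χ)) := by
      rw [hadd u hu.1.le, h1, ← map_sub, ← smul_sub, map_smul, Complex.coe_smul]
      congr 2
      abel
    rw [h2]
    exact ((S _).le_opNorm _).trans (mul_le_of_le_one_left (norm_nonneg _)
      (hcontr _ (by linarith [hu.2])))
  have h := constant_of_has_deriv_right_zero hcont hder t ⟨ht, le_rfl⟩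
  simpa [hS.map_zero, hS'.map_zero] using h

/-- The generator of a contraction semigroup is the closure of its restriction to a dense subspace
that is invariant under the semigroup. -/
theorem mem_closure_graph_iff_generator [CompleteSpace H] {V : Type*} [AddCommGroup V] [Module ℂ V] (e : V →ₗ[ℂ] H)
    (A : V →ₗ[ℂ] V) {S : ℝ → H →L[ℂ] H} (h0 : S 0 = ContinuousLinearMap.id ℂ H)
    (hadd : ∀ s t : ℝ, 0 ≤ s → 0 ≤ t → S (s + t) = (S s).comp (S t))
    (hcont : ∀ ψ : H, ContinuousOn (fun t => S t ψ) (Set.Ici 0))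
    (hcontr : ∀ t, 0 ≤ t → ‖S t‖ ≤ 1) (hdense : DenseRange e)
    (hinv : ∀ t, 0 ≤ t → ∀ v, ∃ w, S t (e v) = e w)
    (hgen : ∀ v, ∀ h, 0 ≤ h → e v - S h (e v) = ∫ s in (0 : ℝ)..h, S s (e (A v))) (ψ φ : H) :
    (ψ, φ) ∈ closure (Set.range fun v => (e v, e (A v))) ↔
      Tendsto (fun h : ℝ => ((h⁻¹ : ℝ) : ℂ) • (ψ - S h ψ)) (𝓝[>] 0) (𝓝 φ) := by
  have hint : ∀ (χ : H) (h : ℝ), 0 ≤ h → IntervalIntegrable (fun s => S s χ) volume 0 h :=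
    fun χ h hh => ((hcont χ).mono (by
      rw [Set.uIcc_of_le hh]; exact Set.Icc_subset_Ici_self)).intervalIntegrable
  -- The integrated form of the evolution equation survives limits in the graph norm and gives back
  -- the derivative at zero.
  have hderiv : ∀ ψ φ : H, (∀ h, 0 ≤ h → ψ - S h ψ = ∫ s in (0 : ℝ)..h, S s φ) →
      Tendsto (fun h : ℝ => ((h⁻¹ : ℝ) : ℂ) • (ψ - S h ψ)) (𝓝[>] 0) (𝓝 φ) := by
    intro ψ φ h
    have h1 : HasDerivWithinAt (fun u => ∫ s in (0 : ℝ)..u, S s φ) (S 0 φ) (Set.Ioi 0) 0 := by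
      refine (intervalIntegral.integral_hasDerivWithinAt_right (by simp)
        (s := Set.Ici 0) (t := Set.Ioi 0) ?_ ?_).mono Set.Ioi_subset_Ici_self
      · exact ⟨Set.Ioi 0, self_mem_nhdsWithin, ((hcont φ).mono
          Set.Ioi_subset_Ici_self).aestronglyMeasurable measurableSet_Ioi⟩
      · exact ((hcont φ) 0 Set.self_mem_Ici).mono Set.Ioi_subset_Ici_self
    rw [hasDerivWithinAt_iff_tendsto_slope' (by simp)] at h1
    rw [h0] at h1
    refine (h1.congr' ?_)
    filter_upwards [self_mem_nhdsWithin] with u hu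
    rw [slope_def_module, intervalIntegral.integral_same, sub_zero, sub_zero, h u (le_of_lt hu),
      Complex.coe_smul]
  constructor
  · intro hmem
    refine hderiv ψ φ fun h hh => ?_
    rw [← sub_eq_zero, ← norm_le_zero_iff]
    refine le_of_forall_pos_le_add fun ε hε => ?_
    -- The error consists of two copies of `‖ψ - e v‖` and of `h` times `‖φ - e (A v)‖`, whence the
    -- divisor `2 + h`.
    obtain ⟨_, ⟨v, rfl⟩, hv⟩ := Metric.mem_closure_iff.1 hmem (ε / (2 + h)) (by positivity)
    rw [Prod.dist_eq, max_lt_iff, dist_eq_norm, dist_eq_norm] at hv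
    obtain ⟨hv1, hv2⟩ := hv
    have e1 : ψ - S h ψ - ∫ s in (0 : ℝ)..h, S s φ =
        (ψ - e v) - S h (ψ - e v) - ∫ s in (0 : ℝ)..h, S s (φ - e (A v)) := by
      simp only [map_sub]
      rw [intervalIntegral.integral_sub (hint _ _ hh) (hint _ _ hh), ← hgen v h hh]
      abel
    have e2 : ‖∫ s in (0 : ℝ)..h, S s (φ - e (A v))‖ ≤ ‖φ - e (A v)‖ * |h - 0| := by
      refine intervalIntegral.norm_integral_le_of_norm_le_const fun s hs => ?_
      rw [Set.uIoc_of_le hh] at hs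
      exact ((S s).le_opNorm _).trans (mul_le_of_le_one_left (norm_nonneg _) (hcontr _ hs.1.le))
    have e3 : ‖S h (ψ - e v)‖ ≤ ‖ψ - e v‖ :=
      ((S h).le_opNorm _).trans (mul_le_of_le_one_left (norm_nonneg _) (hcontr _ hh))
    rw [e1, zero_add]
    rw [sub_zero, abs_of_nonneg hh] at e2
    calc _ ≤ ‖ψ - e v‖ + ‖ψ - e v‖ + ‖φ - e (A v)‖ * h :=
          (norm_sub_le _ _).trans (add_le_add ((norm_sub_le _ _).trans (by gcongr)) e2)
      _ ≤ ε / (2 + h) + ε / (2 + h) + ε / (2 + h) * h := by gcongr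
      _ = ε := by field_simp; ring
  · intro hlim
    -- Minus the generator of a contraction semigroup is accretive, so adding the identity to it
    -- does not shrink the norm.
    have hacc : ∀ ψ φ : H,
        Tendsto (fun h : ℝ => ((h⁻¹ : ℝ) : ℂ) • (ψ - S h ψ)) (𝓝[>] 0) (𝓝 φ) →
        ‖ψ‖ ≤ ‖ψ + φ‖ := by
      intro ψ φ h
      have h1 : 0 ≤ (⟪ψ, φ⟫_ℂ).re := by
        refine ge_of_tendsto ((Complex.continuous_re.tendsto _).comp (tendsto_const_nhds.inner h))
          (eventually_nhdsWithin_of_forall fun u (hu : 0 < u) => ?_)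
        simp only [Function.comp_apply]
        rw [inner_smul_right, Complex.re_ofReal_mul, inner_sub_right, Complex.sub_re]
        refine mul_nonneg (inv_nonneg.2 hu.le) (sub_nonneg.2 ?_)
        refine (Complex.re_le_norm _).trans ((norm_inner_le_norm _ _).trans ?_)
        rw [show (⟪ψ, ψ⟫_ℂ).re = ‖ψ‖ * ‖ψ‖ from
          (inner_self_eq_norm_mul_norm (𝕜 := ℂ) ψ)]
        exact mul_le_mul_of_nonneg_left (((S u).le_opNorm _).trans
          (mul_le_of_le_one_left (norm_nonneg _) (hcontr _ hu.le))) (norm_nonneg _)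
      have h2 : ‖ψ‖ * ‖ψ‖ ≤ ‖ψ‖ * ‖ψ + φ‖ := by
        calc ‖ψ‖ * ‖ψ‖ = (⟪ψ, ψ⟫_ℂ).re := (inner_self_eq_norm_mul_norm (𝕜 := ℂ) ψ).symm
          _ ≤ (⟪ψ, ψ + φ⟫_ℂ).re := by rw [inner_add_right, Complex.add_re]; linarith
          _ ≤ ‖ψ‖ * ‖ψ + φ‖ := (Complex.re_le_norm _).trans (norm_inner_le_norm _ _)
      rcases (norm_nonneg ψ).eq_or_lt with h0 | h0
      · rw [← h0]; exact norm_nonneg _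
      · exact le_of_mul_le_mul_left h2 h0
    -- the range of `1 + A` is dense
    have hrange : DenseRange (e + e ∘ₗ A) := by
      have : (LinearMap.range (e + e ∘ₗ A)).topologicalClosure = ⊤ := by
        rw [Submodule.topologicalClosure_eq_top_iff, Submodule.eq_bot_iff]
        intro χ hχ
        have horth : ∀ v, ⟪χ, e (A v)⟫_ℂ = -⟪χ, e v⟫_ℂ := fun v => by
          have := (Submodule.mem_orthogonal' _ _).1 hχ _ ⟨v, rfl⟩
          rw [LinearMap.add_apply, inner_add_right, LinearMap.comp_apply] at this
          linear_combination this
        -- Along an orbit inside the invariant subspace, `s ↦ ⟨χ, S s (e v)⟩` solves `y' = y`, so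
        -- `e^{-s} y(s)` is constant. As `y` is bounded, letting `s → ∞` shows that the constant is
        -- zero.
        have hzero : ∀ v, ⟪χ, e v⟫_ℂ = 0 := by
          intro v
          have hk : ∀ T : ℝ, 0 ≤ T → Complex.exp (-T) * ⟪χ, S T (e v)⟫_ℂ = ⟪χ, e v⟫_ℂ := by
            intro T hT
            have hc1 : ContinuousOn (fun s : ℝ => Complex.exp (-s) * ⟪χ, S s (e v)⟫_ℂ)
                (Set.Icc 0 T) := by
              refine ContinuousOn.mul (by fun_prop) ?_
              exact continuousOn_const.inner ((hcont (e v)).mono Set.Icc_subset_Ici_self)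
            have hd : ∀ s ∈ Set.Ico 0 T, HasDerivWithinAt
                (fun s : ℝ => Complex.exp (-s) * ⟪χ, S s (e v)⟫_ℂ) 0 (Set.Ici s) s := by
              intro s hs
              obtain ⟨w, hw⟩ := hinv s hs.1 v
              have h1 : HasDerivWithinAt (fun s : ℝ => ⟪χ, S s (e v)⟫_ℂ) ⟪χ, S s (e v)⟫_ℂ
                  (Set.Ici s) s := by
                refine hasDerivWithinAt_Ici_of_tendsto ?_
                have h2 := (tendsto_const_nhds (x := χ).inner (𝕜 := ℂ)
                  (hderiv (e w) (e (A w)) (hgen w))).neg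
                have h3 : -⟪χ, e (A w)⟫_ℂ = ⟪χ, S s (e v)⟫_ℂ := by rw [horth, neg_neg, hw]
                rw [← h3]
                refine h2.congr' ?_
                filter_upwards [self_mem_nhdsWithin] with u hu
                rw [hadd u s (le_of_lt hu) hs.1, ContinuousLinearMap.comp_apply, hw]
                simp only [inner_smul_right, inner_sub_right,
                  Complex.real_smul, horth]
                ring
              have h4 : HasDerivWithinAt (fun s : ℝ => Complex.exp (-s)) (-Complex.exp (-s))
                  (Set.Ici s) s := by
                have := ((Complex.ofRealCLM.hasDerivAt (x := s)).neg.cexp).hasDerivWithinAt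
                  (s := Set.Ici s)
                simpa using this
              have h5 := h4.mul h1
              rwa [neg_mul, neg_add_cancel] at h5
            simpa [h0] using constant_of_has_deriv_right_zero hc1 hd T ⟨hT, le_rfl⟩
          have hb : ∀ T : ℝ, 0 ≤ T → ‖⟪χ, e v⟫_ℂ‖ ≤ Real.exp (-T) * (‖χ‖ * ‖e v‖) := by
            intro T hT
            rw [← hk T hT, norm_mul, Complex.norm_exp]
            simp only [Complex.neg_re, Complex.ofReal_re]
            gcongr
            refine (norm_inner_le_norm _ _).trans ?_
            gcongr
            exact ((S T).le_opNorm _).trans (mul_le_of_le_one_left (norm_nonneg _) (hcontr _ hT))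
          have hl : Tendsto (fun T : ℝ => Real.exp (-T) * (‖χ‖ * ‖e v‖)) atTop (𝓝 0) := by
            simpa using (Real.tendsto_exp_neg_atTop_nhds_zero.mul_const (‖χ‖ * ‖e v‖))
          exact norm_le_zero_iff.1 (ge_of_tendsto hl ((eventually_ge_atTop 0).mono hb))
        exact (hdense.induction_on (p := fun y => ⟪χ, y⟫_ℂ = 0) χ
          (isClosed_eq (by fun_prop) continuous_const) hzero |> inner_self_eq_zero.1)
      have h2 := (Submodule.dense_iff_topologicalClosure_eq_top).2 this
      rwa [LinearMap.coe_range] at h2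
    rw [Metric.mem_closure_iff]
    intro ε hε
    -- A vector `v` with `(1 + A) v` close to `ψ + φ` approximates both components: accretivity
    -- controls `ψ - e v`, and the difference then controls `φ - e (A v)`.
    obtain ⟨v, hv⟩ := Metric.denseRange_iff.1 hrange (ψ + φ) (ε / 2) (by positivity)
    refine ⟨_, ⟨v, rfl⟩, ?_⟩
    have hv' : ‖(ψ - e v) + (φ - e (A v))‖ < ε / 2 := by
      rw [dist_eq_norm] at hv
      have h1 : (ψ - e v) + (φ - e (A v)) = ψ + φ - (e + e ∘ₗ A) v := by
        change _ = ψ + φ - (e v + e (A v))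
        abel
      rwa [h1]
    have h1 := hacc (ψ - e v) (φ - e (A v)) (by
      refine (hlim.sub (hderiv _ _ (hgen v))).congr fun u => ?_
      rw [← smul_sub, map_sub]
      congr 1
      abel)
    have h2 : ‖φ - e (A v)‖ < ε := by
      calc ‖φ - e (A v)‖ = ‖((ψ - e v) + (φ - e (A v))) - (ψ - e v)‖ := by congr 1; abel
        _ ≤ _ := norm_sub_le _ _
        _ < ε := by linarith
    rw [Prod.dist_eq, max_lt_iff, dist_eq_norm, dist_eq_norm]
    exact ⟨by linarith, h2⟩

end Semigroup

/-! ### Operators on `L²(ℝ^d)` with pointwise bounded values -/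

section PointwiseOperators

variable {d : ℕ}

theorem L2.norm_sq_eq_integral (g : L2 d) : ‖g‖ ^ 2 = ∫ x, ‖g x‖ ^ 2 := by
  have h : ((‖g‖ ^ 2 : ℝ) : ℂ) = ∫ x, ((‖g x‖ ^ 2 : ℝ) : ℂ) := by
    have h1 := inner_self_eq_norm_sq_to_K (𝕜 := ℂ) g
    rw [L2.inner_def] at h1
    push_cast
    refine h1.symm.trans (integral_congr_ae (Eventually.of_forall fun x => ?_))
    simp
  have h2 : ∫ x, ((‖g x‖ ^ 2 : ℝ) : ℂ) = ((∫ x, ‖g x‖ ^ 2 : ℝ) : ℂ) :=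
    integral_ofReal (𝕜 := ℂ) (f := fun x => ‖g x‖ ^ 2)
  exact Complex.ofReal_injective (h.trans h2)

theorem L2.integrable_norm_sq (g : L2 d) : Integrable fun x => ‖g x‖ ^ 2 :=
  (memLp_two_iff_integrable_sq_norm (Lp.aestronglyMeasurable g)).1 (Lp.memLp g)

/-- For each `x` the functional `a x` is represented by a vector of norm at most `C x`, so Bessel's
inequality bounds the sum of the `|A (b i) (x)|²` by `C x ^ 2`. Integration over `x` gives the
Hilbert–Schmidt bound. -/
theorem summable_norm_sq_of_pointwise_bound {ι : Type} (b : HilbertBasis ι ℂ (L2 d))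
    {A : L2 d →L[ℂ] L2 d} {a : Rd d → L2 d →L[ℂ] ℂ} (hA : ∀ g, A g =ᵐ[volume] fun x => a x g)
    {C : Rd d → ℝ} (hC : ∀ x, ‖a x‖ ≤ C x) (hint : Integrable fun x => C x ^ 2) :
    Summable fun i => ‖A (b i)‖ ^ 2 := by
  refine summable_of_sum_le (c := ∫ x, C x ^ 2) (fun i => by positivity) fun F => ?_
  have h1 : ∀ i, Integrable fun x => ‖A (b i) x‖ ^ 2 := fun i => L2.integrable_norm_sq _
  simp only [L2.norm_sq_eq_integral]
  rw [← integral_finsetSum _ fun i _ => h1 i]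
  refine integral_mono_ae (integrable_finsetSum _ fun i _ => h1 i) hint ?_
  have h2 : ∀ᵐ x, ∀ i ∈ F, A (b i) x = a x (b i) :=
    (Finset.eventually_all F).2 fun i _ => hA (b i)
  filter_upwards [h2] with x hx
  set y := (InnerProductSpace.toDual ℂ (L2 d)).symm (a x) with hy
  have hyn : ‖y‖ ≤ C x := by rw [hy, LinearIsometryEquiv.norm_map]; exact hC x
  calc ∑ i ∈ F, ‖A (b i) x‖ ^ 2 = ∑ i ∈ F, ‖⟪b i, y⟫_ℂ‖ ^ 2 := Finset.sum_congr rfl fun i hi => by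
        rw [hx i hi, ← inner_conj_symm, Complex.norm_conj, hy, InnerProductSpace.toDual_symm_apply]
    _ ≤ ‖y‖ ^ 2 := b.orthonormal.sum_inner_products_le y
    _ ≤ C x ^ 2 := pow_le_pow_left₀ (norm_nonneg _) hyn 2

/-- Basis vectors are at mutual distance `√2`, so the balls of radius 1/2 around them are disjoint
open sets of a separable space. Countability permits null sets to be collected and sum and integral
to be exchanged. -/
theorem HilbertBasis.countable_index {ι : Type} (b : HilbertBasis ι ℂ (L2 d)) : Countable ι := by
  have : Fact ((2 : ENNReal) ≠ ⊤) := ⟨by norm_num⟩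
  have : SecondCountableTopology (L2 d) := Lp.SecondCountableTopology
  refine Set.countable_univ_iff.1 ?_
  refine Set.PairwiseDisjoint.countable_of_isOpen (s := fun i => Metric.ball (b i) (1 / 2))
    (fun i _ j _ hij => ?_) (fun i _ => Metric.isOpen_ball) fun i _ => ⟨b i, by simp⟩
  refine Metric.ball_disjoint_ball ?_
  have h1 : ‖b i - b j‖ ^ 2 = 2 := by
    have := @norm_sub_sq ℂ _ _ _ _ (b i) (b j)
    rw [b.orthonormal.1 i, b.orthonormal.1 j, b.orthonormal.2 hij] at this
    rw [this]; norm_num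
  rw [dist_eq_norm]
  nlinarith [norm_nonneg (b i - b j)]

/-- The trace of a product of two operators with square integrable pointwise bounds. -/
theorem hasTrace_comp_of_pointwise {A B : L2 d →L[ℂ] L2 d} {a : Rd d → L2 d →L[ℂ] ℂ}
    {β : Rd d → L2 d} (hA : ∀ g, A g =ᵐ[volume] fun x => a x g)
    (hB : ∀ g, B g =ᵐ[volume] fun x => ⟪β x, g⟫_ℂ) (hsa : ∀ g h, ⟪B g, h⟫_ℂ = ⟪g, B h⟫_ℂ)
    {C D : Rd d → ℝ} (hC : ∀ x, ‖a x‖ ≤ C x) (hCint : Integrable fun x => C x ^ 2)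
    (hD : ∀ x, ‖β x‖ ≤ D x) (hDint : Integrable fun x => D x ^ 2) :
    HasTrace (A.comp B) (∫ x, a x (β x)) := by
  have hsA : ∀ {ι : Type} (b : HilbertBasis ι ℂ (L2 d)), Summable fun i => ‖A (b i)‖ ^ 2 :=
    fun b => summable_norm_sq_of_pointwise_bound b hA hC hCint
  have hsB : ∀ {ι : Type} (b : HilbertBasis ι ℂ (L2 d)), Summable fun i => ‖B (b i)‖ ^ 2 :=
    fun b => summable_norm_sq_of_pointwise_bound b (a := fun x => innerSL ℂ (β x)) hB
      (fun x => by rw [innerSL_apply_norm]; exact hD x) hDint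
  refine ⟨?_, fun ι b => ?_⟩
  · obtain ⟨w, b, -⟩ := exists_hilbertBasis ℂ (L2 d)
    exact isTraceClass_comp b A B (hsA b) (hsB b)
  · have := b.countable_index
    -- After exchanging the factors, symmetry of `B` turns the diagonal coefficients into `⟨B (b i),
    -- A (b i)⟩`, which are integrals of functions known pointwise.
    refine hasSum_inner_comp_comm b A B (hsA b) (hsB b) ?_
    have hi : ∀ i, Integrable fun x => ⟪B (b i) x, A (b i) x⟫_ℂ := fun i =>
      L2.integrable_inner _ _
    have hterm : ∀ i, ⟪b i, B (A (b i))⟫_ℂ = ∫ x, ⟪B (b i) x, A (b i) x⟫_ℂ := fun i => by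
      rw [← hsa, L2.inner_def]
    have hbd : ∀ i, ∫ x, ‖⟪B (b i) x, A (b i) x⟫_ℂ‖ ≤ ‖B (b i)‖ ^ 2 + ‖A (b i)‖ ^ 2 := fun i => by
      rw [L2.norm_sq_eq_integral, L2.norm_sq_eq_integral,
        ← integral_add (L2.integrable_norm_sq _) (L2.integrable_norm_sq _)]
      refine integral_mono (hi i).norm
        ((L2.integrable_norm_sq _).add (L2.integrable_norm_sq _)) fun x => ?_
      refine (norm_inner_le_norm _ _).trans ?_
      nlinarith [sq_nonneg (‖B (b i) x‖ - ‖A (b i) x‖), norm_nonneg (B (b i) x),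
        norm_nonneg (A (b i) x)]
    have hsum := hasSum_integral_of_summable_integral_norm hi
      (Summable.of_nonneg_of_le (fun i => integral_nonneg fun x => norm_nonneg _) hbd
        ((hsB b).add (hsA b)))
    -- At a fixed `x` this is Parseval's identity for `β x` and the vector representing `a x`.
    have hlim : ∫ x, ∑' i, ⟪B (b i) x, A (b i) x⟫_ℂ = ∫ x, a x (β x) := by
      refine integral_congr_ae ?_
      filter_upwards [ae_all_iff.2 fun i => hA (b i), ae_all_iff.2 fun i => hB (b i)] with x h1 h2
      have h3 := b.hasSum_inner_mul_inner ((InnerProductSpace.toDual ℂ (L2 d)).symm (a x)) (β x)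
      rw [InnerProductSpace.toDual_symm_apply] at h3
      rw [← h3.tsum_eq]
      refine tsum_congr fun i => ?_
      rw [h1 i, h2 i, InnerProductSpace.toDual_symm_apply, RCLike.inner_apply, inner_conj_symm]
    rw [← hlim]
    exact hsum.congr_fun fun i => hterm i

end PointwiseOperators

/-! ### Gaussian functions as Schwartz functions -/

section Gaussian

variable {d : ℕ}

theorem one_add_pow_mul_exp_neg_le {c : ℝ} (hc : 0 < c) (m : ℕ) :
    ∃ K : ℝ, 0 < K ∧ ∀ r : ℝ, 0 ≤ r → (1 + r) ^ m * Real.exp (-c * r ^ 2) ≤ K := by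
  -- The constant combines `(1 + r)^m ≤ m! e^{1+r}` with the maximum `1/(4c)` of `r - c r²`.
  refine ⟨m.factorial * Real.exp (1 + 1 / (4 * c)), by positivity, fun r hr => ?_⟩
  have h1 := Real.pow_div_factorial_le_exp (1 + r) (by positivity) m
  rw [div_le_iff₀ (by positivity)] at h1
  have h2 : 1 + r + -c * r ^ 2 ≤ 1 + 1 / (4 * c) := by
    have h : 1 / (4 * c) - (r - c * r ^ 2) = (2 * c * r - 1) ^ 2 / (4 * c) := by
      field_simp
      ring
    have h' : 0 ≤ (2 * c * r - 1) ^ 2 / (4 * c) := by positivity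
    linarith
  calc (1 + r) ^ m * Real.exp (-c * r ^ 2)
      ≤ Real.exp (1 + r) * m.factorial * Real.exp (-c * r ^ 2) := by gcongr
    _ = m.factorial * Real.exp (1 + r + -c * r ^ 2) := by rw [Real.exp_add (1 + r)]; ring
    _ ≤ _ := by gcongr

/-- The derivative of `exp` over the reals is multiplication by `exp`, and the embedding of `ℂ` into
its multiplication operators has norm at most 1. -/
theorem norm_iteratedFDeriv_cexp_le (n : ℕ) (z : ℂ) :
    ‖iteratedFDeriv ℝ n Complex.exp z‖ ≤ ‖Complex.exp z‖ := by
  induction n with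
  | zero => simp
  | succ n ih =>
    rw [← norm_iteratedFDeriv_fderiv]
    have h : fderiv ℝ Complex.exp = ContinuousLinearMap.mul ℝ ℂ ∘ Complex.exp := by
      funext w
      have := (Complex.hasStrictFDerivAt_exp_real w).hasFDerivAt.fderiv
      rw [this]
      ext y
      simp [smul_eq_mul]
    rw [h]
    refine ((ContinuousLinearMap.mul ℝ ℂ).norm_iteratedFDeriv_comp_left (N := ω)
      Complex.contDiff_exp.contDiffAt (by exact le_top)).trans ?_
    exact (mul_le_of_le_one_left (norm_nonneg _) (ContinuousLinearMap.opNorm_mul_le ℝ ℂ)).trans ih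

/-- The exponential of a function of temperate growth that is bounded above by a negative definite
quadratic function. -/
def expSchwartz (f : Rd d → ℂ) (hf : f.HasTemperateGrowth)
    (hre : ∃ c C : ℝ, 0 < c ∧ ∀ x, (f x).re ≤ C - c * ‖x‖ ^ 2) : 𝓢(Rd d, ℂ) where
  toFun x := Complex.exp (f x)
  smooth' := Complex.contDiff_exp.comp hf.1
  decay' k n := by
    obtain ⟨c, C, hc, hre⟩ := hre
    obtain ⟨m, K, hK, hKb⟩ := hf.norm_iteratedFDeriv_le_uniform n
    obtain ⟨B, hB, hBb⟩ := one_add_pow_mul_exp_neg_le hc (k + m * n)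
    refine ⟨n.factorial * (K + 1) ^ n * Real.exp C * B, fun x => ?_⟩
    have h1 : ‖iteratedFDeriv ℝ n (Complex.exp ∘ f) x‖ ≤
        n.factorial * ‖Complex.exp (f x)‖ * ((K + 1) * (1 + ‖x‖) ^ m) ^ n := by
      refine norm_iteratedFDeriv_comp_le (N := ∞) Complex.contDiff_exp hf.1
        (by exact_mod_cast le_top) x (fun i _ => norm_iteratedFDeriv_cexp_le i _) fun i hi hin => ?_
      -- The constant `K + 1` makes the bound at least 1, hence dominated by its own positive
      -- powers, which is the form needed by the estimate for derivatives of compositions.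
      have h2 : (1 : ℝ) ≤ (K + 1) * (1 + ‖x‖) ^ m := by
        have : (1 : ℝ) ≤ (1 + ‖x‖) ^ m := one_le_pow₀ (by linarith [norm_nonneg x])
        nlinarith
      calc ‖iteratedFDeriv ℝ i f x‖ ≤ K * (1 + ‖x‖) ^ m := hKb i hin x
        _ ≤ (K + 1) * (1 + ‖x‖) ^ m := by gcongr; linarith
        _ ≤ _ := le_self_pow₀ h2 (by omega)
    have h3 : ‖Complex.exp (f x)‖ ≤ Real.exp C * Real.exp (-c * ‖x‖ ^ 2) := by
      rw [Complex.norm_exp, ← Real.exp_add]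
      exact Real.exp_le_exp.2 (by linarith [hre x])
    have h4 : ‖x‖ ^ k ≤ (1 + ‖x‖) ^ k :=
      pow_le_pow_left₀ (norm_nonneg _) (by linarith [norm_nonneg x]) k
    calc ‖x‖ ^ k * ‖iteratedFDeriv ℝ n (fun x => Complex.exp (f x)) x‖
        ≤ (1 + ‖x‖) ^ k * (n.factorial * (Real.exp C * Real.exp (-c * ‖x‖ ^ 2)) *
          ((K + 1) * (1 + ‖x‖) ^ m) ^ n) := by
          refine mul_le_mul h4 (h1.trans (by gcongr)) (norm_nonneg _) (by positivity)
      _ = n.factorial * (K + 1) ^ n * Real.exp C *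
          ((1 + ‖x‖) ^ (k + m * n) * Real.exp (-c * ‖x‖ ^ 2)) := by
          rw [mul_pow, ← pow_mul, pow_add]; ring
      _ ≤ _ := by
          gcongr
          exact hBb _ (norm_nonneg x)

theorem hasTemperateGrowth_coord (i : Fin d) :
    (fun x : Rd d => ((x i : ℝ) : ℂ)).HasTemperateGrowth :=
  (Complex.ofRealCLM ∘L (EuclideanSpace.proj i : Rd d →L[ℝ] ℝ)).hasTemperateGrowth

theorem hasTemperateGrowth_norm_sq_ofReal :
    (fun x : Rd d => ((‖x‖ ^ 2 : ℝ) : ℂ)).HasTemperateGrowth := by fun_prop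

/-- The exponent `-c |x|² + ∑ u_i x_i`. -/
def gaussExponent (c : ℝ) (u : Fin d → ℂ) (x : Rd d) : ℂ :=
  -c * ((‖x‖ ^ 2 : ℝ) : ℂ) + ∑ i, u i * x i

theorem gaussExponent_hasTemperateGrowth (c : ℝ) (u : Fin d → ℂ) :
    (gaussExponent c u).HasTemperateGrowth := by
  refine ((Function.HasTemperateGrowth.const _).mul hasTemperateGrowth_norm_sq_ofReal).add ?_
  have : (fun x : Rd d => ∑ i, u i * (x i : ℂ)).HasTemperateGrowth :=
    Function.HasTemperateGrowth.sum fun i _ =>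
      (Function.HasTemperateGrowth.const _).mul (hasTemperateGrowth_coord i)
  exact this

theorem norm_sum_mul_coord_le (u : Fin d → ℂ) (x : Rd d) :
    ‖∑ i, u i * (x i : ℂ)‖ ≤ (∑ i, ‖u i‖) * ‖x‖ := by
  rw [Finset.sum_mul]
  refine (norm_sum_le _ _).trans (Finset.sum_le_sum fun i _ => ?_)
  rw [norm_mul, Complex.norm_real]
  gcongr
  exact PiLp.norm_apply_le x i

theorem gaussExponent_re_le {c : ℝ} (hc : 0 < c) (u : Fin d → ℂ) :
    ∃ c' C : ℝ, 0 < c' ∧ ∀ x, (gaussExponent c u x).re ≤ C - c' * ‖x‖ ^ 2 := by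
  set U := ∑ i, ‖u i‖
  -- Half of the quadratic term absorbs the linear one: `U r ≤ c r²/2 + U²/(2c)`.
  refine ⟨c / 2, U ^ 2 / (2 * c), by positivity, fun x => ?_⟩
  have h1 : (gaussExponent c u x).re ≤ -c * ‖x‖ ^ 2 + U * ‖x‖ := by
    rw [gaussExponent, Complex.add_re]
    refine add_le_add (le_of_eq ?_) ((Complex.re_le_norm _).trans (norm_sum_mul_coord_le u x))
    rw [← Complex.ofReal_neg, ← Complex.ofReal_mul, Complex.ofReal_re]
  have h2 : U ^ 2 / (2 * c) - c / 2 * ‖x‖ ^ 2 - (-c * ‖x‖ ^ 2 + U * ‖x‖) =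
      (U - c * ‖x‖) ^ 2 / (2 * c) := by
    field_simp
    ring
  have h3 : 0 ≤ (U - c * ‖x‖) ^ 2 / (2 * c) := by positivity
  linarith

open Classical in
/-- The Schwartz function `exp (-c |x|² + ∑ u_i x_i)`, for `c > 0`. -/
def gauss (c : ℝ) (u : Fin d → ℂ) : 𝓢(Rd d, ℂ) :=
  -- The default value for `c ≤ 0` keeps positivity proofs out of the arguments, so widths can be
  -- rewritten freely.
  if h : 0 < c then
    expSchwartz (gaussExponent c u) (gaussExponent_hasTemperateGrowth c u) (gaussExponent_re_le h u)
  else 0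

theorem gauss_apply {c : ℝ} (hc : 0 < c) (u : Fin d → ℂ) (x : Rd d) :
    gauss c u x = Complex.exp (-c * ((‖x‖ ^ 2 : ℝ) : ℂ) + ∑ i, u i * x i) := by
  rw [gauss, dif_pos hc]
  rfl

theorem gauss_mul_gauss {c c' : ℝ} (hc : 0 < c) (hc' : 0 < c') (u u' : Fin d → ℂ) (x : Rd d) :
    gauss c u x * gauss c' u' x = gauss (c + c') (u + u') x := by
  rw [gauss_apply hc, gauss_apply hc', gauss_apply (add_pos hc hc'), ← Complex.exp_add]
  congr 1
  simp only [Pi.add_apply, add_mul, Finset.sum_add_distrib]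
  push_cast
  ring

theorem sq_norm_eq_sum (x : Rd d) : ‖x‖ ^ 2 = ∑ i, x i ^ 2 := by
  rw [EuclideanSpace.norm_sq_eq]
  simp

theorem real_inner_eq_sum (x y : Rd d) : ⟪x, y⟫_ℝ = ∑ i, x i * y i := by
  rw [PiLp.inner_apply]
  exact Finset.sum_congr rfl fun i _ => by simp [mul_comm]

theorem cpow_div_two_eq_sqrt_pow {r : ℝ} (hr : 0 ≤ r) (d : ℕ) :
    (r : ℂ) ^ ((d : ℂ) / 2) = ((Real.sqrt r ^ d : ℝ) : ℂ) := by
  rw [show (d : ℂ) / 2 = (((d : ℝ) / 2 : ℝ) : ℂ) by push_cast; ring, ← Complex.ofReal_cpow hr,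
    Real.sqrt_eq_rpow, ← Real.rpow_natCast, ← Real.rpow_mul hr]
  congr 2
  ring

theorem integral_gauss {c : ℝ} (hc : 0 < c) (u : Fin d → ℂ) :
    ∫ x, gauss c u x =
      ((Real.sqrt (Real.pi / c) ^ d : ℝ) : ℂ) * Complex.exp ((∑ i, u i ^ 2) / (4 * c)) := by
  have h := GaussianFourier.integral_cexp_neg_mul_sum_add (b := (c : ℂ)) (by simpa using hc) u
  rw [← (PiLp.volume_preserving_toLp (Fin d)).integral_comp
    (MeasurableEquiv.toLp 2 _).measurableEmbedding]
  rw [Fintype.card_fin, ← Complex.ofReal_div, cpow_div_two_eq_sqrt_pow (by positivity)] at h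
  rw [← h]
  refine integral_congr_ae (Eventually.of_forall fun v => ?_)
  simp only [gauss_apply hc, sq_norm_eq_sum]
  push_cast
  rfl

end Gaussian

/-! ### A smoothing operator from `L²` to Schwartz functions -/

section Smoothing

variable {d : ℕ}

theorem memLp_pow_mul_schwartz (φ : 𝓢(Rd d, ℂ)) (n : ℕ) :
    MemLp (fun y => ‖y‖ ^ n * ‖φ y‖) 2 volume := by
  have hm : AEStronglyMeasurable (fun y => ‖y‖ ^ n * ‖φ y‖) volume :=
    Continuous.aestronglyMeasurable (by have := φ.continuous; fun_prop)
  refine (memLp_two_iff_integrable_sq_norm hm).2 ?_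
  obtain ⟨K, -, hK⟩ := φ.decay n 0
  refine Integrable.mono' (g := fun y => K * (‖y‖ ^ n * ‖φ y‖))
    ((φ.integrable_pow_mul volume n).const_mul K) (hm.norm.pow 2) (Eventually.of_forall fun y => ?_)
  have h := hK y
  rw [norm_iteratedFDeriv_zero] at h
  have h0 : 0 ≤ ‖y‖ ^ n * ‖φ y‖ := by positivity
  rw [Real.norm_of_nonneg (by positivity), Real.norm_of_nonneg h0]
  nlinarith

theorem integrable_pow_mul_schwartz_mul (φ : 𝓢(Rd d, ℂ)) (n : ℕ) (g : L2 d) :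
    Integrable fun y => ‖y‖ ^ n * ‖φ y * g y‖ := by
  have h := (memLp_pow_mul_schwartz φ n).integrable_mul (Lp.memLp g).norm
  refine h.congr (Eventually.of_forall fun y => ?_)
  simp [mul_assoc]

theorem integral_pow_mul_schwartz_mul_le (φ : 𝓢(Rd d, ℂ)) (n : ℕ) :
    ∃ K : ℝ, 0 ≤ K ∧ ∀ g : L2 d, ∫ y, ‖y‖ ^ n * ‖φ y * g y‖ ≤ K * ‖g‖ := by
  refine ⟨(∫ y, (‖y‖ ^ n * ‖φ y‖) ^ (2 : ℝ)) ^ (1 / 2 : ℝ), by positivity, fun g => ?_⟩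
  have h := integral_mul_norm_le_Lp_mul_Lq (μ := (volume : Measure (Rd d))) (p := 2) (q := 2)
    (f := fun y : Rd d => ‖y‖ ^ n * ‖φ y‖) (g := fun y => ‖g y‖) (Real.HolderConjugate.two_two)
    (by simpa using memLp_pow_mul_schwartz φ n) (by simpa using (Lp.memLp g).norm)
  have h2 : (∫ y, ‖‖g y‖‖ ^ (2 : ℝ)) ^ (1 / 2 : ℝ) = ‖g‖ := by
    have := L2.norm_sq_eq_integral g
    simp only [norm_norm, Real.rpow_two, ← this]
    rw [← Real.sqrt_eq_rpow, Real.sqrt_sq (norm_nonneg _)]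
  rw [h2] at h
  refine le_trans (le_of_eq (integral_congr_ae (Eventually.of_forall fun y => ?_))) (h.trans_eq ?_)
  · simp [mul_assoc]
  · congr 2
    refine integral_congr_ae (Eventually.of_forall fun y => ?_)
    simp

/-- A derivative of order `n` puts the weight `‖y‖ ^ n` under the Fourier integral. Against the
rapidly decreasing `φ` this costs only the `L²` norm of `g`, by Cauchy–Schwarz. -/
theorem norm_iteratedFDeriv_fourier_schwartz_mul_le (φ : 𝓢(Rd d, ℂ)) (n : ℕ) :
    ∃ K : ℝ, 0 ≤ K ∧ ∀ (g : L2 d) (k : Rd d),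
      ‖iteratedFDeriv ℝ n (FourierTransform.fourier fun y => φ y * g y) k‖ ≤ K * ‖g‖ := by
  obtain ⟨K, hK, hKb⟩ := integral_pow_mul_schwartz_mul_le φ n
  refine ⟨(2 * Real.pi) ^ n * K, by positivity, fun g k => ?_⟩
  rw [Real.iteratedFDeriv_fourier (N := ⊤) (fun m _ => integrable_pow_mul_schwartz_mul φ m g)
    (φ.continuous.aestronglyMeasurable.mul (Lp.aestronglyMeasurable g)) le_top]
  rw [Real.fourier_eq]
  refine (norm_integral_le_integral_norm _).trans ?_
  have hL : ‖(innerSL ℝ : Rd d →L[ℝ] Rd d →L[ℝ] ℝ)‖ ≤ 1 := norm_innerSL_le ℝ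
  have hmono : ∀ y : Rd d, ‖VectorFourier.fourierPowSMulRight (innerSL ℝ) (fun y => φ y * g y) y n‖
      ≤ (2 * Real.pi) ^ n * (‖y‖ ^ n * ‖φ y * g y‖) := fun y => by
    refine (VectorFourier.norm_fourierPowSMulRight_le _ _ _ _).trans ?_
    rw [mul_assoc]
    have h1 : 2 * Real.pi * ‖(innerSL ℝ : Rd d →L[ℝ] Rd d →L[ℝ] ℝ)‖ ≤ 2 * Real.pi :=
      mul_le_of_le_one_right (by positivity) hL
    exact mul_le_mul_of_nonneg_right (pow_le_pow_left₀ (by positivity) h1 n) (by positivity)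
  simp only [Circle.norm_smul]
  refine (integral_mono_of_nonneg (Eventually.of_forall fun y => norm_nonneg _)
    ((integrable_pow_mul_schwartz_mul φ n g).const_mul _) (Eventually.of_forall hmono)).trans ?_
  rw [integral_const_mul, mul_assoc]
  gcongr
  exact hKb g

theorem integrable_schwartz_mul (φ : 𝓢(Rd d, ℂ)) (g : L2 d) : Integrable fun y => φ y * g y :=
  MemLp.integrable_mul (φ.memLp 2 volume) (Lp.memLp g)

theorem contDiff_fourier_schwartz_mul (φ : 𝓢(Rd d, ℂ)) (g : L2 d) :
    ContDiff ℝ ∞ (FourierTransform.fourier fun y => φ y * g y) :=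
  Real.contDiff_fourier (N := ⊤) fun m _ => integrable_pow_mul_schwartz_mul φ m g

/-- Leibniz' rule lets `χ` supply the decay. Since the bound is linear in `‖g‖`, it gives both the
Schwartz property and the continuity of the map from `L²` into the Schwartz space. -/
theorem decay_schwartz_mul_fourier (φ χ : 𝓢(Rd d, ℂ)) (k n : ℕ) :
    ∃ K : ℝ, 0 ≤ K ∧ ∀ (g : L2 d) (x : Rd d), ‖x‖ ^ k * ‖iteratedFDeriv ℝ n
      (fun x => χ x * FourierTransform.fourier (fun y => φ y * g y) x) x‖ ≤ K * ‖g‖ := by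
  choose K hK hKb using norm_iteratedFDeriv_fourier_schwartz_mul_le φ
  refine ⟨∑ i ∈ Finset.range (n + 1),
    (n.choose i : ℝ) * SchwartzMap.seminorm ℝ k i χ * K (n - i), ?_, fun g x => ?_⟩
  · exact Finset.sum_nonneg fun i _ => mul_nonneg (mul_nonneg (by positivity) (apply_nonneg _ _))
      (hK _)
  · have h := norm_iteratedFDeriv_mul_le (χ.smooth ⊤) (contDiff_fourier_schwartz_mul φ g) x
      (n := n) (by exact_mod_cast le_top)
    refine (mul_le_mul_of_nonneg_left h (by positivity)).trans ?_
    rw [Finset.mul_sum, Finset.sum_mul]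
    refine Finset.sum_le_sum fun i _ => ?_
    have h1 := SchwartzMap.le_seminorm ℝ k i χ x
    have h2 := hKb (n - i) g x
    calc _ = (n.choose i : ℝ) * (‖x‖ ^ k * ‖iteratedFDeriv ℝ i χ x‖) *
        ‖iteratedFDeriv ℝ (n - i) (FourierTransform.fourier fun y => φ y * g y) x‖ := by ring
      _ ≤ (n.choose i : ℝ) * SchwartzMap.seminorm ℝ k i χ * (K (n - i) * ‖g‖) := by gcongr
      _ = _ := by ring

/-- The linear map `g ↦ χ 𝓕(φ g)` from `L²` to Schwartz functions. -/
def mulFourierMulLM (φ χ : 𝓢(Rd d, ℂ)) : L2 d →ₗ[ℂ] 𝓢(Rd d, ℂ) where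
  toFun g :=
    { toFun := fun x => χ x * FourierTransform.fourier (fun y => φ y * g y) x
      smooth' := (χ.smooth ⊤).mul (contDiff_fourier_schwartz_mul φ g)
      decay' := fun k n => by
        obtain ⟨K, -, h⟩ := decay_schwartz_mul_fourier φ χ k n
        exact ⟨K * ‖g‖, h g⟩ }
  map_add' g h := by
    ext x
    change χ x * _ = χ x * _ + χ x * _
    rw [← mul_add, Real.fourier_eq, Real.fourier_eq, Real.fourier_eq, ← integral_add]
    · congr 1
      refine integral_congr_ae ?_
      filter_upwards [Lp.coeFn_add g h] with y hy
      rw [hy, Pi.add_apply, ← smul_add, mul_add]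
    · exact (Real.fourierIntegral_convergent_iff x).2 (integrable_schwartz_mul φ g)
    · exact (Real.fourierIntegral_convergent_iff x).2 (integrable_schwartz_mul φ h)
  map_smul' c g := by
    ext x
    change χ x * _ = c * (χ x * _)
    rw [mul_left_comm, Real.fourier_eq, Real.fourier_eq, ← smul_eq_mul c, ← integral_smul]
    congr 1
    refine integral_congr_ae ?_
    filter_upwards [Lp.coeFn_smul c g] with y hy
    rw [hy, Pi.smul_apply, smul_comm c, smul_eq_mul, smul_eq_mul, mul_left_comm]

/-- The map `g ↦ χ 𝓕(φ g)` from `L²` to Schwartz functions. -/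
def mulFourierMul (φ χ : 𝓢(Rd d, ℂ)) : L2 d →L[ℂ] 𝓢(Rd d, ℂ) where
  toLinearMap := mulFourierMulLM φ χ
  cont := by
    refine WithSeminorms.continuous_normedSpace_dom (𝕝 := ℂ) (L2 d)
      (schwartz_withSeminorms ℂ (Rd d) ℂ) (mulFourierMulLM φ χ) fun p => ?_
    obtain ⟨K, hK, h⟩ := decay_schwartz_mul_fourier φ χ p.1 p.2
    refine ⟨⟨K, hK⟩, fun g => ?_⟩
    exact SchwartzMap.seminorm_le_bound ℂ p.1 p.2 _ (by positivity) (h g)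

theorem mulFourierMul_apply (φ χ : 𝓢(Rd d, ℂ)) (g : L2 d) (x : Rd d) :
    mulFourierMul φ χ g x = χ x * FourierTransform.fourier (fun y => φ y * g y) x := rfl

theorem mulFourierMul_schwartz (φ χ ψ : 𝓢(Rd d, ℂ)) :
    mulFourierMul φ χ (schwartzToL2 d ψ) = SchwartzMap.smulLeftCLM ℂ (χ : Rd d → ℂ)
      (FourierTransform.fourier (SchwartzMap.smulLeftCLM ℂ (φ : Rd d → ℂ) ψ)) := by
  ext x
  rw [mulFourierMul_apply, SchwartzMap.smulLeftCLM_apply_apply χ.hasTemperateGrowth, smul_eq_mul,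
    SchwartzMap.fourier_coe]
  congr 1
  rw [Real.fourier_eq, Real.fourier_eq]
  refine integral_congr_ae ?_
  filter_upwards [ψ.coeFn_toLp 2 volume] with y hy
  rw [SchwartzMap.smulLeftCLM_apply_apply φ.hasTemperateGrowth, smul_eq_mul]
  congr 2

/-- The operator `G 𝓕⁻¹ χ 𝓕 G`, where `G` is the multiplication by `φ`. -/
def smoothing (φ χ : 𝓢(Rd d, ℂ)) : L2 d →L[ℂ] 𝓢(Rd d, ℂ) :=
  SchwartzMap.smulLeftCLM ℂ (φ : Rd d → ℂ) ∘L
    (FourierTransform.fourierInvCLM ℂ 𝓢(Rd d, ℂ)) ∘L mulFourierMul φ χ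

theorem smoothing_schwartz (φ χ ψ : 𝓢(Rd d, ℂ)) :
    smoothing φ χ (schwartzToL2 d ψ) = SchwartzMap.smulLeftCLM ℂ (φ : Rd d → ℂ)
      (FourierTransformInv.fourierInv (SchwartzMap.smulLeftCLM ℂ (χ : Rd d → ℂ)
        (FourierTransform.fourier (SchwartzMap.smulLeftCLM ℂ (φ : Rd d → ℂ) ψ)))) := by
  simp [smoothing, mulFourierMul_schwartz]

theorem norm_schwartzToL2_smulLeft_le (φ ψ : 𝓢(Rd d, ℂ)) (hφ : ∀ x, ‖φ x‖ ≤ 1) :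
    ‖schwartzToL2 d (SchwartzMap.smulLeftCLM ℂ (φ : Rd d → ℂ) ψ)‖ ≤ ‖schwartzToL2 d ψ‖ := by
  refine Lp.norm_le_norm_of_ae_le ?_
  filter_upwards [ψ.coeFn_toLp 2 volume,
    (SchwartzMap.smulLeftCLM ℂ (φ : Rd d → ℂ) ψ).coeFn_toLp 2 volume] with y h1 h2
  change ‖(SchwartzMap.toLp _ 2 volume) y‖ ≤ ‖(SchwartzMap.toLp ψ 2 volume) y‖
  rw [h1, h2, SchwartzMap.smulLeftCLM_apply_apply φ.hasTemperateGrowth, norm_smul]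
  exact mul_le_of_le_one_left (norm_nonneg _) (hφ y)

theorem denseRange_schwartzToL2 (d : ℕ) : DenseRange (schwartzToL2 d) :=
  SchwartzMap.denseRange_toLpCLM (by norm_num)

/-- The inclusion of the Schwartz space into `L²` as a continuous map. -/
def schwartzToL2CLM (d : ℕ) : 𝓢(Rd d, ℂ) →L[ℂ] L2 d :=
  SchwartzMap.toLpCLM ℂ ℂ 2 (volume : Measure (Rd d))

theorem schwartzToL2CLM_apply (ψ : 𝓢(Rd d, ℂ)) : schwartzToL2CLM d ψ = schwartzToL2 d ψ := rfl

/-- The Fourier transform is isometric by Plancherel and each multiplication is a contraction;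
density of Schwartz functions does the rest. -/
theorem norm_smoothing_le (φ χ : 𝓢(Rd d, ℂ)) (hφ : ∀ x, ‖φ x‖ ≤ 1) (hχ : ∀ x, ‖χ x‖ ≤ 1) :
    ‖schwartzToL2CLM d ∘L smoothing φ χ‖ ≤ 1 := by
  refine ContinuousLinearMap.opNorm_le_bound _ zero_le_one fun g => ?_
  rw [one_mul]
  refine (denseRange_schwartzToL2 d).induction_on
    (p := fun g => ‖(schwartzToL2CLM d ∘L smoothing φ χ) g‖ ≤ ‖g‖) g
    (isClosed_le (by fun_prop) (by fun_prop)) fun ψ => ?_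
  rw [ContinuousLinearMap.comp_apply, smoothing_schwartz, schwartzToL2CLM_apply]
  refine (norm_schwartzToL2_smulLeft_le _ _ hφ).trans ?_
  have h1 : ∀ ψ : 𝓢(Rd d, ℂ), ‖schwartzToL2 d (FourierTransform.fourier ψ)‖ = ‖schwartzToL2 d ψ‖ :=
    fun ψ => SchwartzMap.norm_fourier_toL2_eq ψ
  rw [← h1 (FourierTransformInv.fourierInv _), FourierTransform.fourier_fourierInv_eq]
  refine (norm_schwartzToL2_smulLeft_le _ _ hχ).trans ?_
  rw [h1]
  exact norm_schwartzToL2_smulLeft_le _ _ hφ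

end Smoothing

/-! ### The Mehler semigroup on coherent states -/

section Coherent

variable {d : ℕ}

theorem fourier_gauss {c : ℝ} (hc : 0 < c) (u : Fin d → ℂ) :
    FourierTransform.fourier (gauss c u) =
      (((Real.sqrt (Real.pi / c) ^ d : ℝ) : ℂ) * Complex.exp ((∑ i, u i ^ 2) / (4 * c))) •
        gauss (Real.pi ^ 2 / c) (fun i => -(Complex.I * Real.pi / c) * u i) := by
  ext k
  have hc' : 0 < Real.pi ^ 2 / c := by positivity
  have h1 : ∀ y, Complex.exp (((-2 * Real.pi * ⟪y, k⟫_ℝ : ℝ) : ℂ) * Complex.I) • gauss c u y =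
      gauss c (fun i => u i - 2 * Real.pi * Complex.I * k i) y := fun y => by
    rw [gauss_apply hc, gauss_apply hc, smul_eq_mul, ← Complex.exp_add, real_inner_eq_sum]
    congr 1
    simp only [sub_mul, Finset.sum_sub_distrib]
    push_cast
    simp only [Finset.mul_sum, Finset.sum_mul]
    have : ∀ i, -2 * (Real.pi : ℂ) * (y i * k i) * Complex.I =
      -(2 * Real.pi * Complex.I * k i * y i) := fun i => by ring
    simp only [this, Finset.sum_neg_distrib]
    ring
  rw [SchwartzMap.fourier_coe, Real.fourier_eq', integral_congr_ae (Eventually.of_forall h1),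
    integral_gauss hc, _root_.smul_apply, gauss_apply hc', smul_eq_mul,
    mul_assoc (((Real.sqrt (Real.pi / c) ^ d : ℝ) : ℂ)), ← Complex.exp_add, sq_norm_eq_sum]
  congr 2
  have hcc : (c : ℂ) ≠ 0 := by exact_mod_cast hc.ne'
  push_cast
  rw [Finset.sum_div, Finset.sum_div, Finset.mul_sum, ← Finset.sum_add_distrib,
    ← Finset.sum_add_distrib]
  refine Finset.sum_congr rfl fun i _ => ?_
  field_simp
  linear_combination (4 * (Real.pi : ℂ) ^ 2 * (k i : ℂ) ^ 2) * Complex.I_sq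

theorem fourierInv_gauss {c : ℝ} (hc : 0 < c) (u : Fin d → ℂ) :
    FourierTransformInv.fourierInv (gauss c u) =
      (((Real.sqrt (Real.pi / c) ^ d : ℝ) : ℂ) * Complex.exp ((∑ i, u i ^ 2) / (4 * c))) •
        gauss (Real.pi ^ 2 / c) (fun i => (Complex.I * Real.pi / c) * u i) := by
  ext k
  have hc' : 0 < Real.pi ^ 2 / c := by positivity
  rw [SchwartzMap.fourierInv_coe, Real.fourierInv_eq_fourier_neg, ← SchwartzMap.fourier_coe,
    fourier_gauss hc, _root_.smul_apply, _root_.smul_apply, gauss_apply hc', gauss_apply hc',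
    norm_neg]
  congr 4
  funext i
  rw [PiLp.neg_apply]
  push_cast
  ring

theorem smulLeft_gauss {c c' : ℝ} (hc : 0 < c) (hc' : 0 < c') (u : Fin d → ℂ) :
    SchwartzMap.smulLeftCLM ℂ (gauss c' 0 : Rd d → ℂ) (gauss c u) = gauss (c + c') u := by
  ext x
  rw [SchwartzMap.smulLeftCLM_apply_apply (gauss c' 0).hasTemperateGrowth, smul_eq_mul, mul_comm,
    gauss_mul_gauss hc hc', add_zero]

theorem conj_gauss {c : ℝ} (hc : 0 < c) (u : Fin d → ℂ) (x : Rd d) :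
    (starRingEnd ℂ) (gauss c u x) = gauss c (fun i => (starRingEnd ℂ) (u i)) x := by
  rw [gauss_apply hc, gauss_apply hc, ← Complex.exp_conj]
  congr 1
  simp

theorem inner_schwartzToL2 (φ ψ : 𝓢(Rd d, ℂ)) :
    ⟪schwartzToL2 d φ, schwartzToL2 d ψ⟫_ℂ = ∫ x, (starRingEnd ℂ) (φ x) * ψ x := by
  refine (SchwartzMap.inner_toL2_toL2_eq φ ψ volume).trans ?_
  exact integral_congr_ae (Eventually.of_forall fun x => by simp [mul_comm])

theorem inner_schwartzToL2_left (φ : 𝓢(Rd d, ℂ)) (g : L2 d) :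
    ⟪schwartzToL2 d φ, g⟫_ℂ = ∫ x, (starRingEnd ℂ) (φ x) * g x := by
  rw [L2.inner_def]
  refine integral_congr_ae ?_
  filter_upwards [φ.coeFn_toLp 2 volume] with x hx
  change ⟪(SchwartzMap.toLp φ 2 volume) x, g x⟫_ℂ = _
  rw [hx, RCLike.inner_apply, mul_comm]

theorem inner_gauss_gauss {c : ℝ} (hc : 0 < c) (u v : Fin d → ℂ) :
    ⟪schwartzToL2 d (gauss c u), schwartzToL2 d (gauss c v)⟫_ℂ =
      ((Real.sqrt (Real.pi / (2 * c)) ^ d : ℝ) : ℂ) *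
        Complex.exp ((∑ i, ((starRingEnd ℂ) (u i) + v i) ^ 2) / (8 * c)) := by
  rw [inner_schwartzToL2]
  simp only [conj_gauss hc, gauss_mul_gauss hc hc]
  rw [integral_gauss (by positivity), ← two_mul]
  congr 3
  push_cast
  ring

/-- An integrable function whose Fourier transform vanishes is zero. -/
theorem ae_eq_zero_of_fourier_eq_zero {h : Rd d → ℂ} (hint : Integrable h)
    (hF : ∀ k, FourierTransform.fourier h k = 0) : h =ᵐ[volume] 0 := by
  refine ae_eq_zero_of_integral_contDiff_smul_eq_zero hint.locallyIntegrable fun g hg hgs => ?_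
  have hgs' : HasCompactSupport fun x => (g x : ℂ) := hgs.comp_left (g := Complex.ofReal) rfl
  have hg' : ContDiff ℝ ∞ fun x => (g x : ℂ) := Complex.ofRealCLM.contDiff.comp hg
  set G : 𝓢(Rd d, ℂ) := hgs'.toSchwartzMap hg' with hG
  set Φ : 𝓢(Rd d, ℂ) := FourierTransformInv.fourierInv G with hΦ
  have h1 : (FourierTransform.fourier (Φ : Rd d → ℂ)) = G := by
    rw [← SchwartzMap.fourier_coe, hΦ, FourierTransform.fourier_fourierInv_eq]
  -- The test function is the Fourier transform of the Schwartz function `Φ`, and the transform is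
  -- moved from `Φ` to `h`.
  have h2 := VectorFourier.integral_fourierIntegral_smul_eq_flip (L := innerₗ (Rd d))
    (e := Real.fourierChar) (μ := volume) (ν := volume) (f := h) (g := (Φ : Rd d → ℂ))
    Real.continuous_fourierChar continuous_inner hint Φ.integrable
  rw [flip_innerₗ] at h2
  have h3 : ∀ x, VectorFourier.fourierIntegral Real.fourierChar volume (innerₗ (Rd d))
    (Φ : Rd d → ℂ) x = g x := fun x => congrFun h1 x
  have h4 : ∀ x, VectorFourier.fourierIntegral Real.fourierChar volume (innerₗ (Rd d)) h x = 0 := hF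
  simp only [h3, h4, zero_smul, integral_zero] at h2
  rw [h2]
  exact integral_congr_ae (Eventually.of_forall fun x => by
    simp [Complex.real_smul, mul_comm])

/-- The coherent states, `exp (-c |x|² + i ⟨ξ, x⟩)`, are total in `L²`. -/
theorem eq_zero_of_inner_gauss_eq_zero {c : ℝ} (hc : 0 < c) {g : L2 d}
    (h : ∀ ξ : Fin d → ℝ, ⟪schwartzToL2 d (gauss c fun i => Complex.I * ξ i), g⟫_ℂ = 0) : g = 0 := by
  -- The inner product with the coherent state `ξ = 2πk` is the value at `k` of the Fourier
  -- transform of `g` times a Gaussian. That Gaussian has no zeros.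
  have hF : ∀ k, FourierTransform.fourier (fun y => gauss c 0 y * g y) k = 0 := fun k => by
    rw [← h fun i => 2 * Real.pi * k i, inner_schwartzToL2_left, Real.fourier_eq']
    refine integral_congr_ae (Eventually.of_forall fun y => ?_)
    simp only [conj_gauss hc, smul_eq_mul]
    rw [← mul_assoc]
    congr 1
    rw [gauss_apply hc, gauss_apply hc, ← Complex.exp_add, real_inner_eq_sum]
    congr 1
    push_cast
    simp only [Finset.mul_sum, Finset.sum_mul, Pi.zero_apply, zero_mul, Finset.sum_const_zero,
      map_mul, Complex.conj_I, map_ofNat, Complex.conj_ofReal]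
    rw [add_zero, add_comm]
    congr 1
    exact Finset.sum_congr rfl fun i _ => by ring
  have h0 := ae_eq_zero_of_fourier_eq_zero (integrable_schwartz_mul (gauss c 0) g) hF
  rw [Lp.eq_zero_iff_ae_eq_zero]
  filter_upwards [h0] with x hx
  rw [gauss_apply hc] at hx
  exact (mul_eq_zero.1 hx).resolve_left (Complex.exp_ne_zero _)

theorem dense_span_gauss {c : ℝ} (hc : 0 < c) :
    Dense (Submodule.span ℂ (Set.range fun ξ : Fin d → ℝ =>
      schwartzToL2 d (gauss c fun i => Complex.I * ξ i)) : Set (L2 d)) := by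
  rw [Submodule.dense_iff_topologicalClosure_eq_top, Submodule.topologicalClosure_eq_top_iff,
    Submodule.eq_bot_iff]
  intro g hg
  exact eq_zero_of_inner_gauss_eq_zero hc fun ξ =>
    (Submodule.mem_orthogonal _ _).1 hg _ (Submodule.subset_span ⟨ξ, rfl⟩)

/-- Through this lemma operator identities such as the semigroup law and the kernel formula become
identities between explicit Gaussians. -/
theorem ext_on_gauss {F : Type*} [TopologicalSpace F] [AddCommGroup F] [Module ℂ F] [T2Space F]
    {c : ℝ} (hc : 0 < c) {A B : L2 d →L[ℂ] F}
    (h : ∀ ξ : Fin d → ℝ, A (schwartzToL2 d (gauss c fun i => Complex.I * ξ i)) =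
      B (schwartzToL2 d (gauss c fun i => Complex.I * ξ i))) : A = B :=
  ContinuousLinearMap.ext_on (dense_span_gauss hc) (by rintro _ ⟨ξ, rfl⟩; exact h ξ)

/-- The operator `e^{-tH}`, `q = e^{-2Ωt} < 1`, as a map into Schwartz functions. -/
def heat (d : ℕ) (Ω q : ℝ) : L2 d →L[ℂ] 𝓢(Rd d, ℂ) :=
  -- This is the factorisation `e^{-½Ω tanh(Ωt)|x|²} e^{-sinh(2Ωt)|p|²/(2Ω)} e^{-½Ω tanh(Ωt)|x|²}`
  -- with `p = 2πξ`, since `(1 - q)/(1 + q) = tanh(Ωt)` and `(1 - q²)/q = 2 sinh(2Ωt)`.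
  smoothing (gauss (Ω / 2 * ((1 - q) / (1 + q))) 0)
    (gauss (Real.pi ^ 2 * (1 - q ^ 2) / (Ω * q)) 0)

theorem norm_gauss_zero_le_one {c : ℝ} (hc : 0 < c) (x : Rd d) : ‖gauss c 0 x‖ ≤ 1 := by
  rw [gauss_apply hc, Complex.norm_exp]
  simp only [Pi.zero_apply, zero_mul, Finset.sum_const_zero, add_zero]
  rw [← Complex.ofReal_neg, ← Complex.ofReal_mul, Complex.ofReal_re]
  exact Real.exp_le_one_iff.2 (by nlinarith [sq_nonneg ‖x‖])

variable {Ω q : ℝ}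

theorem norm_heat_le (hΩ : 0 < Ω) (hq : 0 < q) (hq1 : q < 1) :
    ‖schwartzToL2CLM d ∘L heat d Ω q‖ ≤ 1 := by
  have h1 : 0 < 1 - q := sub_pos.2 hq1
  have h2 : 0 < 1 - q ^ 2 := by nlinarith
  exact norm_smoothing_le _ _ (norm_gauss_zero_le_one (by positivity))
    (norm_gauss_zero_le_one (by positivity))

/-- The width `Ω/2` is the one restored after the three factors: it becomes `Ω/(1+q)`, is changed on
the Fourier side, and returns to `Ω/2`, while `u` is multiplied by `q`. -/
theorem heat_coherent (hΩ : 0 < Ω) (hq : 0 < q) (hq1 : q < 1) (u : Fin d → ℂ) :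
    heat d Ω q (schwartzToL2 d (gauss (Ω / 2) u)) =
      (((Real.sqrt q ^ d : ℝ) : ℂ) * Complex.exp ((1 - q ^ 2) * (∑ i, u i ^ 2) / (4 * Ω))) •
        gauss (Ω / 2) (fun i => q * u i) := by
  have h1 : 0 < 1 - q := sub_pos.2 hq1
  have h2 : 0 < 1 - q ^ 2 := by nlinarith
  have hc0 : 0 < Ω / 2 * ((1 - q) / (1 + q)) := by positivity
  have hk0 : 0 < Real.pi ^ 2 * (1 - q ^ 2) / (Ω * q) := by positivity
  have e1 : Ω / 2 + Ω / 2 * ((1 - q) / (1 + q)) = Ω / (1 + q) := by field_simp; ring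
  have hc1 : 0 < Ω / (1 + q) := by positivity
  have e2 : Real.pi ^ 2 / (Ω / (1 + q)) + Real.pi ^ 2 * (1 - q ^ 2) / (Ω * q) =
      Real.pi ^ 2 * (1 + q) / (Ω * q) := by field_simp; ring
  have hc2 : 0 < Real.pi ^ 2 * (1 + q) / (Ω * q) := by positivity
  have e3 : Real.pi ^ 2 / (Real.pi ^ 2 * (1 + q) / (Ω * q)) + Ω / 2 * ((1 - q) / (1 + q)) =
      Ω / 2 := by field_simp; ring
  rw [heat, smoothing_schwartz, smulLeft_gauss (by positivity) hc0, e1, fourier_gauss hc1, map_smul,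
    smulLeft_gauss (by positivity) hk0, e2, FourierTransform.fourierInv_smul,
    fourierInv_gauss hc2, map_smul, map_smul, smulLeft_gauss (by positivity) hc0, e3, smul_smul]
  have hΩ' : (Ω : ℂ) ≠ 0 := by exact_mod_cast hΩ.ne'
  have hq' : (q : ℂ) ≠ 0 := by exact_mod_cast hq.ne'
  have hpi : (Real.pi : ℂ) ≠ 0 := by exact_mod_cast Real.pi_ne_zero
  have h1q : (1 + q : ℂ) ≠ 0 := by exact_mod_cast (by positivity : (1 + q : ℝ) ≠ 0)
  congr 1
  · have e4 : Real.sqrt (Real.pi / (Ω / (1 + q))) ^ d *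
        Real.sqrt (Real.pi / (Real.pi ^ 2 * (1 + q) / (Ω * q))) ^ d = Real.sqrt q ^ d := by
      rw [← mul_pow, ← Real.sqrt_mul (by positivity)]
      congr 2
      field_simp
    rw [mul_mul_mul_comm, ← Complex.ofReal_mul, e4, ← Complex.exp_add]
    congr 2
    simp only [mul_pow, ← Finset.mul_sum]
    push_cast
    rw [neg_sq, div_pow, mul_pow, Complex.I_sq]
    field_simp
    ring
  · congr 1
    funext i
    push_cast
    field_simp
    rw [Complex.I_sq]
    ring

end Coherent

/-! ### The semigroup of the harmonic oscillator -/

section MehlerSemigroup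

variable {d : ℕ} {Ω : ℝ}

/-- The semigroup `e^{-tH}` (extended by the identity to `t ≤ 0`). -/
def mehlerSemigroup (d : ℕ) (Ω t : ℝ) : L2 d →L[ℂ] L2 d :=
  if t ≤ 0 then ContinuousLinearMap.id ℂ _ else
    schwartzToL2CLM d ∘L heat d Ω (Real.exp (-2 * Ω * t))

/-- The factor that a coherent state acquires under the time evolution. -/
def coherentFactor (Ω s : ℝ) (u : Fin d → ℂ) : ℂ :=
  Complex.exp (-(Ω * d * s) + (1 - Complex.exp (-2 * Ω * s) ^ 2) * (∑ i, u i ^ 2) / (4 * Ω))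

theorem mehlerSemigroup_of_pos {t : ℝ} (ht : 0 < t) :
    mehlerSemigroup d Ω t = schwartzToL2CLM d ∘L heat d Ω (Real.exp (-2 * Ω * t)) :=
  if_neg (not_le.2 ht)

theorem mehlerSemigroup_zero : mehlerSemigroup d Ω 0 = ContinuousLinearMap.id ℂ _ := if_pos le_rfl

theorem exp_neg_lt_one (hΩ : 0 < Ω) {t : ℝ} (ht : 0 < t) : Real.exp (-2 * Ω * t) < 1 :=
  Real.exp_lt_one_iff.2 (by nlinarith [mul_pos hΩ ht])

theorem heat_coherent_exp (hΩ : 0 < Ω) {t : ℝ} (ht : 0 < t) (u : Fin d → ℂ) :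
    heat d Ω (Real.exp (-2 * Ω * t)) (schwartzToL2 d (gauss (Ω / 2) u)) =
      coherentFactor Ω t u • gauss (Ω / 2) (fun i => (Real.exp (-2 * Ω * t) : ℂ) * u i) := by
  rw [heat_coherent hΩ (Real.exp_pos _) (exp_neg_lt_one hΩ ht)]
  congr 1
  rw [coherentFactor, Complex.exp_add]
  congr 1
  · rw [Real.sqrt_eq_rpow, ← Real.exp_mul, ← Real.exp_nat_mul, Complex.ofReal_exp]
    congr 1
    push_cast
    ring
  · push_cast
    rfl

theorem mehlerSemigroup_coherent (hΩ : 0 < Ω) {t : ℝ} (ht : 0 ≤ t) (u : Fin d → ℂ) :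
    mehlerSemigroup d Ω t (schwartzToL2 d (gauss (Ω / 2) u)) = coherentFactor Ω t u •
      schwartzToL2 d (gauss (Ω / 2) (fun i => (Real.exp (-2 * Ω * t) : ℂ) * u i)) := by
  rcases ht.eq_or_lt with rfl | ht
  · simp [mehlerSemigroup_zero, coherentFactor]
  · rw [mehlerSemigroup_of_pos ht, ContinuousLinearMap.comp_apply, heat_coherent_exp hΩ ht,
      map_smul, schwartzToL2CLM_apply]

theorem norm_mehlerSemigroup_le (hΩ : 0 < Ω) (t : ℝ) : ‖mehlerSemigroup d Ω t‖ ≤ 1 := by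
  rcases le_or_gt t 0 with ht | ht
  · rw [mehlerSemigroup, if_pos ht]
    exact ContinuousLinearMap.norm_id_le
  · rw [mehlerSemigroup_of_pos ht]
    exact norm_heat_le hΩ (Real.exp_pos _) (exp_neg_lt_one hΩ ht)

theorem mehlerSemigroup_add (hΩ : 0 < Ω) {s t : ℝ} (hs : 0 ≤ s) (ht : 0 ≤ t) :
    mehlerSemigroup d Ω (s + t) = (mehlerSemigroup d Ω s).comp (mehlerSemigroup d Ω t) := by
  refine ext_on_gauss (half_pos hΩ) fun ξ => ?_
  rw [ContinuousLinearMap.comp_apply, mehlerSemigroup_coherent hΩ ht, map_smul,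
    mehlerSemigroup_coherent hΩ hs, mehlerSemigroup_coherent hΩ (add_nonneg hs ht), smul_smul]
  congr 1
  · simp only [coherentFactor, ← Complex.exp_add, mul_pow, ← Finset.mul_sum]
    congr 1
    have h : Complex.exp (-2 * Ω * (s + t : ℝ)) =
        Complex.exp (-2 * Ω * s) * Complex.exp (-2 * Ω * t) := by
      rw [← Complex.exp_add]; congr 1; push_cast; ring
    have h' : ((Real.exp (-2 * Ω * t) : ℝ) : ℂ) = Complex.exp (-2 * Ω * t) := by push_cast; rfl
    rw [h, h']
    push_cast
    ring
  · congr 2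
    funext i
    rw [← mul_assoc (((Real.exp (-2 * Ω * s) : ℝ) : ℂ)), ← Complex.ofReal_mul, ← Real.exp_add]
    congr 3
    ring

/-- On coherent states both sides are the same explicit exponential. Hence the adjoint and the
operator differ by vectors orthogonal to a total set, first on coherent states and then everywhere.
-/
theorem inner_mehlerSemigroup (hΩ : 0 < Ω) {t : ℝ} (ht : 0 ≤ t) (g h : L2 d) :
    ⟪mehlerSemigroup d Ω t g, h⟫_ℂ = ⟪g, mehlerSemigroup d Ω t h⟫_ℂ := by
  have key : ∀ u v : Fin d → ℂ,
      ⟪mehlerSemigroup d Ω t (schwartzToL2 d (gauss (Ω / 2) u)),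
        schwartzToL2 d (gauss (Ω / 2) v)⟫_ℂ =
      ⟪schwartzToL2 d (gauss (Ω / 2) u),
        mehlerSemigroup d Ω t (schwartzToL2 d (gauss (Ω / 2) v))⟫_ℂ := fun u v => by
    rw [mehlerSemigroup_coherent hΩ ht, mehlerSemigroup_coherent hΩ ht, inner_smul_left,
      inner_smul_right, inner_gauss_gauss (half_pos hΩ), inner_gauss_gauss (half_pos hΩ),
      mul_left_comm, mul_left_comm (coherentFactor Ω t v)]
    congr 1
    rw [coherentFactor, coherentFactor, ← Complex.exp_conj, ← Complex.exp_add, ← Complex.exp_add]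
    congr 1
    have hΩ' : (Ω : ℂ) ≠ 0 := by exact_mod_cast hΩ.ne'
    have h' : ((Real.exp (-2 * Ω * t) : ℝ) : ℂ) = Complex.exp (-2 * Ω * t) := by push_cast; rfl
    have h'' : (starRingEnd ℂ) (Complex.exp (-2 * Ω * t)) = Complex.exp (-2 * Ω * t) := by
      rw [← h', Complex.conj_ofReal]
    simp only [add_sq, map_mul, map_add, map_sub, map_neg, map_div₀, map_sum, map_pow, h'',
      Complex.conj_ofReal, map_natCast, map_ofNat, map_one, h', mul_pow, Finset.sum_add_distrib,
      ← Finset.mul_sum]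
    have e1 : ∑ i, 2 * (Complex.exp (-2 * Ω * t) * (starRingEnd ℂ) (u i)) * v i =
        2 * Complex.exp (-2 * Ω * t) * ∑ i, (starRingEnd ℂ) (u i) * v i := by
      rw [Finset.mul_sum]; exact Finset.sum_congr rfl fun i _ => by ring
    have e2 : ∑ i, 2 * (starRingEnd ℂ) (u i) * (Complex.exp (-2 * Ω * t) * v i) =
        2 * Complex.exp (-2 * Ω * t) * ∑ i, (starRingEnd ℂ) (u i) * v i := by
      rw [Finset.mul_sum]; exact Finset.sum_congr rfl fun i _ => by ring
    rw [e1, e2]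
    push_cast
    field_simp
    ring
  have h1 : ∀ v, (mehlerSemigroup d Ω t).adjoint (schwartzToL2 d (gauss (Ω / 2) v)) =
      mehlerSemigroup d Ω t (schwartzToL2 d (gauss (Ω / 2) v)) := fun v => by
    rw [← sub_eq_zero]
    refine eq_zero_of_inner_gauss_eq_zero (half_pos hΩ) fun ξ => ?_
    rw [inner_sub_right, ContinuousLinearMap.adjoint_inner_right, key, sub_self]
  have h2 : (mehlerSemigroup d Ω t).adjoint = mehlerSemigroup d Ω t :=
    ext_on_gauss (half_pos hΩ) fun ξ => h1 _
  rw [← ContinuousLinearMap.adjoint_inner_right, h2]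

/-- The squared norm of a difference expands into inner products of Gaussians, which depend
continuously on the parameter. -/
theorem continuous_gauss_real_mul {c : ℝ} (hc : 0 < c) (u : Fin d → ℂ) :
    Continuous fun r : ℝ => schwartzToL2 d (gauss c fun i => (r : ℂ) * u i) := by
  refine continuous_iff_continuousAt.2 fun r₀ => ?_
  rw [ContinuousAt, tendsto_iff_norm_sub_tendsto_zero]
  have h : Tendsto (fun r : ℝ => ‖schwartzToL2 d (gauss c fun i => (r : ℂ) * u i) -
      schwartzToL2 d (gauss c fun i => (r₀ : ℂ) * u i)‖ ^ 2) (𝓝 r₀) (𝓝 0) := by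
    have hcont : Continuous fun r : ℝ => ‖schwartzToL2 d (gauss c fun i => (r : ℂ) * u i) -
      schwartzToL2 d (gauss c fun i => (r₀ : ℂ) * u i)‖ ^ 2 := by
      simp only [@norm_sub_sq ℂ, ← @inner_self_eq_norm_sq ℂ, inner_gauss_gauss hc]
      fun_prop
    simpa using hcont.tendsto r₀
  have h2 := (Real.continuous_sqrt.tendsto 0).comp h
  simpa [Function.comp_def, Real.sqrt_sq (norm_nonneg _)] using h2

/-- On the span of the coherent states continuity is explicit. The operators being contractions,
orbits of approximating vectors converge uniformly in time. -/
theorem continuousOn_mehlerSemigroup (hΩ : 0 < Ω) (ψ : L2 d) :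
    ContinuousOn (fun t => mehlerSemigroup d Ω t ψ) (Set.Ici 0) := by
  have hspan : ∀ φ ∈ Submodule.span ℂ (Set.range fun ξ : Fin d → ℝ =>
      schwartzToL2 d (gauss (Ω / 2) fun i => Complex.I * ξ i)),
      ContinuousOn (fun t => mehlerSemigroup d Ω t φ) (Set.Ici 0) := by
    intro φ hφ
    induction hφ using Submodule.span_induction with
    | mem x hx =>
      obtain ⟨ξ, rfl⟩ := hx
      have hc : Continuous fun t : ℝ => coherentFactor Ω t (fun i => Complex.I * ξ i) •
          schwartzToL2 d (gauss (Ω / 2)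
            fun i => (Real.exp (-2 * Ω * t) : ℂ) * (Complex.I * ξ i)) := by
        have hf : Continuous fun t : ℝ => coherentFactor Ω t (fun i => Complex.I * ξ i) := by
          unfold coherentFactor
          fun_prop
        refine hf.smul ?_
        exact (continuous_gauss_real_mul (half_pos hΩ) fun i => Complex.I * ξ i).comp
          (by fun_prop : Continuous fun t : ℝ => Real.exp (-2 * Ω * t))
      exact hc.continuousOn.congr fun t ht => mehlerSemigroup_coherent hΩ ht _
    | zero => simpa using continuousOn_const
    | add x y _ _ hx hy => simp only [map_add]; exact hx.add hy
    | smul a x _ hx => simp only [map_smul]; exact hx.const_smul a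
  refine continuousOn_of_uniform_approx_of_continuousOn fun U hU => ?_
  obtain ⟨ε, hε, hεU⟩ := Metric.mem_uniformity_dist.1 hU
  obtain ⟨φ, hφ, hd⟩ := Metric.dense_iff.1 (dense_span_gauss (half_pos hΩ)) ψ ε hε
  refine ⟨fun t => mehlerSemigroup d Ω t φ, hspan φ hd, fun t _ => hεU ?_⟩
  rw [dist_eq_norm, ← map_sub]
  refine ((mehlerSemigroup d Ω t).le_opNorm _).trans_lt ((mul_le_of_le_one_left (norm_nonneg _)
    (norm_mehlerSemigroup_le hΩ t)).trans_lt ?_)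
  rw [← dist_eq_norm, dist_comm]
  exact hφ

/-! ### The harmonic oscillator on coherent states -/

theorem hasDerivAt_gauss_line {c : ℝ} (hc : 0 < c) (u : Fin d → ℂ) (x : Rd d) (i : Fin d) :
    HasDerivAt (fun s : ℝ => gauss c u (x + s • EuclideanSpace.single i (1 : ℝ)))
      ((u i - 2 * c * x i) * gauss c u x) 0 := by
  have h1 : ∀ s : ℝ, gauss c u (x + s • EuclideanSpace.single i (1 : ℝ)) =
      Complex.exp (-c * ((‖x‖ ^ 2 : ℝ) : ℂ) + (∑ j, u j * x j) + s * (u i - 2 * c * x i)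
        - c * s ^ 2) := fun s => by
    rw [gauss_apply hc]
    congr 1
    have e1 : ‖x + s • EuclideanSpace.single i (1 : ℝ)‖ ^ 2 = ‖x‖ ^ 2 + 2 * s * x i + s ^ 2 := by
      rw [norm_add_sq_real, real_inner_smul_right, norm_smul]
      simp [EuclideanSpace.inner_single_right]
      ring
    have e2 : ∑ j, u j * (((x + s • EuclideanSpace.single i (1 : ℝ)) j : ℝ) : ℂ) =
        ∑ j, u j * x j + s * u i := by
      simp only [PiLp.add_apply, PiLp.smul_apply, PiLp.single_apply, smul_eq_mul]
      push_cast
      simp only [mul_add, Finset.sum_add_distrib]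
      congr 1
      rw [Finset.sum_eq_single i (fun j _ hj => by simp [hj]) (by simp)]
      simp [mul_comm]
    rw [e1, e2]
    push_cast
    ring
  simp only [h1]
  have h2 : HasDerivAt (fun s : ℝ => -c * ((‖x‖ ^ 2 : ℝ) : ℂ) + (∑ j, u j * x j) +
      s * (u i - 2 * c * x i) - c * s ^ 2 : ℝ → ℂ) (u i - 2 * c * x i) 0 := by
    have hid : HasDerivAt (fun s : ℝ => (s : ℂ)) 1 0 := Complex.ofRealCLM.hasDerivAt
    have := ((hid.mul_const (u i - 2 * c * x i)).const_add
      (-c * ((‖x‖ ^ 2 : ℝ) : ℂ) + (∑ j, u j * x j))).sub ((hid.pow 2).const_mul (c : ℂ))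
    refine this.congr_deriv ?_
    simp
  have h3 := h2.cexp
  convert h3 using 1
  rw [gauss_apply hc]
  simp [mul_comm]

theorem lineDerivOp_gauss {c : ℝ} (hc : 0 < c) (u : Fin d → ℂ) (i : Fin d) :
    LineDeriv.lineDerivOp (EuclideanSpace.single i (1 : ℝ)) (gauss c u) =
      u i • gauss c u + (-(2 * c) : ℂ) • SchwartzMap.smulLeftCLM ℂ (fun x : Rd d => ((x i : ℝ) : ℂ))
        (gauss c u) := by
  ext x
  rw [SchwartzMap.lineDerivOp_apply]
  have h : HasLineDerivAt ℝ (gauss c u : Rd d → ℂ) ((u i - 2 * c * x i) * gauss c u x) x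
    (EuclideanSpace.single i (1 : ℝ)) := hasDerivAt_gauss_line hc u x i
  rw [h.lineDeriv, _root_.add_apply, _root_.smul_apply, _root_.smul_apply,
    SchwartzMap.smulLeftCLM_apply_apply (hasTemperateGrowth_coord i)]
  simp only [smul_eq_mul]
  ring

theorem lineDerivOp_coord_mul (ψ : 𝓢(Rd d, ℂ)) (i : Fin d) :
    LineDeriv.lineDerivOp (EuclideanSpace.single i (1 : ℝ))
      (SchwartzMap.smulLeftCLM ℂ (fun x : Rd d => ((x i : ℝ) : ℂ)) ψ) =
    ψ + SchwartzMap.smulLeftCLM ℂ (fun x : Rd d => ((x i : ℝ) : ℂ))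
      (LineDeriv.lineDerivOp (EuclideanSpace.single i (1 : ℝ)) ψ) := by
  ext x
  rw [SchwartzMap.lineDerivOp_apply, _root_.add_apply,
    SchwartzMap.smulLeftCLM_apply_apply (hasTemperateGrowth_coord i), SchwartzMap.lineDerivOp_apply]
  have h1 : HasLineDerivAt ℝ (ψ : Rd d → ℂ) (lineDeriv ℝ ψ x (EuclideanSpace.single i 1)) x
    (EuclideanSpace.single i (1 : ℝ)) := ψ.differentiableAt.lineDifferentiableAt.hasLineDerivAt
  have h2 : HasLineDerivAt ℝ (fun x : Rd d => ((x i : ℝ) : ℂ)) 1 x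
      (EuclideanSpace.single i (1 : ℝ)) := by
    have := (Complex.ofRealCLM ∘L (EuclideanSpace.proj i : Rd d →L[ℝ] ℝ)).hasFDerivAt (x := x)
      |>.hasLineDerivAt (EuclideanSpace.single i (1 : ℝ))
    have h5 : (Complex.ofRealCLM ∘L (EuclideanSpace.proj i : Rd d →L[ℝ] ℝ))
        (EuclideanSpace.single i (1 : ℝ)) = 1 := by simp
    rw [h5] at this
    exact this
  have h3 : HasLineDerivAt ℝ (SchwartzMap.smulLeftCLM ℂ (fun x : Rd d => ((x i : ℝ) : ℂ)) ψ)
      (1 * ψ x + x i * lineDeriv ℝ ψ x (EuclideanSpace.single i 1)) x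
      (EuclideanSpace.single i (1 : ℝ)) := by
    have h4 : ((SchwartzMap.smulLeftCLM ℂ (fun x : Rd d => ((x i : ℝ) : ℂ)) ψ : 𝓢(Rd d, ℂ)) :
        Rd d → ℂ) = fun x => ((x i : ℝ) : ℂ) * ψ x := by
      funext x
      rw [SchwartzMap.smulLeftCLM_apply_apply (hasTemperateGrowth_coord i), smul_eq_mul]
    rw [h4]
    refine (HasDerivAt.mul h2 h1).congr_deriv ?_
    simp
  rw [h3.lineDeriv, one_mul, smul_eq_mul]

/-- At the width `Ω/2` the `|x|²` terms of the Laplacian and of the potential cancel, and an affine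
factor remains. -/
theorem oscillatorS_gauss (hΩ : 0 < Ω) (u : Fin d → ℂ) (x : Rd d) :
    oscillatorS d Ω (gauss (Ω / 2) u) x =
      (Ω * d + 2 * Ω * (∑ i, u i * x i) - ∑ i, u i ^ 2) * gauss (Ω / 2) u x := by
  have hlap : (Laplacian.laplacian (gauss (Ω / 2) u : 𝓢(Rd d, ℂ))) x =
      ∑ i, ((u i - Ω * x i) ^ 2 - Ω) * gauss (Ω / 2) u x := by
    rw [SchwartzMap.laplacian_eq_sum (EuclideanSpace.basisFun (Fin d) ℝ), _root_.sum_apply]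
    refine Finset.sum_congr rfl fun i _ => ?_
    rw [EuclideanSpace.basisFun_apply, lineDerivOp_gauss (half_pos hΩ), LineDeriv.lineDerivOp_add,
      LineDeriv.lineDerivOp_smul, LineDeriv.lineDerivOp_smul, lineDerivOp_coord_mul,
      lineDerivOp_gauss (half_pos hΩ)]
    simp only [_root_.smul_apply, _root_.add_apply,
      SchwartzMap.smulLeftCLM_apply_apply (hasTemperateGrowth_coord i), smul_eq_mul]
    push_cast
    ring
  rw [oscillatorS_apply, ← SchwartzMap.laplacian_apply, hlap, ← Finset.sum_mul, sq_norm_eq_sum]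
  have : ∑ i, ((u i - Ω * x i) ^ 2 - Ω : ℂ) =
      ∑ i, u i ^ 2 - 2 * Ω * (∑ i, u i * x i) + Ω ^ 2 * (∑ i, (x i : ℂ) ^ 2) - Ω * d := by
    rw [Finset.mul_sum, Finset.mul_sum, ← Finset.sum_sub_distrib, ← Finset.sum_add_distrib,
      Finset.sum_sub_distrib (g := fun _ => (Ω : ℂ))]
    congr 1
    · exact Finset.sum_congr rfl fun i _ => by ring
    · simp [mul_comm]
  rw [this]
  push_cast
  ring

theorem integral_mul_oscillatorS (φ ψ : 𝓢(Rd d, ℂ)) :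
    ∫ x, φ x * oscillatorS d Ω ψ x = ∫ x, oscillatorS d Ω φ x * ψ x := by
  have h : Function.HasTemperateGrowth (fun x : Rd d => ((‖x‖ ^ 2 : ℝ) : ℂ)) := by fun_prop
  have hm : ∀ φ ψ : 𝓢(Rd d, ℂ), Integrable fun x => φ x * ψ x := fun φ ψ =>
    MemLp.integrable_mul (φ.memLp 2 volume) (ψ.memLp 2 volume)
  set M := SchwartzMap.smulLeftCLM ℂ (fun x : Rd d => ((‖x‖ ^ 2 : ℝ) : ℂ)) with hM
  have hosc : ∀ (ψ : 𝓢(Rd d, ℂ)) x, oscillatorS d Ω ψ x =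
      -(Laplacian.laplacian ψ) x + ((Ω ^ 2 : ℝ) : ℂ) * M ψ x := fun ψ x => by
    simp only [oscillatorS, _root_.add_apply, _root_.neg_apply, _root_.smul_apply]
    rw [SchwartzMap.laplacianCLM_eq]
    rfl
  have e1 : ∀ x, φ x * oscillatorS d Ω ψ x = (-1) * (φ x * (Laplacian.laplacian ψ) x) +
      ((Ω ^ 2 : ℝ) : ℂ) * (φ x * M ψ x) := fun x => by rw [hosc]; ring
  have e2 : ∀ x, oscillatorS d Ω φ x * ψ x = (-1) * ((Laplacian.laplacian φ) x * ψ x) +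
      ((Ω ^ 2 : ℝ) : ℂ) * (M φ x * ψ x) := fun x => by rw [hosc]; ring
  simp only [e1, e2]
  rw [integral_add ((hm _ _).const_mul _) ((hm _ _).const_mul _), integral_add
    ((hm _ _).const_mul _) ((hm _ _).const_mul _)]
  simp only [integral_const_mul]
  rw [SchwartzMap.integral_mul_laplacian_right_eq_left]
  congr 3
  funext x
  rw [hM, SchwartzMap.smulLeftCLM_apply_apply h, SchwartzMap.smulLeftCLM_apply_apply h, smul_eq_mul,
    smul_eq_mul]
  ring

end MehlerSemigroup

/-! ### The generator of the Mehler semigroup -/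

section Generator

variable {d : ℕ} {Ω : ℝ}

theorem norm_gauss_imag_le_one {c : ℝ} (hc : 0 < c) {w : Fin d → ℂ} (hw : ∀ i, (w i).re = 0)
    (x : Rd d) : ‖gauss c w x‖ ≤ 1 := by
  rw [gauss_apply hc, Complex.norm_exp]
  have h : (∑ i, w i * (x i : ℂ)).re = 0 := by
    rw [Complex.re_sum]
    exact Finset.sum_eq_zero fun i _ => by simp [hw i]
  rw [Complex.add_re, h, add_zero, ← Complex.ofReal_neg, ← Complex.ofReal_mul, Complex.ofReal_re]
  exact Real.exp_le_one_iff.2 (by nlinarith [sq_nonneg ‖x‖])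

theorem norm_coord_mul_gauss_mul_le {c : ℝ} (hc : 0 < c) {u : Fin d → ℂ} (hu : ∀ i, (u i).re = 0)
    (w : Fin d → ℂ) (x : Rd d) (z : ℂ) :
    ‖(∑ i, w i * x i) * gauss c u x * z‖ ≤ (∑ i, ‖w i‖) * (‖x‖ ^ 1 * ‖z‖) := by
  rw [norm_mul, norm_mul, pow_one, ← mul_assoc]
  refine mul_le_mul_of_nonneg_right ?_ (norm_nonneg _)
  calc _ ≤ ((∑ i, ‖w i‖) * ‖x‖) * 1 :=
        mul_le_mul (norm_sum_mul_coord_le w x) (norm_gauss_imag_le_one hc hu x) (norm_nonneg _)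
          (by positivity)
    _ = _ := mul_one _

/-- For imaginary `w` the Gaussian is bounded by 1 uniformly in `r`, so the derivative is dominated
by a multiple of `‖x‖ ‖ψ x‖`. The parameter `r` will be `e^{-2Ωs}`. -/
theorem hasDerivAt_integral_gauss_mul {c : ℝ} (hc : 0 < c) {w : Fin d → ℂ}
    (hw : ∀ i, (w i).re = 0) (ψ : 𝓢(Rd d, ℂ)) (r₀ : ℝ) :
    HasDerivAt (fun r : ℝ => ∫ x, gauss c (fun i => r * w i) x * ψ x)
      (∫ x, (∑ i, w i * x i) * gauss c (fun i => r₀ * w i) x * ψ x) r₀ := by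
  have hwr : ∀ r : ℝ, ∀ i, ((fun i => (r : ℂ) * w i) i).re = 0 := fun r i => by simp [hw i]
  have hcont : ∀ r : ℝ, Continuous fun x : Rd d => gauss c (fun i => r * w i) x * ψ x := fun r =>
    (gauss c _).continuous.mul ψ.continuous
  have hcs : Continuous fun x : Rd d => ∑ i, w i * (x i : ℂ) := by fun_prop
  refine (hasDerivAt_integral_of_dominated_loc_of_deriv_le (s := Set.univ)
    (bound := fun x => (∑ i, ‖w i‖) * (‖x‖ ^ 1 * ‖ψ x‖)) univ_mem
    (Eventually.of_forall fun r => (hcont r).aestronglyMeasurable)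
    (MemLp.integrable_mul ((gauss c _).memLp 2 volume) (ψ.memLp 2 volume))
    ((hcs.mul (gauss c _).continuous).mul ψ.continuous).aestronglyMeasurable
    (F' := fun r x => (∑ i, w i * x i) * gauss c (fun i => (r : ℂ) * w i) x * ψ x)
    (Eventually.of_forall fun x r _ => ?_)
    ((ψ.integrable_pow_mul volume 1).const_mul _) (Eventually.of_forall fun x r _ => ?_)).2
  · exact norm_coord_mul_gauss_mul_le hc (hwr r) w x _
  · refine HasDerivAt.mul_const ?_ _
    simp only [gauss_apply hc]
    have h1 : HasDerivAt (fun r : ℝ => -c * ((‖x‖ ^ 2 : ℝ) : ℂ) + ∑ i, r * w i * x i)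
        (∑ i, w i * (x i : ℂ)) r := by
      have h2 : ∀ r : ℝ, ∑ i, r * w i * (x i : ℂ) = r * ∑ i, w i * (x i : ℂ) := fun r => by
        rw [Finset.mul_sum]; exact Finset.sum_congr rfl fun i _ => by ring
      simp only [h2]
      have hid : HasDerivAt (fun s : ℝ => (s : ℂ)) 1 r := Complex.ofRealCLM.hasDerivAt
      refine ((hid.mul_const (∑ i, w i * (x i : ℂ))).const_add _).congr_deriv ?_
      rw [one_mul]
    refine h1.cexp.congr_deriv ?_
    ring

/-- The time evolution of the coefficients of a Schwartz function along coherent states. -/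
theorem hasDerivAt_coherent_coefficient (hΩ : 0 < Ω) (ξ : Fin d → ℝ) (ψ : 𝓢(Rd d, ℂ)) (s : ℝ) :
    HasDerivAt (fun s : ℝ => ⟪coherentFactor Ω s (fun i => Complex.I * ξ i) • schwartzToL2 d
        (gauss (Ω / 2) fun i => (Real.exp (-2 * Ω * s) : ℂ) * (Complex.I * ξ i)),
        schwartzToL2 d ψ⟫_ℂ)
      (-⟪coherentFactor Ω s (fun i => Complex.I * ξ i) • schwartzToL2 d
        (gauss (Ω / 2) fun i => (Real.exp (-2 * Ω * s) : ℂ) * (Complex.I * ξ i)),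
        schwartzToL2 d (oscillatorS d Ω ψ)⟫_ℂ) s := by
  have hc := half_pos hΩ
  -- The inner product is antilinear in its first argument, so the conjugate of `iξ` enters the
  -- integral.
  set w : Fin d → ℂ := fun i => -(Complex.I * ξ i) with hw
  have hw0 : ∀ i, (w i).re = 0 := fun i => by simp [hw]
  set W : ℂ := ∑ i, w i ^ 2 with hW
  have hΩ' : (Ω : ℂ) ≠ 0 := by exact_mod_cast hΩ.ne'
  -- the coefficient as a real-analytic expression
  have hexp : ∀ s : ℝ, ((Real.exp (-2 * Ω * s) : ℝ) : ℂ) = Complex.exp (-2 * Ω * s) := fun s => by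
    push_cast; rfl
  have hconj : ∀ s : ℝ, (starRingEnd ℂ) (coherentFactor Ω s (fun i => Complex.I * ξ i)) =
      coherentFactor Ω s w := fun s => by
    rw [coherentFactor, coherentFactor, ← Complex.exp_conj]
    congr 1
    have : (starRingEnd ℂ) (Complex.exp (-2 * Ω * s)) = Complex.exp (-2 * Ω * s) := by
      rw [← hexp, Complex.conj_ofReal]
    simp only [map_add, map_neg, map_mul, map_div₀, map_sub, map_pow, map_sum, map_one, map_ofNat,
      map_natCast, Complex.conj_ofReal, Complex.conj_I, hw, neg_mul]
    rw [neg_mul, neg_mul] at this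
    rw [this]
  have hgc : ∀ (s : ℝ) (x : Rd d), (starRingEnd ℂ) (gauss (Ω / 2)
      (fun i => (Real.exp (-2 * Ω * s) : ℂ) * (Complex.I * ξ i)) x) =
      gauss (Ω / 2) (fun i => (Real.exp (-2 * Ω * s) : ℂ) * w i) x := fun s x => by
    rw [conj_gauss hc]
    congr 2
    funext i
    rw [map_mul, Complex.conj_ofReal]
    simp [hw]
  have hcoef : ∀ (s : ℝ) (φ : 𝓢(Rd d, ℂ)), ⟪coherentFactor Ω s (fun i => Complex.I * ξ i) •
      schwartzToL2 d (gauss (Ω / 2) fun i => (Real.exp (-2 * Ω * s) : ℂ) * (Complex.I * ξ i)),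
      schwartzToL2 d φ⟫_ℂ = coherentFactor Ω s w *
        ∫ x, gauss (Ω / 2) (fun i => (Real.exp (-2 * Ω * s) : ℂ) * w i) x * φ x := fun s φ => by
    rw [inner_smul_left, hconj, inner_schwartzToL2]
    simp only [hgc]
  simp only [hcoef]
  set q : ℝ := Real.exp (-2 * Ω * s) with hq
  have hdq : HasDerivAt (fun s : ℝ => Real.exp (-2 * Ω * s)) (-2 * Ω * q) s := by
    refine ((hasDerivAt_id s).const_mul (-2 * Ω)).exp.congr_deriv ?_
    simp [hq]
    ring
  have hp := (hasDerivAt_integral_gauss_mul hc hw0 ψ q).scomp s hdq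
  have hcf : HasDerivAt (fun s : ℝ => coherentFactor Ω s w)
      ((-(Ω * d) + q ^ 2 * W) * coherentFactor Ω s w) s := by
    have hid : HasDerivAt (fun s : ℝ => (s : ℂ)) 1 s := Complex.ofRealCLM.hasDerivAt
    have he : HasDerivAt (fun s : ℝ => Complex.exp (-2 * Ω * s)) (-2 * Ω * q) s := by
      refine (hid.const_mul (-2 * Ω : ℂ)).cexp.congr_deriv ?_
      rw [hq, hexp]; ring
    have h1 := (((hid.const_mul (Ω * d : ℂ)).neg.add
      ((((he.pow 2).const_sub 1).mul_const W).div_const (4 * Ω : ℂ))).cexp)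
    refine h1.congr_deriv ?_
    rw [mul_comm]
    congr 1
    rw [← hexp, ← hq]
    push_cast
    field_simp
    ring
  refine (hcf.mul hp).congr_deriv ?_
  -- evaluate the oscillator on the coherent state
  rw [integral_mul_oscillatorS]
  simp only [oscillatorS_gauss hΩ, Function.comp_apply]
  have hi1 : Integrable fun x => gauss (Ω / 2) (fun i => (q : ℂ) * w i) x * ψ x :=
    MemLp.integrable_mul ((gauss _ _).memLp 2 volume) (ψ.memLp 2 volume)
  have hi2 : Integrable fun x : Rd d => (∑ i, w i * x i) *
      gauss (Ω / 2) (fun i => (q : ℂ) * w i) x * ψ x := by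
    refine Integrable.mono' ((ψ.integrable_pow_mul volume 1).const_mul (∑ i, ‖w i‖))
      (Continuous.aestronglyMeasurable ?_) (Eventually.of_forall fun x => ?_)
    · have := (gauss (Ω / 2) (fun i => (q : ℂ) * w i)).continuous
      have := ψ.continuous
      fun_prop
    · exact norm_coord_mul_gauss_mul_le hc (fun i => by simp [hw0 i]) w x _
  have e1 : ∀ x : Rd d, (Ω * d + 2 * Ω * (∑ i, (q : ℂ) * w i * x i) - ∑ i, ((q : ℂ) * w i) ^ 2) *
      gauss (Ω / 2) (fun i => (q : ℂ) * w i) x * ψ x =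
      (Ω * d - q ^ 2 * W) * (gauss (Ω / 2) (fun i => (q : ℂ) * w i) x * ψ x) +
      (2 * Ω * q) * ((∑ i, w i * x i) * gauss (Ω / 2) (fun i => (q : ℂ) * w i) x * ψ x) :=
    fun x => by
    simp only [mul_pow, mul_assoc (q : ℂ), ← Finset.mul_sum, ← hW]
    ring
  simp only [e1]
  rw [integral_add (hi1.const_mul _) (hi2.const_mul _), integral_const_mul, integral_const_mul,
    Complex.real_smul, ← hq]
  generalize (∫ x, gauss (Ω / 2) (fun i => (q : ℂ) * w i) x * ψ x) = J₁
  generalize (∫ x : Rd d, (∑ i, w i * x i) * gauss (Ω / 2) (fun i => (q : ℂ) * w i) x * ψ x) = J₂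
  rw [Complex.ofReal_mul, Complex.ofReal_mul, Complex.ofReal_neg, Complex.ofReal_ofNat]
  ring

/-- Pairing with a coherent state and using symmetry moves the evolution onto the coherent state,
where it can be differentiated explicitly. The fundamental theorem of calculus and totality of
coherent states conclude. -/
theorem schwartz_sub_mehlerSemigroup (hΩ : 0 < Ω) (ψ : 𝓢(Rd d, ℂ)) (h : ℝ) (hh : 0 ≤ h) :
    schwartzToL2 d ψ - mehlerSemigroup d Ω h (schwartzToL2 d ψ) =
      ∫ s in (0 : ℝ)..h, mehlerSemigroup d Ω s (schwartzToL2 d (oscillatorS d Ω ψ)) := by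
  have hii : IntervalIntegrable (fun s => mehlerSemigroup d Ω s
      (schwartzToL2 d (oscillatorS d Ω ψ))) volume 0 h :=
    ((continuousOn_mehlerSemigroup hΩ _).mono (by
      rw [Set.uIcc_of_le hh]; exact Set.Icc_subset_Ici_self)).intervalIntegrable
  rw [← sub_eq_zero]
  refine eq_zero_of_inner_gauss_eq_zero (half_pos hΩ) fun ξ => ?_
  set G := schwartzToL2 d (gauss (Ω / 2) fun i => Complex.I * ξ i) with hG
  have h1 : ∀ s, 0 ≤ s → ∀ g, ⟪G, mehlerSemigroup d Ω s g⟫_ℂ =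
      ⟪coherentFactor Ω s (fun i => Complex.I * ξ i) • schwartzToL2 d
        (gauss (Ω / 2) fun i => (Real.exp (-2 * Ω * s) : ℂ) * (Complex.I * ξ i)), g⟫_ℂ :=
    fun s hs g => by rw [← inner_mehlerSemigroup hΩ hs, mehlerSemigroup_coherent hΩ hs]
  have h2 : ⟪G, ∫ s in (0 : ℝ)..h, mehlerSemigroup d Ω s
      (schwartzToL2 d (oscillatorS d Ω ψ))⟫_ℂ =
      ∫ s in (0 : ℝ)..h, ⟪G, mehlerSemigroup d Ω s (schwartzToL2 d (oscillatorS d Ω ψ))⟫_ℂ :=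
    ((innerSL ℂ G).intervalIntegral_comp_comm hii).symm
  have hder := hasDerivAt_coherent_coefficient hΩ ξ ψ
  set P : ℝ → ℂ := fun s => ⟪coherentFactor Ω s (fun i => Complex.I * ξ i) • schwartzToL2 d
    (gauss (Ω / 2) fun i => (Real.exp (-2 * Ω * s) : ℂ) * (Complex.I * ξ i)),
    schwartzToL2 d ψ⟫_ℂ with hP
  have hint2 : IntervalIntegrable (fun s => -⟪G, mehlerSemigroup d Ω s
      (schwartzToL2 d (oscillatorS d Ω ψ))⟫_ℂ) volume 0 h := by
    refine ContinuousOn.intervalIntegrable ?_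
    rw [Set.uIcc_of_le hh]
    exact (continuousOn_const.inner
      ((continuousOn_mehlerSemigroup hΩ _).mono Set.Icc_subset_Ici_self)).neg
  have h3 : ∫ s in (0 : ℝ)..h, -⟪G, mehlerSemigroup d Ω s
      (schwartzToL2 d (oscillatorS d Ω ψ))⟫_ℂ = P h - P 0 := by
    refine intervalIntegral.integral_eq_sub_of_hasDerivAt (fun s hs => ?_) hint2
    rw [Set.uIcc_of_le hh] at hs
    rw [h1 s hs.1]
    exact hder s
  rw [intervalIntegral.integral_neg] at h3
  have h4 : P h = ⟪G, mehlerSemigroup d Ω h (schwartzToL2 d ψ)⟫_ℂ := (h1 h hh _).symm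
  have h5 : P 0 = ⟪G, schwartzToL2 d ψ⟫_ℂ := by
    have := h1 0 le_rfl (schwartzToL2 d ψ)
    rw [mehlerSemigroup_zero] at this
    exact this.symm
  rw [inner_sub_right, inner_sub_right, h2, ← h4, ← h5]
  linear_combination h3

theorem mehlerSemigroup_schwartz (t : ℝ) (ψ : 𝓢(Rd d, ℂ)) :
    ∃ φ, mehlerSemigroup d Ω t (schwartzToL2 d ψ) = schwartzToL2 d φ := by
  rcases le_or_gt t 0 with ht | ht
  · exact ⟨ψ, by rw [mehlerSemigroup, if_pos ht]; rfl⟩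
  · exact ⟨_, by rw [mehlerSemigroup_of_pos ht]; rfl⟩

/-- The graph, on Schwartz functions, of an operator given by a map of the Schwartz space. -/
theorem graph_closedOpOfEnd_aux (A : 𝓢(Rd d, ℂ) →L[ℂ] 𝓢(Rd d, ℂ)) :
    ∃ B : L2 d →ₗ.[ℂ] L2 d, closedOpOfEnd A = B.closure ∧
      (B.graph : Set (L2 d × L2 d)) =
        Set.range fun ψ => (schwartzToL2 d ψ, schwartzToL2 d (A ψ)) := by
  refine ⟨_, rfl, ?_⟩
  set P := (schwartzToL2 d ∘ₗ A.toLinearMap).toPMap ⊤ with hP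
  have key : ∀ ψ : 𝓢(Rd d, ℂ), ∀ h, (P.domain.equivMapOfInjective (schwartzToL2 d)
      (schwartzToL2_injective d)).symm ⟨schwartzToL2 d ψ, h⟩ = ⟨ψ, Submodule.mem_top⟩ := by
    intro ψ h
    rw [LinearEquiv.symm_apply_eq]
    rfl
  ext ⟨x, y⟩
  simp only [SetLike.mem_coe, Set.mem_range, LinearPMap.mem_graph_iff]
  constructor
  · rintro ⟨⟨_, ψ, hψ, rfl⟩, rfl, rfl⟩
    refine ⟨ψ, Prod.ext rfl ?_⟩
    change _ = P.toFun _
    have h := key ψ ⟨ψ, hψ, rfl⟩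
    exact (congrArg P.toFun h).symm
  · rintro ⟨ψ, h⟩
    obtain ⟨rfl, rfl⟩ := Prod.ext_iff.1 h
    refine ⟨⟨schwartzToL2 d ψ, ψ, Submodule.mem_top, rfl⟩, rfl, ?_⟩
    exact congrArg P.toFun (key ψ _)

theorem schwartz_mem_graph_closedOpOfEnd (A : 𝓢(Rd d, ℂ) →L[ℂ] 𝓢(Rd d, ℂ)) (ψ : 𝓢(Rd d, ℂ)) :
    (schwartzToL2 d ψ, schwartzToL2 d (A ψ)) ∈ (closedOpOfEnd A).graph := by
  obtain ⟨B, hB, hg⟩ := graph_closedOpOfEnd_aux A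
  rw [hB]
  refine LinearPMap.le_graph_of_le B.le_closure ?_
  rw [← SetLike.mem_coe, hg]
  exact ⟨ψ, rfl⟩

/-- The core criterion applies because the semigroup maps Schwartz functions to Schwartz functions.
-/
theorem isSemigroupOf_oscillator (hΩ : 0 < Ω) :
    IsSemigroupOf (oscillator d Ω) (mehlerSemigroup d Ω) := by
  have hcl := mem_closure_graph_iff_generator (schwartzToL2 d) (oscillatorS d Ω).toLinearMap
    (mehlerSemigroup_zero (d := d) (Ω := Ω)) (fun s t => mehlerSemigroup_add hΩ)
    (continuousOn_mehlerSemigroup hΩ) (fun t _ => norm_mehlerSemigroup_le hΩ t)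
    (denseRange_schwartzToL2 d) (fun t _ => mehlerSemigroup_schwartz t)
    (schwartz_sub_mehlerSemigroup hΩ)
  refine ⟨mehlerSemigroup_zero, fun s t => mehlerSemigroup_add hΩ,
    continuousOn_mehlerSemigroup hΩ, fun ψ φ => ?_⟩
  obtain ⟨B, hB, hg⟩ := graph_closedOpOfEnd_aux (oscillatorS d Ω)
  rw [← hcl]
  have hclos : ∀ p : L2 d × L2 d, p ∈ B.graph.topologicalClosure ↔
      p ∈ closure (Set.range fun v => (schwartzToL2 d v, schwartzToL2 d (oscillatorS d Ω v))) :=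
    fun p => by rw [← hg]; rfl
  -- `LinearPMap.closure` has its meaning only for closable operators. The closure of the graph is
  -- contained in the graph of the generator, which is single-valued: over the vector 0 all
  -- difference quotients vanish.
  have hclosable : B.IsClosable := by
    refine ⟨B.graph.topologicalClosure.toLinearPMap, ?_⟩
    rw [Submodule.toLinearPMap_graph_eq]
    rintro ⟨x, y⟩ hx (rfl : x = 0)
    have h := (hcl 0 y).1 ((hclos _).1 hx)
    simp only [map_zero, sub_zero, smul_zero] at h
    exact (tendsto_nhds_unique h tendsto_const_nhds)
  change (ψ, φ) ∈ (closedOpOfEnd (oscillatorS d Ω)).graph ↔ _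
  rw [hB, ← hclosable.graph_closure_eq_closure_graph, hclos]
  rfl

/-- The operator `e^{-tH}` is the Mehler semigroup. -/
theorem expNeg_oscillator (hΩ : 0 < Ω) {t : ℝ} (ht : 0 ≤ t) :
    expNeg (oscillator d Ω) t = mehlerSemigroup d Ω t := by
  have hS := isSemigroupOf_oscillator (d := d) hΩ
  have hex : ∃ S, IsSemigroupOf (oscillator d Ω) S := ⟨_, hS⟩
  rw [expNeg, dif_pos hex]
  refine hS.eq_of_contraction hex.choose_spec (fun t _ => norm_mehlerSemigroup_le hΩ t) ?_ ht
  refine (denseRange_schwartzToL2 d).mono ?_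
  rintro _ ⟨ψ, rfl⟩
  obtain ⟨y, hy, -⟩ := (LinearPMap.mem_graph_iff _).1
    (schwartz_mem_graph_closedOpOfEnd (oscillatorS d Ω) ψ)
  have hy' : (y : L2 d) = schwartzToL2 d ψ := hy
  rw [← hy']
  exact y.2

end Generator

/-! ### The Mehler kernel and traces of smoothing operators -/

section Kernel

variable {d : ℕ} {Ω q : ℝ}

/-- The coefficient `a` of the Mehler kernel `exp (-a |x|² + b ⟨x, y⟩ - a |y|²)`. -/
def mehlerA (Ω q : ℝ) : ℝ := Ω * (1 + q ^ 2) / (2 * (1 - q ^ 2))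

/-- The coefficient `b` of the Mehler kernel `exp (-a |x|² + b ⟨x, y⟩ - a |y|²)`. -/
def mehlerB (Ω q : ℝ) : ℝ := 2 * Ω * q / (1 - q ^ 2)

/-- The Mehler kernel with one variable fixed. -/
def mehlerKernel (d : ℕ) (Ω q : ℝ) (x : Rd d) : 𝓢(Rd d, ℂ) :=
  ((Real.sqrt (mehlerB Ω q / (2 * Real.pi)) ^ d * Real.exp (-mehlerA Ω q * ‖x‖ ^ 2) : ℝ) : ℂ) •
    gauss (mehlerA Ω q) fun i => ((mehlerB Ω q * x i : ℝ) : ℂ)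

/-- The evaluation at a point, as a functional on Schwartz functions. -/
def schwartzEval (x : Rd d) : 𝓢(Rd d, ℂ) →L[ℂ] ℂ := TemperedDistribution.delta x

theorem schwartzEval_apply (x : Rd d) (ψ : 𝓢(Rd d, ℂ)) : schwartzEval x ψ = ψ x := rfl

theorem mehlerA_pos (hΩ : 0 < Ω) (hq : 0 < q) (hq1 : q < 1) : 0 < mehlerA Ω q := by
  have h2 : 0 < 1 - q ^ 2 := by nlinarith
  unfold mehlerA; positivity

theorem mehlerB_pos (hΩ : 0 < Ω) (hq : 0 < q) (hq1 : q < 1) : 0 < mehlerB Ω q := by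
  have h2 : 0 < 1 - q ^ 2 := by nlinarith
  unfold mehlerB; positivity

/-- Evaluation at `x` is continuous on Schwartz functions, so both sides are continuous functionals
on `L²` and a comparison on coherent states suffices. -/
theorem heat_apply (hΩ : 0 < Ω) (hq : 0 < q) (hq1 : q < 1) (g : L2 d) (x : Rd d) :
    heat d Ω q g x = ⟪schwartzToL2 d (mehlerKernel d Ω q x), g⟫_ℂ := by
  have h2 : 0 < 1 - q ^ 2 := by nlinarith
  have ha := mehlerA_pos hΩ hq hq1
  have hb := mehlerB_pos hΩ hq hq1
  have key : schwartzEval x ∘L heat d Ω q =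
      innerSL ℂ (schwartzToL2 d (mehlerKernel d Ω q x)) := by
    refine ext_on_gauss (half_pos hΩ) fun ξ => ?_
    rw [ContinuousLinearMap.comp_apply, innerSL_apply_apply, heat_coherent hΩ hq hq1,
      schwartzEval_apply]
    rw [mehlerKernel, map_smul, inner_smul_left, inner_schwartzToL2, Complex.conj_ofReal]
    simp only [conj_gauss ha, Complex.conj_ofReal, gauss_mul_gauss ha (half_pos hΩ)]
    have e1 : mehlerA Ω q + Ω / 2 = Ω / (1 - q ^ 2) := by
      unfold mehlerA; field_simp; ring
    have hs : Real.sqrt (mehlerB Ω q / (2 * Real.pi)) ^ d *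
        Real.sqrt (Real.pi / (Ω / (1 - q ^ 2))) ^ d = Real.sqrt q ^ d := by
      rw [← mul_pow, ← Real.sqrt_mul (by positivity)]
      congr 2
      unfold mehlerB
      field_simp
    rw [e1, integral_gauss (by positivity), _root_.smul_apply, gauss_apply (half_pos hΩ),
      smul_eq_mul, ← hs]
    push_cast
    simp only [mul_assoc]
    congr 1
    conv_rhs => rw [mul_left_comm]
    congr 1
    rw [← Complex.exp_add, ← Complex.exp_add]
    congr 1
    have hΩ' : (Ω : ℂ) ≠ 0 := by exact_mod_cast hΩ.ne'
    have h2' : (1 - q ^ 2 : ℂ) ≠ 0 := by exact_mod_cast h2.ne'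
    have hn : ((‖x‖ : ℝ) : ℂ) ^ 2 = ∑ i, (x i : ℂ) ^ 2 := by
      rw [← Complex.ofReal_pow, sq_norm_eq_sum]
      push_cast
      rfl
    rw [hn]
    unfold mehlerA mehlerB
    push_cast
    simp only [Finset.mul_sum, Finset.sum_div, ← Finset.sum_add_distrib, Pi.add_apply]
    refine Finset.sum_congr rfl fun i _ => ?_
    field_simp
    ring
  exact congrArg (fun A : L2 d →L[ℂ] ℂ => A g) key

/-! ### The kernel at time `t`, and traces as integrals over the diagonal -/

variable {t : ℝ}

/-- The time-`t` heat operator, into Schwartz functions. -/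
def heatTime (d : ℕ) (Ω t : ℝ) : L2 d →L[ℂ] 𝓢(Rd d, ℂ) := heat d Ω (Real.exp (-2 * Ω * t))

/-- The Mehler kernel at time `t`. -/
def kernelTime (d : ℕ) (Ω t : ℝ) (x : Rd d) : 𝓢(Rd d, ℂ) :=
  mehlerKernel d Ω (Real.exp (-2 * Ω * t)) x

theorem heatTime_apply (hΩ : 0 < Ω) (ht : 0 < t) (g : L2 d) (x : Rd d) :
    heatTime d Ω t g x = ⟪schwartzToL2 d (kernelTime d Ω t x), g⟫_ℂ :=
  heat_apply hΩ (Real.exp_pos _) (exp_neg_lt_one hΩ ht) g x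

theorem schwartzToL2_heatTime (ht : 0 < t) (g : L2 d) :
    schwartzToL2 d (heatTime d Ω t g) = mehlerSemigroup d Ω t g := by
  rw [mehlerSemigroup_of_pos ht]; rfl

theorem heatTime_add (hΩ : 0 < Ω) {s : ℝ} (hs : 0 < s) (ht : 0 < t) (g : L2 d) :
    heatTime d Ω s (mehlerSemigroup d Ω t g) = heatTime d Ω (s + t) g := by
  refine schwartzToL2_injective d ?_
  rw [schwartzToL2_heatTime hs, schwartzToL2_heatTime (add_pos hs ht),
    mehlerSemigroup_add hΩ hs.le ht.le]
  rfl

/-- The Chapman–Kolmogorov identity, obtained by duality from the semigroup law without another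
Gaussian integral. -/
theorem heatTime_kernelTime (hΩ : 0 < Ω) {s : ℝ} (hs : 0 < s) (ht : 0 < t) (x : Rd d) :
    heatTime d Ω t (schwartzToL2 d (kernelTime d Ω s x)) = kernelTime d Ω (s + t) x := by
  refine schwartzToL2_injective d (ext_inner_right ℂ fun g => ?_)
  rw [← heatTime_apply hΩ (add_pos hs ht), ← heatTime_add hΩ hs ht, heatTime_apply hΩ hs,
    schwartzToL2_heatTime ht, inner_mehlerSemigroup hΩ ht.le]

/-- A family of functionals on Schwartz functions, decaying fast enough to be square integrable. -/
def IsRapid (Λ : Rd d → 𝓢(Rd d, ℂ) →ₗ[ℂ] ℂ) : Prop :=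
  ∃ p : Seminorm ℂ 𝓢(Rd d, ℂ), Continuous p ∧ ∀ ψ x, (1 + ‖x‖) ^ (d + 1) * ‖Λ x ψ‖ ≤ p ψ

theorem isRapid_of_forall_pow {Λ : Rd d → 𝓢(Rd d, ℂ) →ₗ[ℂ] ℂ}
    (h : ∀ n : ℕ, ∃ p : Seminorm ℂ 𝓢(Rd d, ℂ), Continuous p ∧ ∀ ψ x, ‖x‖ ^ n * ‖Λ x ψ‖ ≤ p ψ) :
    IsRapid Λ := by
  obtain ⟨p, hp, hpb⟩ := h 0
  obtain ⟨r, hr, hrb⟩ := h (d + 1)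
  refine ⟨(2 : NNReal) ^ d • (p + r), (hp.add hr).const_smul ((2 : NNReal) ^ d), fun ψ x => ?_⟩
  have h1 := add_pow_le zero_le_one (norm_nonneg x) (d + 1)
  rw [one_pow, Nat.add_sub_cancel] at h1
  have h2 := hpb ψ x
  rw [pow_zero, one_mul] at h2
  calc (1 + ‖x‖) ^ (d + 1) * ‖Λ x ψ‖ ≤ 2 ^ d * (1 + ‖x‖ ^ (d + 1)) * ‖Λ x ψ‖ := by gcongr
    _ = 2 ^ d * (‖Λ x ψ‖ + ‖x‖ ^ (d + 1) * ‖Λ x ψ‖) := by ring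
    _ ≤ 2 ^ d * (p ψ + r ψ) := by gcongr; exact hrb ψ x

theorem isRapid_schwartzEval :
    IsRapid fun x : Rd d => (schwartzEval x).toLinearMap :=
  isRapid_of_forall_pow fun n => ⟨SchwartzMap.seminorm ℂ n 0,
    (schwartz_withSeminorms ℂ (Rd d) ℂ).continuous_seminorm (n, 0), fun ψ x =>
      SchwartzMap.norm_pow_mul_le_seminorm ℂ ψ n x⟩

/-- This fixes the weight in `IsRapid`: the exponent `2 (d + 1)` exceeds the dimension. -/
theorem integrable_one_add_norm_inv_sq (C : ℝ) :
    Integrable fun x : Rd d => (C * ((1 + ‖x‖) ^ (d + 1))⁻¹) ^ 2 := by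
  have h := integrable_one_add_norm (E := Rd d) (μ := volume) (r := 2 * (d + 1)) (by
    rw [finrank_euclideanSpace_fin]; linarith)
  refine (h.const_mul (C ^ 2)).congr (Eventually.of_forall fun x => ?_)
  have h1 : 0 ≤ 1 + ‖x‖ := by positivity
  have e : (-(2 * (d + 1)) : ℝ) = -((2 * (d + 1) : ℕ) : ℝ) := by push_cast; ring
  simp only
  rw [mul_pow, e, Real.rpow_neg h1, Real.rpow_natCast, inv_pow, ← pow_mul, mul_comm (d + 1)]

/-- A continuous seminorm pulled back to a Hilbert space by a continuous linear map is bounded by a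
multiple of the norm. -/
theorem IsRapid.exists_bound {Λ : Rd d → 𝓢(Rd d, ℂ) →ₗ[ℂ] ℂ} (hΛ : IsRapid Λ)
    (A : L2 d →L[ℂ] 𝓢(Rd d, ℂ)) :
    ∃ C, 0 < C ∧ ∀ g x, ‖Λ x (A g)‖ ≤ C * ((1 + ‖x‖) ^ (d + 1))⁻¹ * ‖g‖ := by
  obtain ⟨p, hp, hb⟩ := hΛ
  obtain ⟨C, hC, h⟩ := (p.comp A.toLinearMap).bound_of_continuous_normedSpace
    (hp.comp A.continuous)
  refine ⟨C, hC, fun g x => ?_⟩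
  have h1 : 0 < (1 + ‖x‖) ^ (d + 1) := by positivity
  have h2 := (hb (A g) x).trans (h g)
  rw [mul_right_comm, ← div_eq_mul_inv, le_div_iff₀ h1, mul_comm]
  exact h2

theorem exists_clm_of_pointwise {a : Rd d → L2 d →L[ℂ] ℂ}
    (hm : ∀ g, AEStronglyMeasurable (fun x => a x g) volume) {C : Rd d → ℝ}
    (hC : ∀ x, ‖a x‖ ≤ C x) (hCint : Integrable fun x => C x ^ 2) :
    ∃ A : L2 d →L[ℂ] L2 d, ∀ g, A g =ᵐ[volume] fun x => a x g := by
  have hle : ∀ g x, ‖a x g‖ ^ 2 ≤ C x ^ 2 * ‖g‖ ^ 2 := fun g x => by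
    rw [← mul_pow]
    exact pow_le_pow_left₀ (norm_nonneg _) ((a x).le_of_opNorm_le (hC x) g) 2
  have hmem : ∀ g, MemLp (fun x => a x g) 2 volume := fun g =>
    (memLp_two_iff_integrable_sq_norm (hm g)).2
      (Integrable.mono' (hCint.mul_const _) ((hm g).norm.pow 2)
        (Eventually.of_forall fun x => by
          rw [Real.norm_of_nonneg (by positivity)]; exact hle g x))
  refine ⟨LinearMap.mkContinuous
    { toFun := fun g => (hmem g).toLp _
      map_add' := fun g h => by
        rw [← MemLp.toLp_add]
        exact MemLp.toLp_congr _ _ (Eventually.of_forall fun x => map_add _ _ _)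
      map_smul' := fun c g => by
        rw [RingHom.id_apply, ← MemLp.toLp_const_smul]
        exact MemLp.toLp_congr _ _ (Eventually.of_forall fun x => map_smul _ _ _) }
    (Real.sqrt (∫ x, C x ^ 2)) fun g => ?_, fun g => (hmem g).coeFn_toLp⟩
  refine le_of_sq_le_sq ?_ (by positivity)
  rw [L2.norm_sq_eq_integral, mul_pow, Real.sq_sqrt (integral_nonneg fun x => sq_nonneg _),
    ← integral_mul_const]
  have h1 : ∫ x, ‖((hmem g).toLp _ : L2 d) x‖ ^ 2 = ∫ x, ‖a x g‖ ^ 2 := by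
    refine integral_congr_ae ?_
    filter_upwards [(hmem g).coeFn_toLp] with x hx
    rw [hx]
  exact h1.trans_le (integral_mono_of_nonneg (Eventually.of_forall fun x => by positivity)
    (hCint.mul_const _) (Eventually.of_forall (hle g)))

/-- The trace of an operator `g ↦ (x ↦ Λ_x (e^{-tH} g))`. -/
theorem exists_hasTrace_of_isRapid (hΩ : 0 < Ω) (ht : 0 < t)
    {Λ : Rd d → 𝓢(Rd d, ℂ) →ₗ[ℂ] ℂ} (hΛ : IsRapid Λ)
    (hm : ∀ ψ, AEStronglyMeasurable (fun x => Λ x ψ) volume) :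
    ∃ T : L2 d →L[ℂ] L2 d, (∀ g, T g =ᵐ[volume] fun x => Λ x (heatTime d Ω t g)) ∧
      HasTrace T (∫ x, Λ x (kernelTime d Ω t x)) := by
  -- The time is halved: `Λ` after the first half is one Hilbert–Schmidt factor, the second half is
  -- the other.
  have ht2 := half_pos ht
  obtain ⟨C, hC, hb⟩ := hΛ.exists_bound (heatTime d Ω (t / 2))
  obtain ⟨D, hD, hb'⟩ := isRapid_schwartzEval.exists_bound (heatTime d Ω (t / 2))
  have hpos : ∀ x : Rd d, 0 < ((1 + ‖x‖) ^ (d + 1))⁻¹ := fun x => by positivity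
  set a : Rd d → L2 d →L[ℂ] ℂ := fun x =>
    ((Λ x).comp (heatTime d Ω (t / 2)).toLinearMap).mkContinuous
      (C * ((1 + ‖x‖) ^ (d + 1))⁻¹) (fun g => hb g x) with ha
  have haC : ∀ x, ‖a x‖ ≤ C * ((1 + ‖x‖) ^ (d + 1))⁻¹ := fun x =>
    LinearMap.mkContinuous_norm_le _ (mul_pos hC (hpos x)).le _
  obtain ⟨A, hA⟩ := exists_clm_of_pointwise (a := a) (fun g => hm _) haC
    (integrable_one_add_norm_inv_sq C)
  set β : Rd d → L2 d := fun x => schwartzToL2 d (kernelTime d Ω (t / 2) x) with hβ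
  -- The evaluation bound is applied to `β x` itself: the left side is then `‖β x‖²`, and one factor
  -- cancels.
  have hβD : ∀ x, ‖β x‖ ≤ D * ((1 + ‖x‖) ^ (d + 1))⁻¹ := fun x => by
    have h := hb' (β x) x
    have h1 : (heatTime d Ω (t / 2) (β x)) x = ⟪β x, β x⟫_ℂ := heatTime_apply hΩ ht2 _ x
    change ‖(heatTime d Ω (t / 2) (β x)) x‖ ≤ _ at h
    rw [h1, inner_self_eq_norm_sq_to_K, norm_pow] at h
    simp only [RCLike.norm_ofReal, abs_norm] at h
    by_cases h0 : ‖β x‖ = 0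
    · rw [h0]; exact (mul_pos hD (hpos x)).le
    · refine le_of_mul_le_mul_right (a := ‖β x‖) ?_ ((norm_nonneg _).lt_of_ne' h0)
      rw [← sq]; exact h
  have hB : ∀ g, mehlerSemigroup d Ω (t / 2) g =ᵐ[volume] fun x => ⟪β x, g⟫_ℂ := fun g => by
    rw [← schwartzToL2_heatTime ht2]
    filter_upwards [(heatTime d Ω (t / 2) g).coeFn_toLp 2 volume] with x hx
    exact hx.trans (heatTime_apply hΩ ht2 g x)
  refine ⟨A.comp (mehlerSemigroup d Ω (t / 2)), fun g => ?_, ?_⟩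
  · refine (hA _).trans (Eventually.of_forall fun x => ?_)
    change Λ x (heatTime d Ω (t / 2) (mehlerSemigroup d Ω (t / 2) g)) = _
    rw [heatTime_add hΩ ht2 ht2, add_halves]
  · have h := hasTrace_comp_of_pointwise hA hB (inner_mehlerSemigroup hΩ ht2.le) haC
      (integrable_one_add_norm_inv_sq C) hβD (integrable_one_add_norm_inv_sq D)
    convert h using 2
    funext x
    change _ = Λ x (heatTime d Ω (t / 2) (schwartzToL2 d (kernelTime d Ω (t / 2) x)))
    rw [heatTime_kernelTime hΩ ht2 ht2, add_halves]

/-- On the diagonal the kernel is a multiple of `exp(-(2a - b)|x|²)` with `2a - b = Ω(1 - q)/(1 +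
q)`, so the trace is a Gaussian integral. -/
theorem hasTrace_mehlerSemigroup (hΩ : 0 < Ω) (ht : 0 < t) :
    HasTrace (mehlerSemigroup d Ω t) ((((2 * Real.sinh (Ω * t)) ^ d)⁻¹ : ℝ) : ℂ) := by
  obtain ⟨T, hT, htr⟩ := exists_hasTrace_of_isRapid (d := d) hΩ ht isRapid_schwartzEval
    fun ψ => ψ.continuous.aestronglyMeasurable
  have hTS : T = mehlerSemigroup d Ω t := by
    ext1 g
    rw [← schwartzToL2_heatTime ht]
    exact Lp.ext ((hT g).trans ((heatTime d Ω t g).coeFn_toLp 2 volume).symm)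
  rw [hTS] at htr
  convert htr using 1
  set q := Real.exp (-2 * Ω * t) with hqdef
  have hq : 0 < q := Real.exp_pos _
  have hq1 : q < 1 := exp_neg_lt_one hΩ ht
  have h1 : 0 < 1 - q := sub_pos.2 hq1
  have h2 : 0 < 1 - q ^ 2 := by nlinarith
  have hk : ∀ x : Rd d, (schwartzEval x).toLinearMap
      (kernelTime d Ω t x) = ((Real.sqrt (mehlerB Ω q / (2 * Real.pi)) ^ d : ℝ) : ℂ) *
        gauss (Ω * ((1 - q) / (1 + q))) 0 x := fun x => by
    change mehlerKernel d Ω q x x = _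
    rw [mehlerKernel, _root_.smul_apply, gauss_apply (mehlerA_pos hΩ hq hq1),
      gauss_apply (by positivity), smul_eq_mul, Complex.ofReal_mul, mul_assoc]
    congr 1
    rw [Complex.ofReal_exp, ← Complex.exp_add]
    congr 1
    have h3 : (∑ i, ((mehlerB Ω q * x i : ℝ) : ℂ) * (x i : ℂ)) =
        ((mehlerB Ω q * ‖x‖ ^ 2 : ℝ) : ℂ) := by
      rw [sq_norm_eq_sum, Finset.mul_sum]
      push_cast
      exact Finset.sum_congr rfl fun i _ => by ring
    rw [h3]
    simp only [Pi.zero_apply, zero_mul, Finset.sum_const_zero, add_zero]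
    rw [← Complex.ofReal_neg, ← Complex.ofReal_neg, ← Complex.ofReal_mul, ← Complex.ofReal_mul,
      ← Complex.ofReal_add, ← Complex.ofReal_add]
    congr 1
    unfold mehlerA mehlerB
    have : (1 - q ^ 2) = (1 - q) * (1 + q) := by ring
    rw [this]
    field_simp
    ring
  rw [integral_congr_ae (Eventually.of_forall hk), integral_const_mul,
    integral_gauss (by positivity)]
  simp only [Pi.zero_apply, ne_eq, OfNat.ofNat_ne_zero, not_false_eq_true, zero_pow,
    Finset.sum_const_zero, zero_div, Complex.exp_zero, mul_one]
  rw [← Complex.ofReal_mul, ← mul_pow, ← Real.sqrt_mul (mehlerB_pos hΩ hq hq1 |>.le |> fun h => by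
    positivity), ← inv_pow]
  congr 2
  have e : mehlerB Ω q / (2 * Real.pi) * (Real.pi / (Ω * ((1 - q) / (1 + q)))) =
      ((2 * Real.sinh (Ω * t))⁻¹) ^ 2 := by
    set r := Real.exp (Ω * t) with hr
    have hr0 : 0 < r := Real.exp_pos _
    have hqr : q = (r ^ 2)⁻¹ := by
      rw [hqdef, hr, ← Real.exp_nat_mul, ← Real.exp_neg]; congr 1; push_cast; ring
    have hs : 2 * Real.sinh (Ω * t) = r * (1 - q) := by
      rw [Real.sinh_eq, Real.exp_neg, ← hr, hqr]; field_simp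
    rw [hs]
    have h5 : q * r ^ 2 = 1 := by rw [hqr]; field_simp
    unfold mehlerB
    have : (1 - q ^ 2) = (1 - q) * (1 + q) := by ring
    rw [this]
    field_simp
    linear_combination h5
  rw [e, Real.sqrt_sq (inv_nonneg.2 (by have := Real.sinh_pos_iff.2 (mul_pos hΩ ht); positivity))]

end Kernel

/-! ### The Moyal product with a Schwartz function -/

section Moyal

variable {d : ℕ}

/-- The standard basis vectors of `ℝ^d`. -/
abbrev stdVec (j : Fin d) : Rd d := EuclideanSpace.single j (1 : ℝ)

/-- Multiplication by a coordinate. -/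
abbrev coordMul (j : Fin d) : 𝓢(Rd d, ℂ) →L[ℂ] 𝓢(Rd d, ℂ) :=
  SchwartzMap.smulLeftCLM ℂ fun x : Rd d => ((x j : ℝ) : ℂ)

theorem coordMul_apply (j : Fin d) (ψ : 𝓢(Rd d, ℂ)) (x : Rd d) :
    coordMul j ψ x = (x j : ℂ) * ψ x :=
  SchwartzMap.smulLeftCLM_apply_apply (hasTemperateGrowth_coord j) ψ x

/-- The dilation by `(2π)⁻¹`. -/
def dilation (d : ℕ) : Rd d ≃L[ℝ] Rd d :=
  ContinuousLinearEquiv.smulLeft (Units.mk0 ((2 * Real.pi)⁻¹ : ℝ) (by positivity))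

theorem dilation_apply (k : Rd d) : dilation d k = (2 * Real.pi)⁻¹ • k := rfl

/-- The Fourier transform `(2π)^{-d} ∫ ψ(w) e^{i⟨k, w⟩} dw`. -/
def hatS (d : ℕ) : 𝓢(Rd d, ℂ) →L[ℂ] 𝓢(Rd d, ℂ) :=
  ((((2 * Real.pi) ^ d)⁻¹ : ℝ) : ℂ) • (SchwartzMap.compCLMOfContinuousLinearEquiv ℂ (dilation d) ∘L
    FourierTransform.fourierInvCLM ℂ 𝓢(Rd d, ℂ))

theorem hatS_eq (ψ : 𝓢(Rd d, ℂ)) : hatS d ψ = ((((2 * Real.pi) ^ d)⁻¹ : ℝ) : ℂ) •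
    SchwartzMap.compCLMOfContinuousLinearEquiv ℂ (dilation d)
      (FourierTransformInv.fourierInv ψ) := rfl

theorem hatS_apply (ψ : 𝓢(Rd d, ℂ)) (k : Rd d) :
    hatS d ψ k = ((((2 * Real.pi) ^ d)⁻¹ : ℝ) : ℂ) *
      ∫ w, ψ w * Complex.exp (Complex.I * ((⟪k, w⟫_ℝ : ℝ) : ℂ)) := by
  rw [hatS_eq, _root_.smul_apply, smul_eq_mul, SchwartzMap.compCLMOfContinuousLinearEquiv_apply,
    Function.comp_apply, SchwartzMap.fourierInv_coe, Real.fourierInv_eq', dilation_apply]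
  congr 1
  refine integral_congr_ae (Eventually.of_forall fun w => ?_)
  simp only
  rw [smul_eq_mul, mul_comm, real_inner_smul_right, real_inner_comm, mul_comm Complex.I]
  congr 4
  field_simp

theorem lineDerivOp_hatS (ψ : 𝓢(Rd d, ℂ)) (j : Fin d) :
    LineDeriv.lineDerivOp (stdVec j) (hatS d ψ) = Complex.I • hatS d (coordMul j ψ) := by
  have h : (fun x : Rd d => ⟪x, dilation d (stdVec j)⟫_ℝ) = fun x => (2 * Real.pi)⁻¹ * x j := by
    funext x
    rw [dilation_apply, real_inner_smul_right, EuclideanSpace.inner_single_right]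
    simp
  have hg : (fun x : Rd d => (2 * Real.pi)⁻¹ * x j).HasTemperateGrowth := by
    rw [← h]; fun_prop
  have key : (2 * Real.pi * Complex.I : ℂ) • SchwartzMap.smulLeftCLM ℂ
      (fun x : Rd d => (2 * Real.pi)⁻¹ * x j) ψ = Complex.I • coordMul j ψ := by
    ext x
    rw [_root_.smul_apply, _root_.smul_apply, SchwartzMap.smulLeftCLM_apply_apply hg,
      coordMul_apply, Complex.real_smul, smul_eq_mul, smul_eq_mul]
    have hpi : (Real.pi : ℂ) ≠ 0 := by exact_mod_cast Real.pi_ne_zero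
    push_cast
    field_simp
  rw [hatS_eq, hatS_eq, LineDeriv.lineDerivOp_smul,
    SchwartzMap.lineDerivOp_compCLMOfContinuousLinearEquiv, SchwartzMap.lineDerivOp_fourierInv_eq,
    h, key, FourierTransform.fourierInv_smul, map_smul, smul_comm]

theorem hatS_lineDerivOp (ψ : 𝓢(Rd d, ℂ)) (j : Fin d) :
    hatS d (LineDeriv.lineDerivOp (stdVec j) ψ) = -Complex.I • coordMul j (hatS d ψ) := by
  have hg : (fun x : Rd d => ⟪x, stdVec j⟫_ℝ).HasTemperateGrowth := by fun_prop
  rw [hatS_eq, hatS_eq, SchwartzMap.fourierInv_lineDerivOp_eq]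
  ext k
  simp only [_root_.smul_apply, coordMul_apply, SchwartzMap.compCLMOfContinuousLinearEquiv_apply,
    Function.comp_apply, SchwartzMap.smulLeftCLM_apply_apply hg, map_smul, dilation_apply]
  rw [EuclideanSpace.inner_single_right, Complex.real_smul]
  simp only [smul_eq_mul]
  have hpi : (Real.pi : ℂ) ≠ 0 := by exact_mod_cast Real.pi_ne_zero
  simp
  field_simp

variable (Θ : Matrix (Fin d) (Fin d) ℝ)

/-- The matrix `Θ` as a continuous linear map. -/
def matCLM : Rd d →L[ℝ] Rd d := (Matrix.toEuclideanLin Θ).toContinuousLinearMap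

theorem matCLM_apply (k : Rd d) : matCLM Θ k = matVec Θ k := rfl

@[fun_prop]
theorem continuous_matVec : Continuous fun k : Rd d => matVec Θ k := (matCLM Θ).continuous

theorem BStar.exists_norm_le (f : BStar d) : ∃ C, 0 ≤ C ∧ ∀ x, ‖f.toFun x‖ ≤ C := by
  obtain ⟨C, hC⟩ := f.bounded 0
  exact ⟨C, (norm_nonneg _).trans (hC 0), fun x => by simpa using hC x⟩

/-- A directional derivative of a function in `B_⋆`. -/
def BStar.dirDeriv (f : BStar d) (v : Rd d) : BStar d where
  toFun x := fderiv ℝ f.toFun x v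
  smooth := (f.smooth.fderiv_right (m := ∞) le_rfl).clm_apply contDiff_const
  bounded n := by
    obtain ⟨C, hC⟩ := f.bounded (n + 1)
    refine ⟨‖v‖ * C, fun x => ?_⟩
    refine (norm_iteratedFDeriv_clm_apply_const (N := ∞)
      (f.smooth.fderiv_right (m := ∞) le_rfl).contDiffAt (by exact_mod_cast le_top)).trans ?_
    rw [norm_iteratedFDeriv_fderiv]
    exact mul_le_mul_of_nonneg_left (hC x) (norm_nonneg _)

/-- The function `k ↦ f(x + ½Θk) e^{-i⟨k, x⟩}`. -/
def moyalWeight (f : BStar d) (x k : Rd d) : ℂ :=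
  f.toFun (x + (1 / 2 : ℝ) • matVec Θ k) * Complex.exp (-(Complex.I * ((⟪k, x⟫_ℝ : ℝ) : ℂ)))

theorem norm_moyalWeight (f : BStar d) (x k : Rd d) :
    ‖moyalWeight Θ f x k‖ = ‖f.toFun (x + (1 / 2 : ℝ) • matVec Θ k)‖ := by
  rw [moyalWeight, norm_mul, ← mul_neg, ← Complex.ofReal_neg, mul_comm Complex.I,
    Complex.norm_exp_ofReal_mul_I, mul_one]

theorem continuous_moyalWeight (f : BStar d) :
    Continuous fun p : Rd d × Rd d => moyalWeight Θ f p.1 p.2 := by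
  unfold moyalWeight
  have := f.smooth.continuous
  fun_prop

/-- Translating `y` by `x` turns the inner integral into a Fourier transform of `ψ` and leaves the
phase `e^{-i⟨k,x⟩}`. The outer integral is now against a Schwartz function, which makes all later
estimates absolute. -/
theorem moyal_eq (f : BStar d) (ψ : 𝓢(Rd d, ℂ)) (x : Rd d) :
    moyal Θ f.toFun ψ x = ∫ k, moyalWeight Θ f x k * hatS d ψ k := by
  rw [moyal, ← integral_const_mul]
  refine integral_congr_ae (Eventually.of_forall fun k => ?_)
  simp only
  rw [hatS_apply, mul_left_comm]
  congr 1
  rw [← integral_const_mul]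
  conv_rhs => rw [← integral_add_left_eq_self _ x]
  refine integral_congr_ae (Eventually.of_forall fun y => ?_)
  simp only
  rw [moyalWeight, inner_add_right]
  have : Complex.exp (Complex.I * ((⟪k, y⟫_ℝ : ℝ) : ℂ)) =
      Complex.exp (-(Complex.I * ((⟪k, x⟫_ℝ : ℝ) : ℂ))) *
        Complex.exp (Complex.I * ((⟪k, x⟫_ℝ + ⟪k, y⟫_ℝ : ℝ) : ℂ)) := by
    rw [← Complex.exp_add]
    congr 1
    push_cast
    ring
  rw [this]
  ring

theorem integrable_moyalWeight_mul (f : BStar d) (x : Rd d) (φ : 𝓢(Rd d, ℂ)) :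
    Integrable fun k => moyalWeight Θ f x k * φ k := by
  obtain ⟨C, -, hC⟩ := f.exists_norm_le
  refine φ.integrable.bdd_mul (c := C) ?_ (Eventually.of_forall fun k => ?_)
  · exact ((continuous_moyalWeight Θ f).comp (by fun_prop : Continuous fun k => (x, k)))
      |>.aestronglyMeasurable
  · rw [norm_moyalWeight]; exact hC _

theorem continuous_moyal (f : BStar d) (ψ : 𝓢(Rd d, ℂ)) : Continuous (moyal Θ f.toFun ψ) := by
  obtain ⟨C, -, hC⟩ := f.exists_norm_le
  have h : moyal Θ f.toFun ψ = fun x => ∫ k, moyalWeight Θ f x k * hatS d ψ k :=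
    funext (moyal_eq Θ f ψ)
  rw [h]
  refine continuous_of_dominated (bound := fun k => C * ‖hatS d ψ k‖) (fun x => ?_) (fun x => ?_)
    ((hatS d ψ).integrable.norm.const_mul C) (Eventually.of_forall fun k => ?_)
  · exact (integrable_moyalWeight_mul Θ f x _).aestronglyMeasurable
  · refine Eventually.of_forall fun k => ?_
    rw [norm_mul, norm_moyalWeight]
    gcongr
    exact hC _
  · exact ((continuous_moyalWeight Θ f).comp (by fun_prop : Continuous fun x => (x, k))).mul
      continuous_const

theorem hasFDerivAt_moyalWeight (f : BStar d) (x k : Rd d) (j : Fin d) :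
    DifferentiableAt ℝ (moyalWeight Θ f x) k ∧ fderiv ℝ (moyalWeight Θ f x) k (stdVec j) =
      (1 / 2 : ℂ) * moyalWeight Θ (f.dirDeriv (matVec Θ (stdVec j))) x k -
        Complex.I * x j * moyalWeight Θ f x k := by
  have hf : HasFDerivAt f.toFun (fderiv ℝ f.toFun (x + (1 / 2 : ℝ) • matVec Θ k))
      (x + (1 / 2 : ℝ) • matVec Θ k) :=
    (f.smooth.differentiable (by simp) _).hasFDerivAt
  have haff : HasFDerivAt (fun k => x + (1 / 2 : ℝ) • matVec Θ k) ((1 / 2 : ℝ) • matCLM Θ) k :=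
    ((matCLM Θ).hasFDerivAt.const_smul (1 / 2 : ℝ)).const_add x
  have hin : HasFDerivAt (fun k : Rd d => -(Complex.I * ((⟪k, x⟫_ℝ : ℝ) : ℂ)))
      (-(Complex.I • (Complex.ofRealCLM ∘L (innerSL ℝ x)))) k := by
    have h1 : HasFDerivAt (fun k : Rd d => ((⟪k, x⟫_ℝ : ℝ) : ℂ))
        (Complex.ofRealCLM ∘L (innerSL ℝ x)) k := by
      refine (Complex.ofRealCLM ∘L (innerSL ℝ x)).hasFDerivAt.congr_of_eventuallyEq
        (Eventually.of_forall fun k => ?_)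
      simp [real_inner_comm]
    exact (h1.const_mul Complex.I).neg
  have h := (hf.comp k haff).mul hin.cexp
  refine ⟨h.differentiableAt, ?_⟩
  have h' : HasFDerivAt (moyalWeight Θ f x) _ k := h
  rw [h'.fderiv]
  have hx : ⟪x, stdVec j⟫_ℝ = x j := by
    rw [EuclideanSpace.inner_single_right]; simp
  simp only [_root_.add_apply, _root_.smul_apply, _root_.neg_apply,
    ContinuousLinearMap.comp_apply, innerSL_apply_apply, hx, Complex.ofRealCLM_apply, smul_eq_mul,
    moyalWeight, BStar.dirDeriv, matCLM_apply, map_smul, Complex.real_smul, Function.comp_apply]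
  push_cast
  ring

/-- Integration by parts in `k`: the coordinate comes from the derivative of the phase, the other
derivatives fall on `f (x + ½Θk)` and on the transform of `ψ`, where they act as multiplication of
`ψ` by the coordinate. Growth in `x` is thus traded for a derivative of `f`. -/
theorem coord_mul_moyal (f : BStar d) (ψ : 𝓢(Rd d, ℂ)) (x : Rd d) (j : Fin d) :
    (x j : ℂ) * moyal Θ f.toFun ψ x = moyal Θ f.toFun (coordMul j ψ) x -
      Complex.I / 2 * moyal Θ (f.dirDeriv (matVec Θ (stdVec j))).toFun ψ x := by
  simp only [moyal_eq]
  set φ := hatS d ψ with hφ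
  have hd : ∀ k, fderiv ℝ φ k (stdVec j) = Complex.I * hatS d (coordMul j ψ) k := fun k => by
    rw [← SchwartzMap.lineDerivOp_apply_eq_fderiv, lineDerivOp_hatS]
    rfl
  have hW := hasFDerivAt_moyalWeight Θ f x (j := j)
  have i1 := integrable_moyalWeight_mul Θ f x φ
  have i2 := integrable_moyalWeight_mul Θ (f.dirDeriv (matVec Θ (stdVec j))) x φ
  have i3 := integrable_moyalWeight_mul Θ f x (hatS d (coordMul j ψ))
  have e1 : ∀ k, fderiv ℝ (moyalWeight Θ f x) k (stdVec j) * φ k =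
      (1 / 2 : ℂ) * (moyalWeight Θ (f.dirDeriv (matVec Θ (stdVec j))) x k * φ k) -
        Complex.I * x j * (moyalWeight Θ f x k * φ k) := fun k => by rw [(hW k).2]; ring
  have e2 : ∀ k, moyalWeight Θ f x k * fderiv ℝ φ k (stdVec j) =
      Complex.I * (moyalWeight Θ f x k * hatS d (coordMul j ψ) k) := fun k => by rw [hd]; ring
  have ibp := integral_mul_fderiv_eq_neg_fderiv_mul_of_integrable (μ := (volume : Measure (Rd d)))
    (f := moyalWeight Θ f x) (g := φ) (v := stdVec j)
    (by simp only [e1]; exact (i2.const_mul _).sub (i1.const_mul _))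
    (by simp only [e2]; exact i3.const_mul _) i1 (fun k _ => (hW k).1)
    (fun k _ => φ.differentiableAt)
  simp only [e1, e2] at ibp
  rw [integral_sub (i2.const_mul _) (i1.const_mul _), integral_const_mul, integral_const_mul,
    integral_const_mul] at ibp
  linear_combination Complex.I * ibp +
    (x j * (∫ k, moyalWeight Θ f x k * φ k) - ∫ k, moyalWeight Θ f x k * hatS d (coordMul j ψ) k)
      * Complex.I_sq

theorem exists_continuous_seminorm_sum_le {ι : Type*} (s : Finset ι)
    {p : ι → Seminorm ℂ 𝓢(Rd d, ℂ)} (hp : ∀ i, Continuous (p i)) :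
    ∃ r : Seminorm ℂ 𝓢(Rd d, ℂ), Continuous r ∧ ∀ ψ, ∑ i ∈ s, p i ψ ≤ r ψ := by
  classical
  induction s using Finset.induction_on with
  | empty => exact ⟨0, continuous_const, fun ψ => le_of_eq (by simp)⟩
  | insert i s hi ih =>
    obtain ⟨r, hr, h⟩ := ih
    refine ⟨p i + r, (hp i).add hr, fun ψ => ?_⟩
    rw [Finset.sum_insert hi]
    exact add_le_add le_rfl (h ψ)

theorem norm_le_sum_abs (x : Rd d) : ‖x‖ ≤ ∑ j, |x j| := by
  refine le_of_sq_le_sq ?_ (Finset.sum_nonneg fun j _ => abs_nonneg _)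
  rw [sq_norm_eq_sum]
  refine (Finset.sum_le_sum fun i _ => (sq_abs (x i)).ge).trans ?_
  exact Finset.sum_sq_le_sq_sum_of_nonneg fun i _ => abs_nonneg _

/-- Each power of `‖x‖` is removed by `coord_mul_moyal` at the cost of a derivative of `f`. Such
derivatives stay in `BStar`, so the induction runs over all `f` at once and starts from the `L¹`
norm of the transform of `ψ`. -/
theorem exists_seminorm_pow_mul_moyal_le (n : ℕ) (f : BStar d) :
    ∃ p : Seminorm ℂ 𝓢(Rd d, ℂ), Continuous p ∧
      ∀ (ψ : 𝓢(Rd d, ℂ)) x, ‖x‖ ^ n * ‖moyal Θ f.toFun ψ x‖ ≤ p ψ := by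
  induction n generalizing f with
  | zero =>
    obtain ⟨C, hC0, hC⟩ := f.exists_norm_le
    set J : 𝓢(Rd d, ℂ) →L[ℂ] Lp ℂ 1 (volume : Measure (Rd d)) :=
      SchwartzMap.toLpCLM ℂ ℂ 1 volume ∘L hatS d
    lift C to NNReal using hC0
    refine ⟨C • (normSeminorm ℂ _).comp J.toLinearMap, (J.continuous.norm).const_smul C,
      fun ψ x => ?_⟩
    rw [pow_zero, one_mul, moyal_eq]
    refine (norm_integral_le_integral_norm _).trans ?_
    have h1 : ‖J ψ‖ = ∫ k, ‖hatS d ψ k‖ := by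
      rw [L1.norm_eq_integral_norm]
      refine integral_congr_ae ?_
      filter_upwards [(hatS d ψ).coeFn_toLp 1 volume] with k hk
      exact congrArg norm hk
    change _ ≤ C * ‖J ψ‖
    rw [h1, ← integral_const_mul]
    refine integral_mono_of_nonneg (Eventually.of_forall fun k => norm_nonneg _)
      ((hatS d ψ).integrable.norm.const_mul C) (Eventually.of_forall fun k => ?_)
    simp only
    rw [norm_mul, norm_moyalWeight]
    gcongr
    exact hC _
  | succ n ih =>
    obtain ⟨p, hp, hpb⟩ := ih f
    choose r hr hrb using fun j => ih (f.dirDeriv (matVec Θ (stdVec j)))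
    obtain ⟨s, hs, hsb⟩ := exists_continuous_seminorm_sum_le Finset.univ
      (p := fun j => p.comp (coordMul j).toLinearMap + r j)
      (fun j => (hp.comp (coordMul j).continuous).add (hr j))
    refine ⟨s, hs, fun ψ x => le_trans ?_ (hsb ψ)⟩
    calc ‖x‖ ^ (n + 1) * ‖moyal Θ f.toFun ψ x‖
        ≤ (∑ j, |x j|) * (‖x‖ ^ n * ‖moyal Θ f.toFun ψ x‖) := by
          rw [pow_succ, mul_comm (‖x‖ ^ n), mul_assoc]
          gcongr
          exact norm_le_sum_abs x
      _ = ∑ j, ‖x‖ ^ n * ‖(x j : ℂ) * moyal Θ f.toFun ψ x‖ := by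
          rw [Finset.sum_mul]
          refine Finset.sum_congr rfl fun j _ => ?_
          rw [norm_mul, Complex.norm_real, Real.norm_eq_abs]
          ring
      _ ≤ ∑ j, (p (coordMul j ψ) + r j ψ) := by
          refine Finset.sum_le_sum fun j _ => ?_
          rw [coord_mul_moyal]
          have h1 := hpb (coordMul j ψ) x
          have h2 := hrb j ψ x
          have h3 : ‖Complex.I / 2 * moyal Θ (f.dirDeriv (matVec Θ (stdVec j))).toFun ψ x‖ ≤
              ‖moyal Θ (f.dirDeriv (matVec Θ (stdVec j))).toFun ψ x‖ := by
            rw [norm_mul]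
            exact mul_le_of_le_one_left (norm_nonneg _) (by simp; norm_num)
          refine (mul_le_mul_of_nonneg_left ((norm_sub_le _ _).trans (add_le_add le_rfl h3))
            (by positivity)).trans ?_
          rw [mul_add]
          exact add_le_add h1 h2
      _ = _ := rfl

/-- The functional `ψ ↦ (f ⋆ Dψ)(x)`. -/
def moyalFunctional (f : BStar d) (D : 𝓢(Rd d, ℂ) →L[ℂ] 𝓢(Rd d, ℂ)) (x : Rd d) :
    𝓢(Rd d, ℂ) →ₗ[ℂ] ℂ where
  toFun ψ := moyal Θ f.toFun (D ψ) x
  map_add' ψ φ := by rw [map_add, moyal_add]; rfl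
  map_smul' c ψ := by rw [map_smul, moyal_smul]; rfl

theorem isRapid_moyalFunctional (f : BStar d) (D : 𝓢(Rd d, ℂ) →L[ℂ] 𝓢(Rd d, ℂ)) :
    IsRapid (moyalFunctional Θ f D) :=
  isRapid_of_forall_pow fun n => by
    obtain ⟨p, hp, h⟩ := exists_seminorm_pow_mul_moyal_le Θ n f
    exact ⟨p.comp D.toLinearMap, hp.comp D.continuous, fun ψ x => h (D ψ) x⟩

/-! ### Graphs of the closed operators and the traced operator -/

theorem mem_graph_closedOp (P : 𝓢(Rd d, ℂ) →ₗ.[ℂ] L2 d) (ψ : P.domain) :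
    (schwartzToL2 d ψ, P ψ) ∈ (closedOp P).graph := by
  refine LinearPMap.le_graph_of_le (LinearPMap.le_closure _) ?_
  rw [LinearPMap.mem_graph_iff]
  refine ⟨⟨schwartzToL2 d ψ, ψ, ψ.2, rfl⟩, rfl, ?_⟩
  have key : (P.domain.equivMapOfInjective (schwartzToL2 d)
      (schwartzToL2_injective d)).symm ⟨schwartzToL2 d ψ, ψ, ψ.2, rfl⟩ = ψ := by
    rw [LinearEquiv.symm_apply_eq]
    rfl
  exact congrArg P.toFun key

theorem schwartz_mem_graph_leftMoyal (f : BStar d) (ψ : 𝓢(Rd d, ℂ)) (g : L2 d)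
    (hg : g =ᵐ[volume] moyal Θ f.toFun ψ) : (schwartzToL2 d ψ, g) ∈ (leftMoyal Θ f).graph := by
  have hmem : MemLp (moyal Θ f.toFun ψ) 2 volume := (memLp_congr_ae hg).1 (Lp.memLp g)
  have hgl : g = hmem.toLp _ := Lp.ext (hg.trans hmem.coeFn_toLp.symm)
  rw [hgl]
  exact mem_graph_closedOp (moyalS Θ f) ⟨ψ, hmem⟩

/-- The product `∇_{μ_1} ⋯ ∇_{μ_k}` on Schwartz functions. -/
def nablaProd (Ω : ℝ) (l : List (Fin d)) : 𝓢(Rd d, ℂ) →L[ℂ] 𝓢(Rd d, ℂ) :=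
  l.foldr (fun ν A => nablaS Θ Ω ν ∘L A) (ContinuousLinearMap.id ℂ _)

/-- After `e^{-tH}` every vector is a Schwartz function and remains one under each `∇`, so no vector
leaves the natural domains. -/
theorem mem_graph_foldr_nabla {Ω t : ℝ} (hΩ : 0 < Ω) (ht : 0 < t) (l : List (Fin d)) (g : L2 d) :
    (g, schwartzToL2 d (nablaProd Θ Ω l (heatTime d Ω t g))) ∈
      (l.foldr (fun ν A => pcomp (nabla Θ Ω ν) A)
        ((expNeg (oscillator d Ω) t).toLinearMap.toPMap ⊤)).graph := by
  induction l with
  | nil =>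
    rw [List.foldr_nil, LinearPMap.mem_graph_iff]
    refine ⟨⟨g, Submodule.mem_top⟩, rfl, ?_⟩
    change expNeg (oscillator d Ω) t g = schwartzToL2 d (heatTime d Ω t g)
    rw [expNeg_oscillator hΩ ht.le, schwartzToL2_heatTime ht]
  | cons ν l ih =>
    rw [List.foldr_cons, mem_graph_pcomp]
    exact ⟨_, ih, schwartz_mem_graph_closedOpOfEnd (nablaS Θ Ω ν) _⟩

/-- A graph is single-valued, so it cannot properly contain the graph of an everywhere defined
operator. -/
theorem eq_toPMap_of_forall_mem_graph {A : L2 d →ₗ.[ℂ] L2 d} {T : L2 d →L[ℂ] L2 d}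
    (h : ∀ g, (g, T g) ∈ A.graph) : A = T.toLinearMap.toPMap ⊤ := by
  refine (LinearPMap.eq_of_eq_graph ?_)
  ext ⟨x, y⟩
  have h2 : (x, y) ∈ (T.toLinearMap.toPMap ⊤).graph ↔ y = T x := by
    rw [LinearPMap.mem_graph_iff]
    constructor
    · rintro ⟨z, hz, rfl⟩
      exact congrArg T hz
    · rintro rfl
      exact ⟨⟨x, Submodule.mem_top⟩, rfl, rfl⟩
  rw [h2]
  constructor
  · intro hxy
    exact LinearPMap.mem_graph_snd_inj A hxy (h x) rfl
  · rintro rfl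
    exact h x

/-- The operator `L_⋆(f) ∇_{μ_1} ⋯ ∇_{μ_k} e^{-tH}` and its trace as an integral over the
diagonal. -/
theorem exists_tracedOp_eq_hasTrace {Ω t : ℝ} (hΩ : 0 < Ω) (ht : 0 < t) (f : BStar d) {k : ℕ}
    (μ : Fin k → Fin d) :
    ∃ T : L2 d →L[ℂ] L2 d, tracedOp Θ Ω t f μ = T.toLinearMap.toPMap ⊤ ∧
      HasTrace T (∫ x, moyal Θ f.toFun (nablaProd Θ Ω (List.ofFn μ) (kernelTime d Ω t x)) x) := by
  obtain ⟨T, hT, htr⟩ := exists_hasTrace_of_isRapid hΩ ht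
    (isRapid_moyalFunctional Θ f (nablaProd Θ Ω (List.ofFn μ)))
    (fun ψ => (continuous_moyal Θ f _).aestronglyMeasurable)
  refine ⟨T, eq_toPMap_of_forall_mem_graph fun g => ?_, htr⟩
  rw [tracedOp, mem_graph_pcomp]
  exact ⟨_, mem_graph_foldr_nabla Θ hΩ ht _ g, schwartz_mem_graph_leftMoyal Θ f _ _ (hT g)⟩

end Moyal

/-! ### Wick polynomials -/

section Wick

variable {k : ℕ}

/-- The involutions of `{1, …, k}` that fix everything outside `S`. -/
def pairingsOn (S : Finset (Fin k)) : Finset (Equiv.Perm (Fin k)) :=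
  (pairings k).filter fun σ => ∀ i ∉ S, σ i = i

theorem mem_pairingsOn {S : Finset (Fin k)} {σ : Equiv.Perm (Fin k)} :
    σ ∈ pairingsOn S ↔ (∀ i, σ (σ i) = i) ∧ ∀ i ∉ S, σ i = i := by
  simp [pairingsOn, pairings]

/-- The weight of a pairing: a factor `Z_i` for each unpaired index and a factor `N_{ij}` for each
pair. -/
def wickWeight (Z : Fin k → ℂ) (N : Fin k → Fin k → ℂ) (S : Finset (Fin k))
    (σ : Equiv.Perm (Fin k)) : ℂ :=
  (∏ i ∈ S.filter (fun i => σ i = i), Z i) * ∏ i ∈ S.filter (fun i => i < σ i), N i (σ i)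

/-- The Wick polynomial of the indices in `S`. -/
def wick (Z : Fin k → ℂ) (N : Fin k → Fin k → ℂ) (S : Finset (Fin k)) : ℂ :=
  ∑ σ ∈ pairingsOn S, wickWeight Z N S σ

theorem wick_empty (Z : Fin k → ℂ) (N : Fin k → Fin k → ℂ) : wick Z N ∅ = 1 := by
  have h : pairingsOn (∅ : Finset (Fin k)) = {1} := by
    ext σ
    simp only [mem_pairingsOn, Finset.notMem_empty, not_false_eq_true, forall_const,
      Finset.mem_singleton]
    constructor
    · rintro ⟨-, h⟩
      exact Equiv.ext h
    · rintro rfl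
      simp
  simp [wick, h, wickWeight]

theorem filter_pairingsOn_fixed {S : Finset (Fin k)} (j : Fin k) :
    (pairingsOn S).filter (fun σ => σ j = j) = pairingsOn (S.erase j) := by
  ext σ
  simp only [Finset.mem_filter, mem_pairingsOn, Finset.mem_erase, not_and]
  constructor
  · rintro ⟨⟨h1, h2⟩, h3⟩
    refine ⟨h1, fun i hi => ?_⟩
    by_cases hij : i = j
    · rw [hij, h3]
    · exact h2 i (hi hij)
  · rintro ⟨h1, h2⟩
    exact ⟨⟨h1, fun i hi => h2 i fun _ => hi⟩, h2 j fun h => absurd rfl h⟩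

theorem filter_lt_erase_of_fixed {S : Finset (Fin k)} {σ : Equiv.Perm (Fin k)} {j : Fin k}
    (h : σ j = j) : (S.erase j).filter (fun i => i < σ i) = S.filter fun i => i < σ i := by
  rw [Finset.filter_erase, Finset.erase_eq_of_notMem]
  simp [h]

theorem wickWeight_of_fixed (Z : Fin k → ℂ) (N : Fin k → Fin k → ℂ) {S : Finset (Fin k)}
    {σ : Equiv.Perm (Fin k)} {j : Fin k} (hj : j ∈ S) (h : σ j = j) :
    wickWeight Z N S σ = Z j * wickWeight Z N (S.erase j) σ := by
  have h1 : (S.erase j).filter (fun i => σ i = i) = (S.filter fun i => σ i = i).erase j :=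
    Finset.filter_erase _ _ _
  rw [wickWeight, wickWeight, h1, filter_lt_erase_of_fixed h, ← mul_assoc, Finset.mul_prod_erase _ _ (by simp [hj, h])]

theorem swap_mul_apply_of_ne {σ : Equiv.Perm (Fin k)} (h : ∀ i, σ (σ i) = i) {m j i : Fin k}
    (hm : σ m = j) (him : i ≠ m) (hij : i ≠ j) : (Equiv.swap m j * σ) i = σ i := by
  rw [Equiv.Perm.mul_apply]
  refine Equiv.swap_apply_of_ne_of_ne (fun h1 => hij ?_) (fun h1 => him ?_)
  · rw [← h i, h1, hm]
  · rw [← h i, h1, ← hm, h]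

/-- Multiplication by the transposition of `m` and `j` is a bijection between the involutions that
pair `m` with `j` and those that fix both. It removes exactly the factor `N m j`, counted at `m`
because `m < j`. -/
theorem sum_wickWeight_paired (Z : Fin k → ℂ) (N : Fin k → Fin k → ℂ) {S : Finset (Fin k)}
    {m j : Fin k} (hm : ∀ i ∈ S, m < i) (hj : j ∈ S) :
    ∑ σ ∈ (pairingsOn (insert m S)).filter (fun σ => σ m = j), wickWeight Z N (insert m S) σ =
      N m j * wick Z N (S.erase j) := by
  have hmj : m < j := hm j hj
  have hmS : m ∉ S := fun h => lt_irrefl _ (hm m h)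
  rw [wick, Finset.mul_sum]
  refine Finset.sum_nbij' (fun σ => Equiv.swap m j * σ) (fun σ => Equiv.swap m j * σ) ?_ ?_ ?_ ?_ ?_
  · intro σ hσ
    simp only [Finset.mem_filter, mem_pairingsOn] at hσ
    obtain ⟨⟨h1, h2⟩, h3⟩ := hσ
    have h4 : σ j = m := by rw [← h3, h1]
    have ej : (Equiv.swap m j * σ) j = j := by simp [h4]
    have em : (Equiv.swap m j * σ) m = m := by simp [h3]
    have en : ∀ i, i ≠ m → i ≠ j → (Equiv.swap m j * σ) i = σ i := fun i =>
      swap_mul_apply_of_ne h1 h3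
    refine mem_pairingsOn.2 ⟨fun i => ?_, fun i hi => ?_⟩
    · by_cases him : i = m
      · rw [him, em, em]
      by_cases hij : i = j
      · rw [hij, ej, ej]
      rw [en i him hij, en (σ i) (fun h => hij (by rw [← h1 i, h, h3]))
        (fun h => him (by rw [← h1 i, h, h4])), h1]
    · by_cases him : i = m
      · rw [him, em]
      by_cases hij : i = j
      · rw [hij, ej]
      rw [en i him hij]
      exact h2 i (by simp_all)
  · intro σ hσ
    obtain ⟨h1, h2⟩ := mem_pairingsOn.1 hσ
    have hfm : σ m = m := h2 m (by simp [hmS])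
    have hfj : σ j = j := h2 j (by simp)
    have hne : ∀ i, i ≠ m → i ≠ j → (Equiv.swap m j * σ) i = σ i := fun i him hij => by
      rw [Equiv.Perm.mul_apply]
      refine Equiv.swap_apply_of_ne_of_ne (fun h => him ?_) (fun h => hij ?_)
      · exact σ.injective (h.trans hfm.symm)
      · exact σ.injective (h.trans hfj.symm)
    have ej : (Equiv.swap m j * σ) j = m := by simp [hfj]
    have em : (Equiv.swap m j * σ) m = j := by simp [hfm]
    simp only [Finset.mem_filter, mem_pairingsOn]
    refine ⟨⟨fun i => ?_, fun i hi => ?_⟩, em⟩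
    · by_cases him : i = m
      · rw [him, em, ej]
      by_cases hij : i = j
      · rw [hij, ej, em]
      rw [hne i him hij, hne (σ i) (fun h => him (σ.injective (h.trans hfm.symm)))
        (fun h => hij (σ.injective (h.trans hfj.symm))), h1]
    · simp only [Finset.mem_insert, not_or] at hi
      have hij : i ≠ j := fun h => hi.2 (h ▸ hj)
      rw [hne i hi.1 hij]
      exact h2 i (by simp [hi.2])
  · intro σ _
    simp [← mul_assoc]
  · intro σ _
    simp [← mul_assoc]
  · intro σ hσ
    simp only [Finset.mem_filter, mem_pairingsOn] at hσ
    obtain ⟨⟨h1, h2⟩, h3⟩ := hσ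
    have h4 : σ j = m := by rw [← h3, h1]
    have en : ∀ i ∈ S.erase j, (Equiv.swap m j * σ) i = σ i := fun i hi =>
      swap_mul_apply_of_ne h1 h3 (fun h => hmS (h ▸ Finset.mem_of_mem_erase hi))
        (Finset.ne_of_mem_erase hi)
    have f1 : (insert m S).filter (fun i => σ i = i) =
        (S.erase j).filter fun i => (Equiv.swap m j * σ) i = i := by
      ext i
      simp only [Finset.mem_filter, Finset.mem_insert]
      constructor
      · rintro ⟨rfl | hi, h⟩
        · exact absurd (h3.symm.trans h) hmj.ne'
        · have hij : i ≠ j := by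
            rintro rfl
            exact hmj.ne (h4.symm.trans h)
          have hmem := Finset.mem_erase.2 ⟨hij, hi⟩
          exact ⟨hmem, (en i hmem).trans h⟩
      · rintro ⟨hi, h⟩
        exact ⟨Or.inr (Finset.mem_of_mem_erase hi), (en i hi).symm.trans h⟩
    have f2 : (insert m S).filter (fun i => i < σ i) =
        insert m ((S.erase j).filter fun i => i < (Equiv.swap m j * σ) i) := by
      ext i
      simp only [Finset.mem_filter, Finset.mem_insert]
      constructor
      · rintro ⟨rfl | hi, h⟩
        · exact Or.inl rfl
        · have hij : i ≠ j := by
            rintro rfl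
            rw [h4] at h
            exact lt_asymm h hmj
          have hmem := Finset.mem_erase.2 ⟨hij, hi⟩
          exact Or.inr ⟨hmem, by rwa [en i hmem]⟩
      · rintro (rfl | ⟨hi, h⟩)
        · exact ⟨Or.inl rfl, by rwa [h3]⟩
        · rw [en i hi] at h
          exact ⟨Or.inr (Finset.mem_of_mem_erase hi), h⟩
    rw [wickWeight, wickWeight, f1, f2,
      Finset.prod_insert (fun h => hmS (Finset.mem_of_mem_erase (Finset.mem_filter.1 h).1)), h3, mul_left_comm]
    congr 2
    refine Finset.prod_congr rfl fun i hi => ?_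
    rw [en i (Finset.mem_filter.1 hi).1]

/-- The recursion of Wick polynomials, in the smallest index. -/
theorem wick_insert (Z : Fin k → ℂ) (N : Fin k → Fin k → ℂ) {S : Finset (Fin k)} {m : Fin k}
    (hm : ∀ i ∈ S, m < i) :
    wick Z N (insert m S) = Z m * wick Z N S + ∑ j ∈ S, N m j * wick Z N (S.erase j) := by
  have hmS : m ∉ S := fun h => lt_irrefl _ (hm m h)
  have hmaps : ∀ σ ∈ pairingsOn (insert m S), σ m ∈ insert m S := by
    intro σ hσ
    obtain ⟨h1, h2⟩ := mem_pairingsOn.1 hσ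
    by_contra h
    have h3 := h2 _ h
    rw [h1] at h3
    rw [← h3] at h
    exact h (Finset.mem_insert_self m S)
  -- The involutions are sorted by the image of `m`: `m` itself if it is unpaired, its partner
  -- otherwise.
  rw [wick, ← Finset.sum_fiberwise_of_maps_to hmaps, Finset.sum_insert hmS]
  congr 1
  · rw [filter_pairingsOn_fixed, Finset.erase_insert hmS, wick, Finset.mul_sum]
    refine Finset.sum_congr rfl fun σ hσ => ?_
    rw [wickWeight_of_fixed Z N (Finset.mem_insert_self m S) ((mem_pairingsOn.1 hσ).2 m hmS),
      Finset.erase_insert hmS]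
  · exact Finset.sum_congr rfl fun j hj => sum_wickWeight_paired Z N hm hj

/-- Only unpaired factors vary. Deleting the factor of an unpaired `j` leaves a weight for `S.erase
j`, so Wick polynomials are differentiated as Hermite polynomials are. -/
theorem hasDerivAt_wick {Z : ℝ → Fin k → ℂ} {η : Fin k → ℂ} (N : Fin k → Fin k → ℂ) {s : ℝ}
    (h : ∀ i, HasDerivAt (fun s => Z s i) (η i) s) (S : Finset (Fin k)) :
    HasDerivAt (fun s => wick (Z s) N S) (∑ j ∈ S, η j * wick (Z s) N (S.erase j)) s := by
  have h1 : ∀ σ : Equiv.Perm (Fin k), HasDerivAt (fun s => wickWeight (Z s) N S σ)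
      (∑ j ∈ S.filter (fun i => σ i = i), η j * wickWeight (Z s) N (S.erase j) σ) s := fun σ => by
    refine ((HasDerivAt.fun_finsetProd fun i _ => h i).mul_const _).congr_deriv ?_
    rw [Finset.sum_mul]
    refine Finset.sum_congr rfl fun j hj => ?_
    rw [wickWeight, Finset.filter_erase, filter_lt_erase_of_fixed (Finset.mem_filter.1 hj).2, smul_eq_mul]
    ring
  refine (HasDerivAt.fun_sum fun σ _ => h1 σ).congr_deriv ?_
  simp only [wick, Finset.mul_sum, ← filter_pairingsOn_fixed]
  rw [Finset.sum_comm' (t' := S) (s' := fun j => (pairingsOn S).filter fun σ => σ j = j)]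
  intro σ j
  simp only [Finset.mem_filter]
  tauto

theorem norm_wick_le (N : Fin k → Fin k → ℂ) (S : Finset (Fin k)) :
    ∃ C : ℝ, 0 ≤ C ∧ ∀ (Z : Fin k → ℂ) (R : ℝ), 1 ≤ R → (∀ i, ‖Z i‖ ≤ R) →
      ‖wick Z N S‖ ≤ C * R ^ k := by
  refine ⟨∑ σ ∈ pairingsOn S, ∏ i ∈ S.filter (fun i => i < σ i), ‖N i (σ i)‖,
    Finset.sum_nonneg fun σ _ => Finset.prod_nonneg fun i _ => norm_nonneg _, fun Z R hR hZ => ?_⟩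
  rw [wick, Finset.sum_mul]
  refine (norm_sum_le _ _).trans (Finset.sum_le_sum fun σ _ => ?_)
  rw [wickWeight, norm_mul, norm_prod, norm_prod, mul_comm]
  refine mul_le_mul_of_nonneg_left ?_ (Finset.prod_nonneg fun i _ => norm_nonneg _)
  refine (Finset.prod_le_prod (fun i _ => norm_nonneg _) fun i _ => hZ i).trans ?_
  rw [Finset.prod_const]
  refine pow_le_pow_right₀ hR ?_
  exact (Finset.card_le_univ _).trans_eq (Fintype.card_fin k)

theorem continuous_wick {X : Type*} [TopologicalSpace X] {Z : X → Fin k → ℂ}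
    (hZ : ∀ i, Continuous fun x => Z x i) (N : Fin k → Fin k → ℂ) (S : Finset (Fin k)) :
    Continuous fun x => wick (Z x) N S := by
  unfold wick wickWeight
  fun_prop

theorem wick_univ (Z : Fin k → ℂ) (N : Fin k → Fin k → ℂ) :
    wick Z N Finset.univ = ∑ σ ∈ pairings k,
      (∏ i ∈ Finset.univ.filter (fun i => σ i = i), Z i) *
        ∏ i ∈ Finset.univ.filter (fun i => i < σ i), N i (σ i) := by
  rw [wick, pairingsOn, Finset.filter_true_of_mem fun σ _ i hi => absurd (Finset.mem_univ i) hi]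
  rfl

end Wick

/-! ### Covariant derivatives of Gaussians and Gaussian integrals of Wick polynomials -/

section WickGauss

variable {d k : ℕ} (Θ : Matrix (Fin d) (Fin d) ℝ) (Ω : ℝ)

/-- A vector of `ℝ^d` with complex components. -/
def cvec (x : Rd d) : Fin d → ℂ := fun i => (x i : ℂ)

/-- The matrix of the linear part of the symbol of `∇` acting on a Gaussian of exponent `c`. -/
def symbolMat (c : ℝ) : Matrix (Fin d) (Fin d) ℂ :=
  -(Complex.I • (1 : Matrix (Fin d) (Fin d) ℂ)) - (Ω ^ 2 / (4 * c) : ℂ) • Θ.map Complex.ofReal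

/-- The symbol of `∇` acting on a Gaussian. -/
def symbol (c : ℝ) (u : Fin d → ℂ) (κ : Rd d) : Fin d → ℂ :=
  symbolMat Θ Ω c *ᵥ cvec κ + (Complex.I * Ω ^ 2 / (4 * c) : ℂ) • (Θ.map Complex.ofReal *ᵥ u)

/-- The contractions of the symbol of `∇`. -/
def symbolContraction (c : ℝ) : Matrix (Fin d) (Fin d) ℂ :=
  (Ω ^ 2 / 2 : ℂ) • (Θ.map Complex.ofReal * (symbolMat Θ Ω c)ᵀ)

theorem hatS_coordMul (φ : 𝓢(Rd d, ℂ)) (ρ : Fin d) :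
    hatS d (coordMul ρ φ) = -Complex.I • LineDeriv.lineDerivOp (stdVec ρ) (hatS d φ) := by
  rw [lineDerivOp_hatS, smul_smul, neg_mul, Complex.I_mul_I, neg_neg, one_smul]

theorem nablaS_eq (ν : Fin d) (φ : 𝓢(Rd d, ℂ)) :
    nablaS Θ Ω ν φ = LineDeriv.lineDerivOp (stdVec ν) φ +
      ∑ ρ, (Complex.I / 2 * Ω ^ 2 * Θ ν ρ : ℂ) • coordMul ρ φ := by
  ext x
  rw [nablaS_apply, _root_.add_apply, SchwartzMap.lineDerivOp_apply, _root_.sum_apply]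
  simp only [_root_.smul_apply, coordMul_apply, smul_eq_mul]
  push_cast
  rw [Finset.mul_sum, Finset.sum_mul]
  congr 1
  exact Finset.sum_congr rfl fun ρ _ => by ring

/-- In this convention `∂_ν` becomes multiplication by `-iκ_ν` and `x_ρ` becomes `-i∂_ρ`. -/
theorem hatS_nablaS (ν : Fin d) (φ : 𝓢(Rd d, ℂ)) (κ : Rd d) :
    hatS d (nablaS Θ Ω ν φ) κ = -Complex.I * κ ν * hatS d φ κ +
      (Ω ^ 2 / 2 : ℂ) * ∑ ρ, (Θ ν ρ : ℂ) * LineDeriv.lineDerivOp (stdVec ρ) (hatS d φ) κ := by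
  rw [nablaS_eq, map_add, map_sum, hatS_lineDerivOp, _root_.add_apply, _root_.sum_apply,
    _root_.smul_apply, coordMul_apply, Finset.mul_sum]
  simp only [map_smul, hatS_coordMul, _root_.smul_apply, smul_eq_mul]
  congr 1
  · ring
  · refine Finset.sum_congr rfl fun ρ _ => ?_
    linear_combination (-(Ω : ℂ) ^ 2 / 2 * Θ ν ρ *
      LineDeriv.lineDerivOp (stdVec ρ) (hatS d φ) κ) * Complex.I_sq

theorem SchwartzMap.hasLineDerivAt (φ : 𝓢(Rd d, ℂ)) (v x : Rd d) :
    HasLineDerivAt ℝ (φ : Rd d → ℂ) (LineDeriv.lineDerivOp v φ x) x v := by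
  rw [SchwartzMap.lineDerivOp_apply_eq_fderiv]
  exact φ.differentiableAt.hasFDerivAt.hasLineDerivAt v

/-- The first-order differential equation of the Gaussian is Fourier transformed and solved for the
derivative, with no explicit formula for the transform. -/
theorem lineDerivOp_hatS_gauss {c : ℝ} (hc : 0 < c) (u : Fin d → ℂ) (ρ : Fin d) (κ : Rd d) :
    LineDeriv.lineDerivOp (stdVec ρ) (hatS d (gauss c u)) κ =
      (Complex.I * u ρ - κ ρ) / (2 * c) * hatS d (gauss c u) κ := by
  have hc' : (c : ℂ) ≠ 0 := by exact_mod_cast hc.ne'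
  have h := congrArg (fun φ => hatS d φ κ) (lineDerivOp_gauss hc u ρ)
  simp only [map_add, map_smul] at h
  rw [hatS_lineDerivOp, _root_.add_apply, _root_.smul_apply, _root_.smul_apply, _root_.smul_apply,
    coordMul_apply] at h
  rw [lineDerivOp_hatS, _root_.smul_apply]
  simp only [smul_eq_mul] at h ⊢
  have h2 : hatS d (coordMul ρ (gauss c u)) κ =
      (u ρ + Complex.I * κ ρ) / (2 * c) * hatS d (gauss c u) κ := by
    field_simp
    linear_combination h
  rw [h2]
  field_simp
  linear_combination (κ ρ * hatS d (gauss c u) κ : ℂ) * Complex.I_sq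

theorem hasDerivAt_affine (lam : ℂ) (Y : Fin d → ℂ) (y : Rd d) (ρ : Fin d) :
    HasDerivAt (fun s : ℝ => lam + ∑ σ, Y σ * ((y + s • stdVec ρ) σ : ℂ)) (Y ρ) 0 := by
  have h : ∀ s : ℝ, lam + ∑ σ, Y σ * ((y + s • stdVec ρ) σ : ℂ) =
      (lam + ∑ σ, Y σ * (y σ : ℂ)) + (s : ℂ) * Y ρ := fun s => by
    have h1 : ∀ σ, Y σ * ((y + s • stdVec ρ) σ : ℂ) =
        Y σ * (y σ : ℂ) + if σ = ρ then (s : ℂ) * Y ρ else 0 := fun σ => by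
      by_cases hσ : σ = ρ
      · subst hσ; simp; ring
      · simp [hσ]
    simp only [h1, Finset.sum_add_distrib, Finset.sum_ite_eq', Finset.mem_univ, if_true]
    ring
  simp only [h]
  have hid : HasDerivAt (fun s : ℝ => (s : ℂ)) 1 0 := Complex.ofRealCLM.hasDerivAt
  exact ((hid.mul_const (Y ρ)).const_add _).congr_deriv (one_mul _)

theorem hasLineDerivAt_wick (lam : Fin k → ℂ) (Y : Fin k → Fin d → ℂ) (N : Fin k → Fin k → ℂ)
    (S : Finset (Fin k)) (y : Rd d) (ρ : Fin d) :
    HasLineDerivAt ℝ (fun y : Rd d => wick (fun i => lam i + ∑ σ, Y i σ * (y σ : ℂ)) N S)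
      (∑ j ∈ S, Y j ρ * wick (fun i => lam i + ∑ σ, Y i σ * (y σ : ℂ)) N (S.erase j)) y
      (stdVec ρ) := by
  have h := hasDerivAt_wick N (fun i => hasDerivAt_affine (lam i) (Y i) y ρ) S
  simp only [zero_smul, add_zero] at h
  exact h

theorem symbol_eq (c : ℝ) (u : Fin d → ℂ) (κ : Rd d) (ν : Fin d) :
    symbol Θ Ω c u κ ν = Complex.I * Ω ^ 2 / (4 * c) * ∑ ρ, (Θ ν ρ : ℂ) * u ρ +
      ∑ ρ, symbolMat Θ Ω c ν ρ * (κ ρ : ℂ) := by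
  rw [add_comm]
  rfl

theorem sum_symbolMat_mul (c : ℝ) (κ : Rd d) (ν : Fin d) :
    ∑ ρ, symbolMat Θ Ω c ν ρ * (κ ρ : ℂ) =
      -Complex.I * κ ν - Ω ^ 2 / (4 * c) * ∑ ρ, (Θ ν ρ : ℂ) * κ ρ := by
  simp only [symbolMat, Matrix.sub_apply, Matrix.neg_apply, Matrix.smul_apply, smul_eq_mul,
    Matrix.one_apply, Matrix.map_apply, sub_mul, Finset.sum_sub_distrib, Finset.mul_sum]
  congr 1
  · simp
  · exact Finset.sum_congr rfl fun ρ _ => by ring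

/-- A further `∇` on the left acts by a multiplication and a derivative in `κ`. The derivative of
the Gaussian completes the multiplication to the symbol of the new index, and the derivative of the
symbol of `j` is its contraction with `j`. This is the recursion `wick_insert`, the leftmost index
being the smallest. -/
theorem hatS_nablaProd_gauss {c : ℝ} (hc : 0 < c) (u : Fin d → ℂ) (μ : Fin k → Fin d)
    {l : List (Fin k)} (hl : l.Pairwise (· < ·)) (κ : Rd d) :
    hatS d (nablaProd Θ Ω (l.map μ) (gauss c u)) κ =
      wick (fun i => symbol Θ Ω c u κ (μ i))
        (fun i j => symbolContraction Θ Ω c (μ i) (μ j)) l.toFinset * hatS d (gauss c u) κ := by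
  have hc' : (c : ℂ) ≠ 0 := by exact_mod_cast hc.ne'
  induction l generalizing κ with
  | nil =>
    rw [List.map_nil, List.toFinset_nil, wick_empty, one_mul]
    rfl
  | cons m l ih =>
    rw [List.pairwise_cons] at hl
    have ih' := ih hl.2
    set φ := nablaProd Θ Ω (l.map μ) (gauss c u) with hφ
    change hatS d (nablaS Θ Ω (μ m) φ) κ = _
    have hd : ∀ ρ, (LineDeriv.lineDerivOp (stdVec ρ) (hatS d φ) : 𝓢(Rd d, ℂ)) κ =
        (∑ j ∈ l.toFinset, symbolMat Θ Ω c (μ j) ρ * wick (fun i => symbol Θ Ω c u κ (μ i))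
          (fun i j => symbolContraction Θ Ω c (μ i) (μ j)) (l.toFinset.erase j)) *
            hatS d (gauss c u) κ +
        wick (fun i => symbol Θ Ω c u κ (μ i))
          (fun i j => symbolContraction Θ Ω c (μ i) (μ j)) l.toFinset *
          ((Complex.I * u ρ - κ ρ) / (2 * c) * hatS d (gauss c u) κ) := fun ρ => by
      have h1 := hasLineDerivAt_wick
        (fun i => Complex.I * Ω ^ 2 / (4 * c) * ∑ ρ, (Θ (μ i) ρ : ℂ) * u ρ)
        (fun i ρ => symbolMat Θ Ω c (μ i) ρ)
        (fun i j => symbolContraction Θ Ω c (μ i) (μ j)) l.toFinset κ ρ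
      simp only [← symbol_eq] at h1
      have h2 := SchwartzMap.hasLineDerivAt (hatS d (gauss c u)) (stdVec ρ) κ
      have h3 := SchwartzMap.hasLineDerivAt (hatS d φ) (stdVec ρ) κ
      rw [funext ih'] at h3
      have h4 := HasDerivAt.unique h3 (HasDerivAt.mul h1 h2)
      rw [h4, lineDerivOp_hatS_gauss hc]
      simp only [zero_smul, add_zero]
    rw [hatS_nablaS, ih', List.toFinset_cons, wick_insert _ _ fun i hi =>
      hl.1 i (List.mem_toFinset.1 hi), symbol_eq, sum_symbolMat_mul]
    simp only [hd]
    set W := fun S => wick (fun i => symbol Θ Ω c u κ (μ i))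
      (fun i j => symbolContraction Θ Ω c (μ i) (μ j)) S with hW
    have e1 : ∑ j ∈ l.toFinset, symbolContraction Θ Ω c (μ m) (μ j) * W (l.toFinset.erase j) =
        (Ω ^ 2 / 2 : ℂ) * ∑ ρ, (Θ (μ m) ρ : ℂ) * ∑ j ∈ l.toFinset,
          symbolMat Θ Ω c (μ j) ρ * W (l.toFinset.erase j) := by
      simp only [symbolContraction, Matrix.smul_apply, smul_eq_mul, Matrix.mul_apply,
        Matrix.transpose_apply, Matrix.map_apply, Finset.mul_sum, Finset.sum_mul]
      rw [Finset.sum_comm]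
      refine Finset.sum_congr rfl fun ρ _ => Finset.sum_congr rfl fun j _ => ?_
      ring
    have e2 : ∑ ρ, (Θ (μ m) ρ : ℂ) * ((∑ j ∈ l.toFinset, symbolMat Θ Ω c (μ j) ρ *
          W (l.toFinset.erase j)) * hatS d (gauss c u) κ +
          W l.toFinset * ((Complex.I * u ρ - κ ρ) / (2 * c) * hatS d (gauss c u) κ)) =
        (∑ ρ, (Θ (μ m) ρ : ℂ) * ∑ j ∈ l.toFinset, symbolMat Θ Ω c (μ j) ρ *
          W (l.toFinset.erase j)) * hatS d (gauss c u) κ +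
        (Complex.I * (∑ ρ, (Θ (μ m) ρ : ℂ) * u ρ) - ∑ ρ, (Θ (μ m) ρ : ℂ) * κ ρ) / (2 * c) *
          W l.toFinset * hatS d (gauss c u) κ := by
      rw [Finset.mul_sum, ← Finset.sum_sub_distrib, Finset.sum_div, Finset.sum_mul, Finset.sum_mul,
        Finset.sum_mul, ← Finset.sum_add_distrib]
      exact Finset.sum_congr rfl fun ρ _ => by ring
    rw [e1, e2]
    generalize (∑ ρ, (Θ (μ m) ρ : ℂ) * ∑ j ∈ l.toFinset, symbolMat Θ Ω c (μ j) ρ *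
          W (l.toFinset.erase j)) = A₁
    generalize (∑ ρ, (Θ (μ m) ρ : ℂ) * u ρ) = A₂
    generalize (∑ ρ, (Θ (μ m) ρ : ℂ) * κ ρ) = A₃
    change -Complex.I * κ (μ m) * (W l.toFinset * _) + _ = _
    field_simp
    ring

theorem exists_norm_affine_le (lam : Fin k → ℂ) (Y : Fin k → Fin d → ℂ) :
    ∃ K : ℝ, 1 ≤ K ∧ ∀ (y : Rd d) i, ‖lam i + ∑ σ, Y i σ * (y σ : ℂ)‖ ≤ K * (1 + ‖y‖) := by
  refine ⟨1 + ∑ i, (‖lam i‖ + ∑ σ, ‖Y i σ‖), ?_, fun y i => ?_⟩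
  · have : 0 ≤ ∑ i, (‖lam i‖ + ∑ σ, ‖Y i σ‖) := by positivity
    linarith
  · have h1 : ‖lam i‖ + ∑ σ, ‖Y i σ‖ ≤ ∑ i, (‖lam i‖ + ∑ σ, ‖Y i σ‖) :=
      Finset.single_le_sum (f := fun i => ‖lam i‖ + ∑ σ, ‖Y i σ‖) (fun i _ => by positivity)
        (Finset.mem_univ i)
    have h2 : 0 ≤ ∑ σ, ‖Y i σ‖ := by positivity
    have h3 := norm_nonneg y
    have h4 := norm_nonneg (lam i)
    refine (norm_add_le _ _).trans ((add_le_add le_rfl (norm_sum_mul_coord_le (Y i) y)).trans ?_)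
    nlinarith

theorem integrable_wick_mul (lam : Fin k → ℂ) (Y : Fin k → Fin d → ℂ) (N : Fin k → Fin k → ℂ)
    (S : Finset (Fin k)) (φ : 𝓢(Rd d, ℂ)) :
    Integrable fun y : Rd d => wick (fun i => lam i + ∑ σ, Y i σ * (y σ : ℂ)) N S * φ y := by
  obtain ⟨C, hC, hCb⟩ := norm_wick_le N S
  obtain ⟨K, hK, hKb⟩ := exists_norm_affine_le lam Y
  have hcont : Continuous fun y : Rd d => wick (fun i => lam i + ∑ σ, Y i σ * (y σ : ℂ)) N S :=
    continuous_wick (fun i => by fun_prop) N S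
  refine Integrable.mono' (g := fun y => C * K ^ k * 2 ^ (k - 1) *
    (‖y‖ ^ 0 * ‖φ y‖ + ‖y‖ ^ k * ‖φ y‖))
    (((φ.integrable_pow_mul volume 0).add (φ.integrable_pow_mul volume k)).const_mul _)
    (hcont.mul φ.continuous).aestronglyMeasurable (Eventually.of_forall fun y => ?_)
  have h1 := hCb _ (K * (1 + ‖y‖)) (by nlinarith [norm_nonneg y]) (hKb y)
  have h2 := add_pow_le zero_le_one (norm_nonneg y) k
  rw [one_pow] at h2
  rw [norm_mul, ← add_mul, ← mul_assoc]
  refine mul_le_mul_of_nonneg_right (h1.trans ?_) (norm_nonneg _)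
  rw [mul_pow, mul_assoc, mul_assoc, pow_zero]
  gcongr

/-- **Wick's theorem** for a shifted Gaussian. -/
theorem integral_wick_gauss {c : ℝ} (hc : 0 < c) (u : Fin d → ℂ) (lam : Fin k → ℂ)
    (Y : Fin k → Fin d → ℂ) (n : Fin k → Fin k → ℂ) (S : Finset (Fin k)) :
    ∫ y : Rd d, wick (fun i => lam i + ∑ σ, Y i σ * (y σ : ℂ)) n S * gauss c u y =
      wick (fun i => lam i + (∑ σ, Y i σ * u σ) / (2 * c))
        (fun i j => n i j + (∑ σ, Y i σ * Y j σ) / (2 * c)) S * ∫ y, gauss c u y := by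
  have hc' : (c : ℂ) ≠ 0 := by exact_mod_cast hc.ne'
  induction S using Finset.strongInduction with
  | H S ih =>
    rcases S.eq_empty_or_nonempty with rfl | hne
    · simp only [wick_empty, one_mul]
    set w : Finset (Fin k) → Rd d → ℂ := fun S y =>
      wick (fun i => lam i + ∑ σ, Y i σ * (y σ : ℂ)) n S with hw
    set m := S.min' hne with hm
    -- The linear factor of the smallest index is removed by Gaussian integration by parts, which
    -- leaves integrals over proper subsets of `S`.
    have hmS : m ∈ S := S.min'_mem hne
    have hlt : ∀ i ∈ S.erase m, m < i := fun i hi => S.min'_lt_of_mem_erase_min' hne hi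
    set T := S.erase m with hT
    have hins : S = insert m T := (Finset.insert_erase hmS).symm
    have hTS : T ⊂ S := Finset.erase_ssubset hmS
    have hint : ∀ S' (φ : 𝓢(Rd d, ℂ)), Integrable fun y => w S' y * φ y := fun S' φ =>
      integrable_wick_mul lam Y n S' φ
    -- Since `y_σ` times the Gaussian is `(u_σ - ∂_σ)/(2c)` of it, the derivative moves onto the
    -- Wick polynomial of `T`.
    have ibp : ∀ σ : Fin d, ∫ y, w T y * ((y σ : ℂ) * gauss c u y) =
        u σ / (2 * c) * (∫ y, w T y * gauss c u y) +
          (∑ j ∈ T, Y j σ * ∫ y, w (T.erase j) y * gauss c u y) / (2 * c) := fun σ => by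
      have hD : ∀ y, LineDeriv.lineDerivOp (stdVec σ) (gauss c u) y =
          u σ * gauss c u y - 2 * c * ((y σ : ℂ) * gauss c u y) := fun y => by
        rw [lineDerivOp_gauss hc, _root_.add_apply, _root_.smul_apply, _root_.smul_apply,
          coordMul_apply]
        simp only [smul_eq_mul]
        ring
      have hi2 : Integrable fun y => w T y * ((y σ : ℂ) * gauss c u y) := by
        have := hint T (coordMul σ (gauss c u))
        simpa only [coordMul_apply] using this
      have hi3 : Integrable fun y => (∑ j ∈ T, Y j σ * w (T.erase j) y) * gauss c u y := by
        simp only [Finset.sum_mul, mul_assoc]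
        exact integrable_finsetSum _ fun j _ => (hint _ _).const_mul _
      have h := integral_bilinear_hasLineDerivAt_right_eq_neg_left_of_integrable
        (μ := (volume : Measure (Rd d))) (B := ContinuousLinearMap.mul ℝ ℂ)
        (f := w T) (f' := fun y => ∑ j ∈ T, Y j σ * w (T.erase j) y) (g := gauss c u)
        (g' := LineDeriv.lineDerivOp (stdVec σ) (gauss c u)) (v := stdVec σ)
        hi3 (hint T (LineDeriv.lineDerivOp (stdVec σ) (gauss c u))) (hint T _)
        (fun y _ => hasLineDerivAt_wick lam Y n T y σ)
        (fun y _ => SchwartzMap.hasLineDerivAt _ _ _)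
      simp only [ContinuousLinearMap.mul_apply', hD] at h
      have e1 : ∀ y, w T y * (u σ * gauss c u y - 2 * c * ((y σ : ℂ) * gauss c u y)) =
          u σ * (w T y * gauss c u y) - 2 * c * (w T y * ((y σ : ℂ) * gauss c u y)) := fun y => by
        ring
      have e2 : ∀ y, (∑ j ∈ T, Y j σ * w (T.erase j) y) * gauss c u y =
          ∑ j ∈ T, Y j σ * (w (T.erase j) y * gauss c u y) := fun y => by
        simp only [Finset.sum_mul, mul_assoc]
      simp only [e1, e2] at h
      rw [integral_sub ((hint T _).const_mul _) (hi2.const_mul (2 * c : ℂ)),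
        integral_finsetSum _ fun j _ => (hint _ _).const_mul _] at h
      simp only [integral_const_mul] at h
      have h' : u σ * (∫ y, w T y * gauss c u y) -
          2 * c * (∫ y, w T y * ((y σ : ℂ) * gauss c u y)) =
          -∑ j ∈ T, Y j σ * ∫ y, w (T.erase j) y * gauss c u y := h
      generalize (∫ y, w T y * ((y σ : ℂ) * gauss c u y)) = A₁ at h' ⊢
      generalize (∫ y, w T y * gauss c u y) = A₂ at h' ⊢
      generalize (∑ j ∈ T, Y j σ * ∫ y, w (T.erase j) y * gauss c u y) = A₃ at h' ⊢
      field_simp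
      linear_combination -h'
    have hrec : ∀ y, w S y * gauss c u y = lam m * (w T y * gauss c u y) +
        (∑ σ, Y m σ * (w T y * ((y σ : ℂ) * gauss c u y))) +
        ∑ j ∈ T, n m j * (w (T.erase j) y * gauss c u y) := fun y => by
      simp only [hw]
      rw [hins, wick_insert _ _ hlt, add_mul, add_mul, add_mul, Finset.sum_mul, Finset.sum_mul,
        Finset.sum_mul]
      congr 1
      · congr 1
        · ring
        · exact Finset.sum_congr rfl fun σ _ => by ring
      · exact Finset.sum_congr rfl fun σ _ => by ring
    have hi2 : ∀ σ, Integrable fun y => w T y * ((y σ : ℂ) * gauss c u y) := fun σ => by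
      have := hint T (coordMul σ (gauss c u))
      simpa only [coordMul_apply] using this
    have ihT : ∀ S' ⊂ S, ∫ y, w S' y * gauss c u y =
      wick (fun i => lam i + (∑ σ, Y i σ * u σ) / (2 * c))
        (fun i j => n i j + (∑ σ, Y i σ * Y j σ) / (2 * c)) S' * ∫ y, gauss c u y := ih
    change ∫ y, w S y * gauss c u y = _
    simp only [hrec]
    rw [integral_add, integral_add, integral_finsetSum, integral_finsetSum]
    rotate_left
    · exact fun j _ => (hint _ _).const_mul _
    · exact fun σ _ => (hi2 σ).const_mul _
    · exact (hint _ _).const_mul _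
    · exact integrable_finsetSum _ fun σ _ => (hi2 σ).const_mul _
    · exact ((hint _ _).const_mul _).add (integrable_finsetSum _ fun σ _ => (hi2 σ).const_mul _)
    · exact integrable_finsetSum _ fun σ _ => (hint _ _).const_mul _
    simp only [integral_const_mul, ibp]
    have hsub : ∀ j, T.erase j ⊂ S := fun j =>
      Finset.ssubset_of_subset_of_ssubset (Finset.erase_subset j T) hTS
    simp only [ihT T hTS, ihT _ (hsub _)]
    rw [hins, wick_insert _ _ hlt]
    set W := fun S' => wick (fun i => lam i + (∑ σ, Y i σ * u σ) / (2 * c))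
        (fun i j => n i j + (∑ σ, Y i σ * Y j σ) / (2 * c)) S' with hW
    change lam m * (W T * _) + (∑ σ, Y m σ * (u σ / (2 * c) * (W T * _) +
      (∑ j ∈ T, Y j σ * (W (T.erase j) * _)) / (2 * c))) + ∑ j ∈ T, n m j * (W (T.erase j) * _) =
      ((lam m + (∑ σ, Y m σ * u σ) / (2 * c)) * W T +
        ∑ j ∈ T, (n m j + (∑ σ, Y m σ * Y j σ) / (2 * c)) * W (T.erase j)) * _
    set J := ∫ y, gauss c u y with hJ
    -- The first part is the shift of the linear factor of `m`, the second the shift of its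
    -- contractions with each `j`.
    have s1 : ∑ σ, Y m σ * (u σ / (2 * c) * (W T * J) +
        (∑ j ∈ T, Y j σ * (W (T.erase j) * J)) / (2 * c)) =
        (∑ σ, Y m σ * u σ) / (2 * c) * W T * J +
        ∑ j ∈ T, (∑ σ, Y m σ * Y j σ) / (2 * c) * W (T.erase j) * J := by
      simp only [mul_add, Finset.sum_add_distrib, Finset.sum_div, Finset.sum_mul, Finset.mul_sum]
      congr 1
      · exact Finset.sum_congr rfl fun σ _ => by ring
      · rw [Finset.sum_comm]
        exact Finset.sum_congr rfl fun j _ => Finset.sum_congr rfl fun σ _ => by ring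
    rw [s1, add_mul, Finset.sum_mul]
    simp only [add_mul, Finset.sum_add_distrib]
    have s2 : ∑ j ∈ T, n m j * (W (T.erase j) * J) = ∑ j ∈ T, n m j * W (T.erase j) * J :=
      Finset.sum_congr rfl fun j _ => by ring
    rw [s2]
    ring

/-- Fubini's theorem combined with a shear of one of the variables. -/
theorem integral_integral_shear {Φ : Rd d → Rd d → ℂ} (hΦ : Continuous (Function.uncurry Φ))
    (hint : Integrable (Function.uncurry Φ) (volume.prod volume)) {τ : Rd d → Rd d}
    (hτ : Continuous τ) : ∫ x, ∫ κ, Φ x κ = ∫ z, ∫ κ, Φ (z - τ κ) κ := by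
  rw [integral_integral_swap hint]
  have h1 : ∀ κ, ∫ x, Φ x κ = ∫ z, Φ (z - τ κ) κ := fun κ =>
    (integral_sub_right_eq_self (fun x => Φ x κ) (τ κ)).symm
  simp only [h1]
  refine integral_integral_swap ?_
  have hc : Continuous (Function.uncurry fun κ z => Φ (z - τ κ) κ) :=
    hΦ.comp (by fun_prop : Continuous fun p : Rd d × Rd d => (p.2 - τ p.1, p.1))
  have hint' := (integrable_prod_iff' hΦ.aestronglyMeasurable).1 hint
  refine (integrable_prod_iff hc.aestronglyMeasurable).2 ⟨?_, ?_⟩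
  · filter_upwards [hint'.1] with κ hκ
    exact hκ.comp_sub_right (τ κ)
  · refine hint'.2.congr (Eventually.of_forall fun κ => ?_)
    exact (integral_sub_right_eq_self (fun x => ‖Φ x κ‖) (τ κ)).symm

end WickGauss

/-! ### The effective metric -/

section Metric

variable {d : ℕ} {Θ : Matrix (Fin d) (Fin d) ℝ} {Ω : ℝ}

theorem matVec_mul (A B : Matrix (Fin d) (Fin d) ℝ) (x : Rd d) :
    matVec (A * B) x = matVec A (matVec B x) := by
  simp [matVec, Matrix.mulVec_mulVec]

theorem inner_matVec (A : Matrix (Fin d) (Fin d) ℝ) (x y : Rd d) :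
    ⟪matVec A x, y⟫_ℝ = ⟪x, matVec Aᵀ y⟫_ℝ := by
  simp only [real_inner_eq_sum, matVec, Matrix.mulVec, dotProduct, Matrix.transpose_apply,
    Finset.sum_mul, Finset.mul_sum]
  rw [Finset.sum_comm]
  exact Finset.sum_congr rfl fun i _ => Finset.sum_congr rfl fun j _ => by ring

theorem inner_matVec_self_of_skew (hΘ : Θᵀ = -Θ) (x : Rd d) : ⟪x, matVec Θ x⟫_ℝ = 0 := by
  have h := inner_matVec Θ x x
  have h2 : matVec (-Θ) x = -matVec Θ x := by simp [matVec, Matrix.neg_mulVec]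
  rw [hΘ, h2, inner_neg_right, real_inner_comm] at h
  linarith

theorem det_matCLM (A : Matrix (Fin d) (Fin d) ℝ) :
    LinearMap.det (matCLM A).toLinearMap = A.det := by
  rw [matCLM]
  simp [Matrix.toEuclideanLin_eq_toLin_orthonormal]

/-- A root of the inverse of the effective metric. -/
def metricRoot (Θ : Matrix (Fin d) (Fin d) ℝ) (Ω : ℝ) : Matrix (Fin d) (Fin d) ℝ :=
  1 + (Ω / 2) • Θ

/-- The inverse of the effective metric. -/
def metricInv (Θ : Matrix (Fin d) (Fin d) ℝ) (Ω : ℝ) : Matrix (Fin d) (Fin d) ℝ :=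
  1 - (Ω ^ 2 / 4) • (Θ * Θ)

theorem metricRoot_transpose_mul (hΘ : Θᵀ = -Θ) :
    (metricRoot Θ Ω)ᵀ * metricRoot Θ Ω = metricInv Θ Ω := by
  simp only [metricRoot, metricInv, Matrix.transpose_add, Matrix.transpose_one,
    Matrix.transpose_smul, hΘ, add_mul, mul_add, one_mul, mul_one, smul_mul_assoc, mul_smul_comm,
    neg_mul, smul_neg]
  match_scalars <;> ring

theorem matVec_metricRoot (x : Rd d) :
    matVec (metricRoot Θ Ω) x = x + (Ω / 2) • matVec Θ x := by
  ext i
  simp [matVec, metricRoot, Matrix.add_mulVec, Matrix.smul_mulVec]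

theorem norm_sq_matVec_metricRoot (hΘ : Θᵀ = -Θ) (x : Rd d) :
    ‖matVec (metricRoot Θ Ω) x‖ ^ 2 = ‖x‖ ^ 2 + Ω ^ 2 / 4 * ‖matVec Θ x‖ ^ 2 := by
  rw [matVec_metricRoot, norm_add_sq_real, inner_smul_right, inner_matVec_self_of_skew hΘ,
    norm_smul, mul_pow, Real.norm_eq_abs, sq_abs]
  ring

/-- Skew-symmetry removes the cross term, so `metricRoot` does not shorten any vector and is
injective. -/
theorem det_metricRoot_ne_zero (hΘ : Θᵀ = -Θ) : (metricRoot Θ Ω).det ≠ 0 := by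
  intro h
  obtain ⟨v, hv, hmv⟩ := Matrix.exists_mulVec_eq_zero_iff.2 h
  have h1 := norm_sq_matVec_metricRoot (Ω := Ω) hΘ (WithLp.toLp 2 v)
  have h2 : matVec (metricRoot Θ Ω) (WithLp.toLp 2 v) = 0 := by
    simp [matVec, hmv]
  rw [h2, norm_zero] at h1
  have h3 : ‖(WithLp.toLp 2 v : Rd d)‖ = 0 := by
    have : 0 ≤ Ω ^ 2 / 4 * ‖matVec Θ (WithLp.toLp 2 v)‖ ^ 2 := by positivity
    nlinarith [norm_nonneg (WithLp.toLp 2 v : Rd d)]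
  refine hv ?_
  have h4 := norm_eq_zero.1 h3
  simpa using h4

theorem isUnit_det_metricRoot (hΘ : Θᵀ = -Θ) : IsUnit (metricRoot Θ Ω).det :=
  (det_metricRoot_ne_zero hΘ).isUnit

theorem isUnit_det_metricInv (hΘ : Θᵀ = -Θ) : IsUnit (metricInv Θ Ω).det := by
  rw [← metricRoot_transpose_mul hΘ, Matrix.det_mul, Matrix.det_transpose]
  exact (isUnit_det_metricRoot hΘ).mul (isUnit_det_metricRoot hΘ)

theorem metricG_eq : metricG Θ Ω = (metricInv Θ Ω)⁻¹ := rfl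

theorem inv_metricG (hΘ : Θᵀ = -Θ) : (metricG Θ Ω)⁻¹ = metricInv Θ Ω := by
  rw [metricG_eq, Matrix.nonsing_inv_nonsing_inv _ (isUnit_det_metricInv hΘ)]

theorem metricG_mul_metricInv (hΘ : Θᵀ = -Θ) : metricG Θ Ω * metricInv Θ Ω = 1 :=
  Matrix.nonsing_inv_mul _ (isUnit_det_metricInv hΘ)

theorem metricInv_mul_metricG (hΘ : Θᵀ = -Θ) : metricInv Θ Ω * metricG Θ Ω = 1 :=
  Matrix.mul_nonsing_inv _ (isUnit_det_metricInv hΘ)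

theorem metricRoot_inv_mul_transpose (hΘ : Θᵀ = -Θ) :
    (metricRoot Θ Ω)⁻¹ * ((metricRoot Θ Ω)⁻¹)ᵀ = metricG Θ Ω := by
  rw [metricG_eq, ← metricRoot_transpose_mul hΘ, Matrix.mul_inv_rev, Matrix.transpose_nonsing_inv]

theorem mul_metricG_comm (hΘ : Θᵀ = -Θ) : Θ * metricG Θ Ω = metricG Θ Ω * Θ := by
  have h : Θ * metricInv Θ Ω = metricInv Θ Ω * Θ := by
    simp only [metricInv, mul_sub, sub_mul, mul_one, one_mul, mul_smul_comm, smul_mul_assoc,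
      mul_assoc]
  calc Θ * metricG Θ Ω = metricG Θ Ω * (metricInv Θ Ω * Θ) * metricG Θ Ω := by
        rw [← mul_assoc, metricG_mul_metricInv hΘ, one_mul]
    _ = metricG Θ Ω * Θ * (metricInv Θ Ω * metricG Θ Ω) := by rw [← h]; simp only [mul_assoc]
    _ = _ := by rw [metricInv_mul_metricG hΘ, mul_one]

/-- Since `Θ² = (4/Ω²)(1 - g⁻¹)` and `g` commutes with `Θ`, all products reduce to few matrices. The
term `ΘgΘ` of `N` is rewritten by this. -/
theorem mul_metricG_mul (hΩ : 0 < Ω) (hΘ : Θᵀ = -Θ) :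
    Θ * (metricG Θ Ω * Θ) = (4 / Ω ^ 2) • (metricG Θ Ω - 1) := by
  have h : Θ * Θ = (4 / Ω ^ 2) • (1 - metricInv Θ Ω) := by
    rw [metricInv, sub_sub_cancel, smul_smul]
    have : 4 / Ω ^ 2 * (Ω ^ 2 / 4) = 1 := by field_simp
    rw [this, one_smul]
  rw [← mul_assoc, mul_metricG_comm hΘ, mul_assoc, h, mul_smul_comm, mul_sub, mul_one,
    metricG_mul_metricInv hΘ]

theorem metricG_transpose (hΘ : Θᵀ = -Θ) : (metricG Θ Ω)ᵀ = metricG Θ Ω := by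
  rw [← metricRoot_inv_mul_transpose hΘ, Matrix.transpose_mul, Matrix.transpose_transpose]

theorem sqrt_det_metricG (hΘ : Θᵀ = -Θ) :
    Real.sqrt (metricG Θ Ω).det = |((metricRoot Θ Ω).det)⁻¹| := by
  rw [← metricRoot_inv_mul_transpose hΘ, Matrix.det_mul, Matrix.det_transpose,
    Matrix.det_nonsing_inv, Ring.inverse_eq_inv', Real.sqrt_mul_self_eq_abs]

/-- The map `z ↦ (B⁻¹)ᵀ z`, `B` the root of the inverse metric. -/
def rootVec (Θ : Matrix (Fin d) (Fin d) ℝ) (Ω : ℝ) (z : Rd d) : Rd d :=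
  matVec ((metricRoot Θ Ω)⁻¹)ᵀ z

theorem inner_rootVec (hΘ : Θᵀ = -Θ) (x y : Rd d) :
    ⟪rootVec Θ Ω x, rootVec Θ Ω y⟫_ℝ = ⟪x, matVec (metricG Θ Ω) y⟫_ℝ := by
  rw [rootVec, rootVec, inner_matVec, Matrix.transpose_transpose, ← matVec_mul,
    metricRoot_inv_mul_transpose hΘ]

theorem norm_sq_rootVec (hΘ : Θᵀ = -Θ) (z : Rd d) :
    ‖rootVec Θ Ω z‖ ^ 2 = ⟪z, matVec (metricG Θ Ω) z⟫_ℝ := by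
  rw [← inner_rootVec hΘ, real_inner_self_eq_norm_sq]

theorem inner_rootVec_skew (hΘ : Θᵀ = -Θ) (z : Rd d) :
    ⟪rootVec Θ Ω (matVec Θ z), rootVec Θ Ω z⟫_ℝ = 0 := by
  have hsk : (metricG Θ Ω * Θ)ᵀ = -(metricG Θ Ω * Θ) := by
    rw [Matrix.transpose_mul, metricG_transpose hΘ, hΘ, neg_mul, mul_metricG_comm hΘ]
  rw [real_inner_comm, inner_rootVec hΘ, ← matVec_mul, inner_matVec_self_of_skew hsk]

theorem norm_sq_rootVec_skew (hΩ : 0 < Ω) (hΘ : Θᵀ = -Θ) (z : Rd d) :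
    ‖rootVec Θ Ω (matVec Θ z)‖ ^ 2 =
      4 / Ω ^ 2 * (‖z‖ ^ 2 - ⟪z, matVec (metricG Θ Ω) z⟫_ℝ) := by
  have h2 : matVec (-(4 / Ω ^ 2) • (metricG Θ Ω - 1)) z =
      (4 / Ω ^ 2) • (z - matVec (metricG Θ Ω) z) := by
    ext i
    simp [matVec, Matrix.smul_mulVec, Matrix.sub_mulVec, Matrix.neg_mulVec]
    ring
  rw [norm_sq_rootVec hΘ, inner_matVec, ← matVec_mul, ← matVec_mul, hΘ, neg_mul, neg_mul,
    mul_assoc, mul_metricG_mul hΩ hΘ, ← neg_smul, h2, inner_smul_right, inner_sub_right,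
    real_inner_self_eq_norm_sq]

/-- An invertible matrix as a continuous linear equivalence. -/
def matCLE (A : Matrix (Fin d) (Fin d) ℝ) (hA : IsUnit A.det) : Rd d ≃L[ℝ] Rd d :=
  ContinuousLinearEquiv.equivOfInverse (matCLM A) (matCLM A⁻¹)
    (fun x => by
      rw [matCLM_apply, matCLM_apply, ← matVec_mul, Matrix.nonsing_inv_mul _ hA]; simp [matVec])
    (fun x => by
      rw [matCLM_apply, matCLM_apply, ← matVec_mul, Matrix.mul_nonsing_inv _ hA]; simp [matVec])

theorem matCLE_apply (A : Matrix (Fin d) (Fin d) ℝ) (hA : IsUnit A.det) (x : Rd d) :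
    matCLE A hA x = matVec A x := rfl

theorem integral_comp_matVec {A : Matrix (Fin d) (Fin d) ℝ} (hA : IsUnit A.det) (F : Rd d → ℂ) :
    ∫ x, F (matVec A x) = ((|(A.det)⁻¹| : ℝ) : ℂ) * ∫ y, F y := by
  have hemb : MeasurableEmbedding (matCLE A hA) :=
    (matCLE A hA).toHomeomorph.measurableEmbedding
  have h1 : Measure.map (matCLE A hA) (volume : Measure (Rd d)) =
      ENNReal.ofReal |(A.det)⁻¹| • volume := by
    have := Measure.map_linearMap_addHaar_eq_smul_addHaar (volume : Measure (Rd d))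
      (f := (matCLM A).toLinearMap) (by rw [det_matCLM]; exact hA.ne_zero)
    rw [det_matCLM] at this
    exact this
  have h2 := hemb.integral_map (μ := (volume : Measure (Rd d))) F
  rw [h1, integral_smul_measure, ENNReal.toReal_ofReal (abs_nonneg _)] at h2
  rw [← Complex.real_smul, h2]
  rfl

end Metric

/-! ### The parameters of the Mehler kernel -/

section Parameters

variable {Ω t : ℝ}

/-- In hyperbolic form `a = (Ω/2) coth(2Ωt)` and `b = Ω/sinh(2Ωt)`, so this is `coth² - 1/sinh² =
1`. -/
theorem four_mul_mehlerA_sq_sub {q : ℝ} (hq : 0 < q) (hq1 : q < 1) :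
    4 * mehlerA Ω q ^ 2 - mehlerB Ω q ^ 2 = Ω ^ 2 := by
  have h2 : (1 - q ^ 2) ≠ 0 := by nlinarith
  unfold mehlerA mehlerB
  field_simp
  ring

theorem exp_neg_two_mul_eq : Real.exp (-2 * Ω * t) = (Real.exp (Ω * t) ^ 2)⁻¹ := by
  rw [← Real.exp_nat_mul, ← Real.exp_neg]; congr 1; push_cast; ring

theorem one_lt_exp (hΩ : 0 < Ω) (ht : 0 < t) : 1 < Real.exp (Ω * t) :=
  Real.one_lt_exp_iff.2 (mul_pos hΩ ht)

theorem two_mul_mehlerA_sub (hΩ : 0 < Ω) (ht : 0 < t) :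
    2 * mehlerA Ω (Real.exp (-2 * Ω * t)) - mehlerB Ω (Real.exp (-2 * Ω * t)) =
      Ω * Real.tanh (Ω * t) := by
  rw [exp_neg_two_mul_eq, Real.tanh_eq_sinh_div_cosh, Real.sinh_eq, Real.cosh_eq, Real.exp_neg]
  have hr := one_lt_exp hΩ ht
  set r := Real.exp (Ω * t)
  have h0 : 0 < r := by linarith
  have h4 : r ^ 4 - 1 ≠ 0 := by nlinarith [sq_nonneg (r ^ 2 - 1), sq_nonneg (r - 1)]
  have h2 : (1 - (r ^ 2)⁻¹ ^ 2) ≠ 0 := by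
    field_simp
    exact div_ne_zero h4 (by positivity)
  have h5 : (r + r⁻¹) ≠ 0 := by positivity
  unfold mehlerA mehlerB
  field_simp
  ring

theorem two_mul_mehlerA_add (hΩ : 0 < Ω) (ht : 0 < t) :
    2 * mehlerA Ω (Real.exp (-2 * Ω * t)) + mehlerB Ω (Real.exp (-2 * Ω * t)) =
      Ω * coth (Ω * t) := by
  rw [exp_neg_two_mul_eq, coth, Real.sinh_eq, Real.cosh_eq, Real.exp_neg]
  have hr := one_lt_exp hΩ ht
  set r := Real.exp (Ω * t)
  have h0 : 0 < r := by linarith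
  have h4 : r ^ 4 - 1 ≠ 0 := by nlinarith [sq_nonneg (r ^ 2 - 1), sq_nonneg (r - 1)]
  have h2 : (1 - (r ^ 2)⁻¹ ^ 2) ≠ 0 := by
    field_simp
    exact div_ne_zero h4 (by positivity)
  have h7 : r ^ 2 - 1 ≠ 0 := by nlinarith
  have h5 : (r - r⁻¹) ≠ 0 := by
    field_simp
    exact div_ne_zero h7 h0.ne'
  unfold mehlerA mehlerB
  field_simp
  ring

theorem mehlerB_eq (hΩ : 0 < Ω) (ht : 0 < t) :
    mehlerB Ω (Real.exp (-2 * Ω * t)) = Ω / Real.sinh (2 * Ω * t) := by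
  have e : 2 * Ω * t = 2 * (Ω * t) := by ring
  rw [exp_neg_two_mul_eq, e, Real.sinh_two_mul, Real.sinh_eq, Real.cosh_eq, Real.exp_neg]
  have hr := one_lt_exp hΩ ht
  set r := Real.exp (Ω * t)
  have h0 : 0 < r := by linarith
  have h4 : r ^ 4 - 1 ≠ 0 := by nlinarith [sq_nonneg (r ^ 2 - 1), sq_nonneg (r - 1)]
  have h2 : (1 - (r ^ 2)⁻¹ ^ 2) ≠ 0 := by
    field_simp
    exact div_ne_zero h4 (by positivity)
  have h7 : r ^ 2 - 1 ≠ 0 := by nlinarith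
  have h5 : (r - r⁻¹) ≠ 0 := by
    field_simp
    exact div_ne_zero h7 h0.ne'
  have h6 : (r + r⁻¹) ≠ 0 := by positivity
  unfold mehlerB
  field_simp
  ring

end Parameters

/-! ### The matrices of the trace formula -/

section Matrices

variable {d : ℕ} {Θ : Matrix (Fin d) (Fin d) ℝ} {Ω a b : ℝ}

/-- The linear part of the symbol of `∇` along the shear `x = z - ½Θκ`. -/
def shearMat (Θ : Matrix (Fin d) (Fin d) ℝ) (Ω a b : ℝ) : Matrix (Fin d) (Fin d) ℂ :=
  symbolMat Θ Ω a - (Complex.I * Ω ^ 2 * b / (8 * a) : ℂ) •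
    (Θ.map Complex.ofReal * Θ.map Complex.ofReal)

theorem map_ofReal_mul (A B : Matrix (Fin d) (Fin d) ℝ) :
    (A * B).map Complex.ofReal = A.map Complex.ofReal * B.map Complex.ofReal :=
  map_mul Complex.ofRealHom.mapMatrix A B

theorem map_ofReal_one : (1 : Matrix (Fin d) (Fin d) ℝ).map Complex.ofReal = 1 :=
  map_one (Complex.ofRealHom.mapMatrix)

theorem map_ofReal_metricInv : (metricInv Θ Ω).map Complex.ofReal =
    1 - (Ω ^ 2 / 4 : ℂ) • (Θ.map Complex.ofReal * Θ.map Complex.ofReal) := by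
  rw [← map_ofReal_mul]
  ext i j
  by_cases h : i = j <;> simp [metricInv, h]

theorem map_ofReal_mul_self (hΩ : 0 < Ω) : Θ.map Complex.ofReal * Θ.map Complex.ofReal =
    (4 / Ω ^ 2 : ℂ) • (1 - (metricInv Θ Ω).map Complex.ofReal) := by
  have hΩ' : (Ω : ℂ) ≠ 0 := by exact_mod_cast hΩ.ne'
  rw [map_ofReal_metricInv, sub_sub_cancel, smul_smul]
  have : (4 / Ω ^ 2 * (Ω ^ 2 / 4) : ℂ) = 1 := by field_simp
  rw [this, one_smul]

theorem shearMat_eq (hΩ : 0 < Ω) (ha : 0 < a) : shearMat Θ Ω a b =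
    (-(Complex.I * (1 + b / (2 * a))) : ℂ) • (1 : Matrix (Fin d) (Fin d) ℂ) +
      (Complex.I * b / (2 * a) : ℂ) • (metricInv Θ Ω).map Complex.ofReal -
      (Ω ^ 2 / (4 * a) : ℂ) • Θ.map Complex.ofReal := by
  have hΩ' : (Ω : ℂ) ≠ 0 := by exact_mod_cast hΩ.ne'
  have ha' : (a : ℂ) ≠ 0 := by exact_mod_cast ha.ne'
  rw [shearMat, symbolMat, map_ofReal_mul_self hΩ]
  match_scalars <;> field_simp <;> ring

theorem transpose_map_ofReal (hΘ : Θᵀ = -Θ) :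
    (Θ.map Complex.ofReal)ᵀ = -Θ.map Complex.ofReal := by
  rw [← Matrix.transpose_map, hΘ]
  ext i j
  simp

theorem transpose_metricInv (hΘ : Θᵀ = -Θ) : (metricInv Θ Ω)ᵀ = metricInv Θ Ω := by
  rw [← metricRoot_transpose_mul hΘ, Matrix.transpose_mul, Matrix.transpose_transpose]

theorem transpose_shearMat (hΩ : 0 < Ω) (ha : 0 < a) (hΘ : Θᵀ = -Θ) : (shearMat Θ Ω a b)ᵀ =
    (-(Complex.I * (1 + b / (2 * a))) : ℂ) • (1 : Matrix (Fin d) (Fin d) ℂ) +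
      (Complex.I * b / (2 * a) : ℂ) • (metricInv Θ Ω).map Complex.ofReal +
      (Ω ^ 2 / (4 * a) : ℂ) • Θ.map Complex.ofReal := by
  rw [shearMat_eq hΩ ha, Matrix.transpose_sub, Matrix.transpose_add, Matrix.transpose_smul,
    Matrix.transpose_smul, Matrix.transpose_smul, transpose_map_ofReal hΘ, Matrix.transpose_one,
    ← Matrix.transpose_map, transpose_metricInv hΘ, smul_neg, sub_neg_eq_add]

theorem shearMat_mul_metricG (hΩ : 0 < Ω) (ha : 0 < a) (hΘ : Θᵀ = -Θ) :
    shearMat Θ Ω a b * (metricG Θ Ω).map Complex.ofReal =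
    (-(Complex.I * (1 + b / (2 * a))) : ℂ) • (metricG Θ Ω).map Complex.ofReal +
      (Complex.I * b / (2 * a) : ℂ) • (1 : Matrix (Fin d) (Fin d) ℂ) -
      (Ω ^ 2 / (4 * a) : ℂ) • ((metricG Θ Ω).map Complex.ofReal * Θ.map Complex.ofReal) := by
  rw [shearMat_eq hΩ ha, sub_mul, add_mul, smul_mul_assoc, smul_mul_assoc, smul_mul_assoc, one_mul,
    ← map_ofReal_mul, ← map_ofReal_mul, metricInv_mul_metricG hΘ, mul_metricG_comm hΘ,
    map_ofReal_one, map_ofReal_mul]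

theorem map_ofReal_metricG_mul_sq (hΩ : 0 < Ω) (hΘ : Θᵀ = -Θ) :
    (metricG Θ Ω).map Complex.ofReal * (Θ.map Complex.ofReal * Θ.map Complex.ofReal) =
      (4 / Ω ^ 2 : ℂ) • ((metricG Θ Ω).map Complex.ofReal - 1) := by
  rw [map_ofReal_mul_self hΩ, mul_smul_comm, mul_sub, mul_one, ← map_ofReal_mul,
    metricG_mul_metricInv hΘ, map_ofReal_one]

/-- This identity produces `N`. With `Θ²` eliminated in favour of `g⁻¹`, both sides are linear
combinations of a few matrices, and their coefficients agree by `4a² - b² = Ω²`. -/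
theorem contraction_eq (hΩ : 0 < Ω) (ha : 0 < a) (hab : 4 * a ^ 2 - b ^ 2 = Ω ^ 2)
    (hΘ : Θᵀ = -Θ) :
    symbolContraction Θ Ω a + (2 * a : ℂ) •
        (shearMat Θ Ω a b * (metricG Θ Ω).map Complex.ofReal * (shearMat Θ Ω a b)ᵀ) =
      -((2 * a : ℂ) • (metricInv Θ Ω).map Complex.ofReal) -
        (2 * (2 * a + b) : ℂ) • ((metricG Θ Ω).map Complex.ofReal - 1) -
        (Complex.I * Ω ^ 2 / 2 : ℂ) • Θ.map Complex.ofReal := by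
  have hΩ' : (Ω : ℂ) ≠ 0 := by exact_mod_cast hΩ.ne'
  have ha' : (a : ℂ) ≠ 0 := by exact_mod_cast ha.ne'
  have hab' : 4 * (a : ℂ) ^ 2 - b ^ 2 = Ω ^ 2 := by exact_mod_cast hab
  have hGD : (metricG Θ Ω).map Complex.ofReal * (metricInv Θ Ω).map Complex.ofReal = 1 := by
    rw [← map_ofReal_mul, metricG_mul_metricInv hΘ, map_ofReal_one]
  have hGTT := map_ofReal_metricG_mul_sq hΩ hΘ
  have hGTD : (metricG Θ Ω).map Complex.ofReal * (Θ.map Complex.ofReal *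
      (metricInv Θ Ω).map Complex.ofReal) = Θ.map Complex.ofReal := by
    rw [← map_ofReal_mul, ← map_ofReal_mul, ← mul_assoc, ← mul_metricG_comm hΘ, mul_assoc,
      metricG_mul_metricInv hΘ, mul_one]
  have hTT := map_ofReal_mul_self (Θ := Θ) hΩ
  have hS : symbolContraction Θ Ω a = -((Complex.I * Ω ^ 2 / 2 : ℂ) • Θ.map Complex.ofReal) +
      (Ω ^ 2 / (2 * a) : ℂ) • (1 - (metricInv Θ Ω).map Complex.ofReal) := by
    rw [symbolContraction, symbolMat, Matrix.transpose_sub, Matrix.transpose_neg,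
      Matrix.transpose_smul, Matrix.transpose_smul, transpose_map_ofReal hΘ, Matrix.transpose_one,
      mul_sub, mul_neg, mul_smul_comm, mul_one, mul_smul_comm, mul_neg, hTT]
    match_scalars <;> field_simp
  rw [hS, shearMat_mul_metricG hΩ ha hΘ, transpose_shearMat hΩ ha hΘ]
  -- From here the matrices are letters subject only to the relations `hGD`, `hGTT` and `hGTD`,
  -- which bring every product to normal form.
  generalize (metricG Θ Ω).map Complex.ofReal = G at *
  generalize (metricInv Θ Ω).map Complex.ofReal = D at *
  generalize Θ.map Complex.ofReal = T at *
  simp only [sub_mul, add_mul, mul_add, smul_mul_assoc, mul_smul_comm, one_mul, mul_one, mul_assoc,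
    hGD, hGTT, hGTD]
  match_scalars
  all_goals field_simp
  · ring
  · linear_combination (-8 * b * (2 * a + b) : ℂ) * Complex.I_sq - 8 * hab'
  · linear_combination (b ^ 2 : ℂ) * Complex.I_sq + hab'
  · linear_combination (4 * (2 * a + b) ^ 2 : ℂ) * Complex.I_sq + 4 * hab'
  · ring

/-- This identity produces `Z`, by the same reduction to a normal form. -/
theorem linear_eq (hΩ : 0 < Ω) (ha : 0 < a) (hab : 4 * a ^ 2 - b ^ 2 = Ω ^ 2)
    (hΘ : Θᵀ = -Θ) :
    (Complex.I * Ω ^ 2 * b / (4 * a) : ℂ) • Θ.map Complex.ofReal + (2 * a : ℂ) •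
        (shearMat Θ Ω a b * (metricG Θ Ω).map Complex.ofReal *
          ((-(Ω ^ 2 / (4 * a)) : ℂ) • Θ.map Complex.ofReal +
            (Complex.I * (b / (2 * a) - 1) : ℂ) • 1)) =
      (-(2 * a - b) : ℂ) • 1 + (Complex.I * Ω ^ 2 : ℂ) • (Θ * metricG Θ Ω).map Complex.ofReal := by
  have hΩ' : (Ω : ℂ) ≠ 0 := by exact_mod_cast hΩ.ne'
  have ha' : (a : ℂ) ≠ 0 := by exact_mod_cast ha.ne'
  have hab' : 4 * (a : ℂ) ^ 2 - b ^ 2 = Ω ^ 2 := by exact_mod_cast hab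
  have hGTT := map_ofReal_metricG_mul_sq hΩ hΘ
  rw [shearMat_mul_metricG hΩ ha hΘ, mul_metricG_comm hΘ, map_ofReal_mul]
  generalize (metricG Θ Ω).map Complex.ofReal = G at *
  generalize Θ.map Complex.ofReal = T at *
  simp only [sub_mul, add_mul, mul_add, smul_mul_assoc, mul_smul_comm, one_mul, mul_one, mul_assoc,
    hGTT]
  match_scalars
  all_goals field_simp
  · ring
  · ring
  · linear_combination (-4 * (b ^ 2 - 4 * a ^ 2) : ℂ) * Complex.I_sq - 4 * hab'
  · linear_combination (4 * b * (b - 2 * a) : ℂ) * Complex.I_sq + 4 * hab'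

end Matrices

/-! ### The integral kernel of the traced operator -/

section TraceIntegral

variable {d k : ℕ} {Θ : Matrix (Fin d) (Fin d) ℝ} {Ω a b : ℝ}

theorem hatS_gauss {c : ℝ} (hc : 0 < c) (u : Fin d → ℂ) (κ : Rd d) :
    hatS d (gauss c u) κ = ((((2 * Real.pi) ^ d)⁻¹ * Real.sqrt (Real.pi / c) ^ d : ℝ) : ℂ) *
      Complex.exp ((∑ i, (u i + Complex.I * κ i) ^ 2) / (4 * c)) := by
  have h : ∀ w : Rd d, gauss c u w * Complex.exp (Complex.I * ((⟪κ, w⟫_ℝ : ℝ) : ℂ)) =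
      gauss c (fun i => u i + Complex.I * κ i) w := fun w => by
    rw [gauss_apply hc, gauss_apply hc, ← Complex.exp_add, add_assoc, real_inner_eq_sum]
    push_cast
    rw [Finset.mul_sum, ← Finset.sum_add_distrib]
    congr 2
    exact Finset.sum_congr rfl fun i _ => by ring
  rw [hatS_apply]
  simp only [h]
  rw [integral_gauss hc, ← mul_assoc, Complex.ofReal_mul]

/-- The Gaussian part of the Fourier transform of the Mehler kernel in one variable. -/
def mixedGauss (Ω a b : ℝ) (x κ : Rd d) : ℂ :=
  Complex.exp (((-(Ω ^ 2 / (4 * a)) * ‖x‖ ^ 2 - 1 / (4 * a) * ‖κ‖ ^ 2 : ℝ) : ℂ) +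
    Complex.I * ((b / (2 * a) * ⟪κ, x⟫_ℝ : ℝ) : ℂ))

theorem continuous_mixedGauss :
    Continuous fun p : Rd d × Rd d => mixedGauss Ω a b p.1 p.2 := by
  unfold mixedGauss
  fun_prop

theorem norm_mixedGauss (hΩ : 0 < Ω) (ha : 0 < a) (x κ : Rd d) :
    ‖mixedGauss Ω a b x κ‖ =
      ‖gauss (Ω ^ 2 / (4 * a)) 0 x‖ * ‖gauss (1 / (4 * a)) 0 κ‖ := by
  rw [gauss_apply (by positivity), gauss_apply (by positivity), mixedGauss, Complex.norm_exp,
    Complex.norm_exp, Complex.norm_exp, ← Real.exp_add]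
  simp only [Pi.zero_apply, zero_mul, Finset.sum_const_zero, add_zero]
  congr 1
  simp only [Complex.add_re, Complex.ofReal_re, Complex.I_mul_re, Complex.ofReal_im, neg_zero,
    add_zero, ← Complex.ofReal_neg, ← Complex.ofReal_mul]
  ring

/-- The transform contributes `b²|x|²/(4a)`, and `-a + b²/(4a) = -Ω²/(4a)`. Hence there is Gaussian
decay in `x` and in `κ` at once, as needed for Fubini's theorem. -/
theorem hatS_kernel (ha : 0 < a) (hab : 4 * a ^ 2 - b ^ 2 = Ω ^ 2) (x κ : Rd d) :
    ((Real.exp (-a * ‖x‖ ^ 2) : ℝ) : ℂ) * hatS d (gauss a fun i => ((b * x i : ℝ) : ℂ)) κ =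
      ((((2 * Real.pi) ^ d)⁻¹ * Real.sqrt (Real.pi / a) ^ d : ℝ) : ℂ) * mixedGauss Ω a b x κ := by
  rw [hatS_gauss ha, mul_left_comm, mixedGauss, Complex.ofReal_exp, ← Complex.exp_add]
  congr 2
  have ha' : (a : ℂ) ≠ 0 := by exact_mod_cast ha.ne'
  have hab' : 4 * (a : ℂ) ^ 2 - b ^ 2 = Ω ^ 2 := by exact_mod_cast hab
  have h : ∑ i, (((b * x i : ℝ) : ℂ) + Complex.I * κ i) ^ 2 =
      ((b ^ 2 * ‖x‖ ^ 2 - ‖κ‖ ^ 2 : ℝ) : ℂ) + 2 * Complex.I * ((b * ⟪κ, x⟫_ℝ : ℝ) : ℂ) := by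
    rw [sq_norm_eq_sum, sq_norm_eq_sum, real_inner_eq_sum]
    push_cast
    simp only [Finset.mul_sum]
    rw [← Finset.sum_sub_distrib, ← Finset.sum_add_distrib]
    refine Finset.sum_congr rfl fun i _ => ?_
    linear_combination (κ i : ℂ) ^ 2 * Complex.I_sq
  rw [h]
  push_cast
  rw [← hab']
  field_simp
  ring

theorem integrable_one_add_norm_pow_mul (φ : 𝓢(Rd d, ℂ)) (n : ℕ) :
    Integrable fun y : Rd d => (1 + ‖y‖) ^ n * ‖φ y‖ := by
  refine Integrable.mono' (g := fun y => 2 ^ (n - 1) * (‖y‖ ^ 0 * ‖φ y‖ + ‖y‖ ^ n * ‖φ y‖))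
    (((φ.integrable_pow_mul volume 0).add (φ.integrable_pow_mul volume n)).const_mul _)
    (Continuous.aestronglyMeasurable (by fun_prop)) (Eventually.of_forall fun y => ?_)
  rw [Real.norm_of_nonneg (by positivity), ← add_mul, ← mul_assoc, pow_zero]
  gcongr
  simpa using add_pow_le zero_le_one (norm_nonneg y) n

/-- The integrand of the trace. -/
def traceIntegrand (Θ : Matrix (Fin d) (Fin d) ℝ) (Ω a b : ℝ) (f : BStar d) (μ : Fin k → Fin d)
    (x κ : Rd d) : ℂ :=
  moyalWeight Θ f x κ * (wick (fun i => symbol Θ Ω a (fun j => ((b * x j : ℝ) : ℂ)) κ (μ i))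
    (fun i j => symbolContraction Θ Ω a (μ i) (μ j)) Finset.univ * mixedGauss Ω a b x κ)

theorem continuous_traceIntegrand (f : BStar d) (μ : Fin k → Fin d) :
    Continuous (Function.uncurry (traceIntegrand Θ Ω a b f μ)) := by
  refine (continuous_moyalWeight Θ f).mul (Continuous.mul ?_ continuous_mixedGauss)
  refine continuous_wick (fun i => ?_) _ _
  simp only [symbol_eq]
  fun_prop

theorem exists_norm_symbol_le (Θ : Matrix (Fin d) (Fin d) ℝ) (Ω a b : ℝ) (μ : Fin k → Fin d) :
    ∃ K : ℝ, 1 ≤ K ∧ ∀ (x κ : Rd d) i,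
      ‖symbol Θ Ω a (fun j => ((b * x j : ℝ) : ℂ)) κ (μ i)‖ ≤ K * ((1 + ‖x‖) * (1 + ‖κ‖)) := by
  obtain ⟨K₁, hK₁, h₁⟩ := exists_norm_affine_le (d := d) (k := k) 0
    fun i j => Complex.I * Ω ^ 2 / (4 * a) * Θ (μ i) j * b
  obtain ⟨K₂, hK₂, h₂⟩ := exists_norm_affine_le (d := d) (k := k) 0
    fun i j => symbolMat Θ Ω a (μ i) j
  refine ⟨K₁ + K₂, by linarith, fun x κ i => ?_⟩
  have e₁ := h₁ x i
  have e₂ := h₂ κ i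
  simp only [Pi.zero_apply, zero_add] at e₁ e₂
  rw [symbol_eq]
  have e : Complex.I * Ω ^ 2 / (4 * a) * ∑ ρ, (Θ (μ i) ρ : ℂ) * ((b * x ρ : ℝ) : ℂ) =
      ∑ ρ, Complex.I * Ω ^ 2 / (4 * a) * Θ (μ i) ρ * b * (x ρ : ℂ) := by
    rw [Finset.mul_sum]
    exact Finset.sum_congr rfl fun ρ _ => by push_cast; ring
  rw [e]
  have hx := norm_nonneg x
  have hκ := norm_nonneg κ
  calc _ ≤ K₁ * (1 + ‖x‖) + K₂ * (1 + ‖κ‖) := (norm_add_le _ _).trans (add_le_add e₁ e₂)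
    _ ≤ K₁ * ((1 + ‖x‖) * (1 + ‖κ‖)) + K₂ * ((1 + ‖x‖) * (1 + ‖κ‖)) := by
      gcongr
      · nlinarith
      · nlinarith
    _ = _ := by ring

theorem integrable_traceIntegrand (hΩ : 0 < Ω) (ha : 0 < a) (f : BStar d) (μ : Fin k → Fin d) :
    Integrable (Function.uncurry (traceIntegrand Θ Ω a b f μ)) (volume.prod volume) := by
  obtain ⟨M, hM0, hM⟩ := f.exists_norm_le
  obtain ⟨C, hC, hCb⟩ := norm_wick_le
    (fun i j => symbolContraction Θ Ω a (μ i) (μ j)) Finset.univ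
  obtain ⟨K, hK, hKb⟩ := exists_norm_symbol_le Θ Ω a b μ
  refine Integrable.mono' (((integrable_one_add_norm_pow_mul
    (gauss (Ω ^ 2 / (4 * a)) 0) k).mul_prod (integrable_one_add_norm_pow_mul
    (gauss (1 / (4 * a)) 0) k)).const_mul (M * C * K ^ k))
    (continuous_traceIntegrand f μ).aestronglyMeasurable (Eventually.of_forall ?_)
  rintro ⟨x, κ⟩
  have hx := norm_nonneg x
  have hκ := norm_nonneg κ
  have h1 : 1 ≤ K * ((1 + ‖x‖) * (1 + ‖κ‖)) :=
    one_le_mul_of_one_le_of_one_le hK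
      (one_le_mul_of_one_le_of_one_le (by linarith) (by linarith))
  simp only [Function.uncurry_apply_pair, traceIntegrand]
  rw [norm_mul, norm_mul, norm_moyalWeight, norm_mixedGauss hΩ ha]
  calc _ ≤ M * (C * (K * ((1 + ‖x‖) * (1 + ‖κ‖))) ^ k *
        (‖gauss (Ω ^ 2 / (4 * a)) 0 x‖ * ‖gauss (1 / (4 * a)) 0 κ‖)) := by
        gcongr
        · exact hM _
        · exact hCb _ _ h1 (hKb x κ)
    _ = _ := by simp only [mul_pow]; ring

/-- The linear term of the Gaussian in the sheared integrand. -/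
def shearTerm (Θ : Matrix (Fin d) (Fin d) ℝ) (Ω a b : ℝ) (z : Rd d) : Fin d → ℂ := fun i =>
  -(Ω ^ 2 / (4 * a) : ℂ) * rootVec Θ Ω (matVec Θ z) i +
    Complex.I * (b / (2 * a) - 1) * rootVec Θ Ω z i

theorem inner_rootVec_matVec (hΘ : Θᵀ = -Θ) (w κ : Rd d) :
    ⟪rootVec Θ Ω w, matVec (metricRoot Θ Ω) κ⟫_ℝ = ⟪w, κ⟫_ℝ := by
  rw [rootVec, inner_matVec, Matrix.transpose_transpose, ← matVec_mul,
    Matrix.nonsing_inv_mul _ (isUnit_det_metricRoot hΘ)]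
  simp [matVec]

/-- Because `⟨κ, Θκ⟩ = 0` the shear leaves the phases bilinear in `z` and `κ`. The term `¼|Θκ|²`
from `|z - ½Θκ|²` completes `|κ|²` to `|(1 + ½ΩΘ)κ|²`. -/
theorem mixedGauss_shear (hΘ : Θᵀ = -Θ) (ha : 0 < a) (z κ : Rd d) :
    Complex.exp (-(Complex.I * ((⟪κ, z⟫_ℝ : ℝ) : ℂ))) *
      mixedGauss Ω a b (z - (1 / 2 : ℝ) • matVec Θ κ) κ =
      ((Real.exp (-(Ω ^ 2 / (4 * a)) * ‖z‖ ^ 2) : ℝ) : ℂ) *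
        gauss (1 / (4 * a)) (shearTerm Θ Ω a b z) (matVec (metricRoot Θ Ω) κ) := by
  have hs : ∑ i, shearTerm Θ Ω a b z i * (matVec (metricRoot Θ Ω) κ i : ℂ) =
      -(Ω ^ 2 / (4 * a) : ℂ) * ((⟪matVec Θ z, κ⟫_ℝ : ℝ) : ℂ) +
        Complex.I * (b / (2 * a) - 1) * ((⟪z, κ⟫_ℝ : ℝ) : ℂ) := by
    rw [← inner_rootVec_matVec (Ω := Ω) hΘ, ← inner_rootVec_matVec (Ω := Ω) hΘ z,
      real_inner_eq_sum, real_inner_eq_sum]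
    push_cast
    simp only [shearTerm, Finset.mul_sum]
    rw [← Finset.sum_add_distrib]
    exact Finset.sum_congr rfl fun i _ => by ring
  have ha' : (a : ℂ) ≠ 0 := by exact_mod_cast ha.ne'
  have hk : ⟪κ, z - (1 / 2 : ℝ) • matVec Θ κ⟫_ℝ = ⟪z, κ⟫_ℝ := by
    rw [inner_sub_right, inner_smul_right, inner_matVec_self_of_skew hΘ, mul_zero, sub_zero,
      real_inner_comm]
  have hn : ‖z - (1 / 2 : ℝ) • matVec Θ κ‖ ^ 2 =
      ‖z‖ ^ 2 + ⟪matVec Θ z, κ⟫_ℝ + 1 / 4 * ‖matVec Θ κ‖ ^ 2 := by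
    have h2 : ⟪matVec Θ z, κ⟫_ℝ = -⟪z, matVec Θ κ⟫_ℝ := by
      rw [inner_matVec, hΘ, ← inner_neg_right]
      simp [matVec, Matrix.neg_mulVec]
    rw [norm_sub_sq_real, inner_smul_right, norm_smul, mul_pow, h2]
    norm_num
    ring
  rw [gauss_apply (by positivity), hs, norm_sq_matVec_metricRoot hΘ, mixedGauss, hk, hn,
    real_inner_comm κ z, ← Complex.exp_add, Complex.ofReal_exp, ← Complex.exp_add]
  congr 1
  push_cast
  field_simp
  ring

theorem cvec_matVec (M : Matrix (Fin d) (Fin d) ℝ) (x : Rd d) :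
    cvec (matVec M x) = M.map Complex.ofReal *ᵥ cvec x := by
  ext i
  simp [cvec, matVec, Matrix.mulVec, dotProduct]

/-- The linear part of the symbol in the sheared integrand. -/
def shearLinear (Θ : Matrix (Fin d) (Fin d) ℝ) (Ω a b : ℝ) : Matrix (Fin d) (Fin d) ℂ :=
  shearMat Θ Ω a b * ((metricRoot Θ Ω)⁻¹).map Complex.ofReal

theorem symbol_shear (hΘ : Θᵀ = -Θ) (z κ : Rd d) (ν : Fin d) :
    symbol Θ Ω a (fun j => ((b * (z - (1 / 2 : ℝ) • matVec Θ κ) j : ℝ) : ℂ)) κ ν =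
      Complex.I * Ω ^ 2 * b / (4 * a) * (matVec Θ z ν : ℂ) +
        ∑ σ, shearLinear Θ Ω a b ν σ * (matVec (metricRoot Θ Ω) κ σ : ℂ) := by
  have h1 : ∑ σ, shearLinear Θ Ω a b ν σ * (matVec (metricRoot Θ Ω) κ σ : ℂ) =
      (shearMat Θ Ω a b *ᵥ cvec κ) ν := by
    change (shearLinear Θ Ω a b *ᵥ cvec (matVec (metricRoot Θ Ω) κ)) ν = _
    rw [cvec_matVec, Matrix.mulVec_mulVec, shearLinear, mul_assoc, ← map_ofReal_mul,
      Matrix.nonsing_inv_mul _ (isUnit_det_metricRoot hΘ), map_ofReal_one, mul_one]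
  have h2 : (fun j => ((b * (z - (1 / 2 : ℝ) • matVec Θ κ) j : ℝ) : ℂ)) =
      (b : ℂ) • (cvec z - (1 / 2 : ℂ) • (Θ.map Complex.ofReal *ᵥ cvec κ)) := by
    rw [← cvec_matVec]
    ext j
    simp [cvec]
  have h3 : (matVec Θ z ν : ℂ) = (Θ.map Complex.ofReal *ᵥ cvec z) ν := by
    rw [← cvec_matVec]; rfl
  rw [h1, h2, h3, symbol, shearMat, Matrix.mulVec_smul, Matrix.mulVec_sub, Matrix.mulVec_smul,
    Matrix.sub_mulVec, Matrix.smul_mulVec, ← Matrix.mulVec_mulVec]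
  simp only [Pi.add_apply, Pi.sub_apply, Pi.smul_apply, smul_eq_mul]
  ring

theorem traceIntegrand_shear (hΘ : Θᵀ = -Θ) (ha : 0 < a) (f : BStar d) (μ : Fin k → Fin d)
    (z κ : Rd d) :
    traceIntegrand Θ Ω a b f μ (z - (1 / 2 : ℝ) • matVec Θ κ) κ =
      f.toFun z * ((Real.exp (-(Ω ^ 2 / (4 * a)) * ‖z‖ ^ 2) : ℝ) : ℂ) *
        (wick (fun i => Complex.I * Ω ^ 2 * b / (4 * a) * (matVec Θ z (μ i) : ℂ) +
            ∑ σ, shearLinear Θ Ω a b (μ i) σ * (matVec (metricRoot Θ Ω) κ σ : ℂ))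
          (fun i j => symbolContraction Θ Ω a (μ i) (μ j)) Finset.univ *
          gauss (1 / (4 * a)) (shearTerm Θ Ω a b z) (matVec (metricRoot Θ Ω) κ)) := by
  have hk : ⟪κ, z - (1 / 2 : ℝ) • matVec Θ κ⟫_ℝ = ⟪κ, z⟫_ℝ := by
    rw [inner_sub_right, inner_smul_right, inner_matVec_self_of_skew hΘ, mul_zero, sub_zero]
  rw [traceIntegrand, moyalWeight, sub_add_cancel, hk]
  simp only [symbol_shear hΘ]
  have h := mixedGauss_shear (Ω := Ω) (b := b) hΘ ha z κ
  linear_combination f.toFun z * (wick (fun i => Complex.I * Ω ^ 2 * b / (4 * a) *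
    (matVec Θ z (μ i) : ℂ) +
    ∑ σ, shearLinear Θ Ω a b (μ i) σ * (matVec (metricRoot Θ Ω) κ σ : ℂ))
    (fun i j => symbolContraction Θ Ω a (μ i) (μ j)) Finset.univ) * h

theorem shearTerm_eq (z : Rd d) : shearTerm Θ Ω a b z =
    (((metricRoot Θ Ω)⁻¹)ᵀ).map Complex.ofReal *ᵥ
      (((-(Ω ^ 2 / (4 * a)) : ℂ) • Θ.map Complex.ofReal +
        (Complex.I * (b / (2 * a) - 1) : ℂ) • (1 : Matrix (Fin d) (Fin d) ℂ)) *ᵥ cvec z) := by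
  rw [Matrix.add_mulVec, Matrix.smul_mulVec, Matrix.smul_mulVec, Matrix.one_mulVec,
    Matrix.mulVec_add, Matrix.mulVec_smul, Matrix.mulVec_smul, ← cvec_matVec, ← cvec_matVec,
    ← cvec_matVec]
  rfl

theorem map_ofReal_metricRoot_inv_mul (hΘ : Θᵀ = -Θ) :
    ((metricRoot Θ Ω)⁻¹).map Complex.ofReal * (((metricRoot Θ Ω)⁻¹)ᵀ).map Complex.ofReal =
      (metricG Θ Ω).map Complex.ofReal := by
  rw [← map_ofReal_mul, metricRoot_inv_mul_transpose hΘ]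

/-- Wick's theorem at width `1/(4a)` shifts linear factors by `2a` times this sum. The two inverse
roots inside it combine to `g`, so `linear_eq` applies. -/
theorem linear_shear (hΩ : 0 < Ω) (ha : 0 < a) (hab : 4 * a ^ 2 - b ^ 2 = Ω ^ 2)
    (hΘ : Θᵀ = -Θ) (z : Rd d) (ν : Fin d) :
    Complex.I * Ω ^ 2 * b / (4 * a) * (matVec Θ z ν : ℂ) +
        2 * a * ∑ σ, shearLinear Θ Ω a b ν σ * shearTerm Θ Ω a b z σ =
      -(2 * a - b) * z ν + Complex.I * Ω ^ 2 * (matVec (Θ * metricG Θ Ω) z ν : ℂ) := by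
  have h := congrArg (fun M => (M *ᵥ cvec z) ν) (linear_eq hΩ ha hab hΘ)
  simp only [Matrix.add_mulVec (A := _ • _) (B := _ • _), Matrix.smul_mulVec, Pi.add_apply,
    Pi.smul_apply, ← cvec_matVec, Matrix.one_mulVec, smul_eq_mul] at h
  have h1 : ∑ σ, shearLinear Θ Ω a b ν σ * shearTerm Θ Ω a b z σ =
      ((shearMat Θ Ω a b * (metricG Θ Ω).map Complex.ofReal *
          ((-(Ω ^ 2 / (4 * a)) : ℂ) • Θ.map Complex.ofReal +
            (Complex.I * (b / (2 * a) - 1) : ℂ) • (1 : Matrix (Fin d) (Fin d) ℂ))) *ᵥ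
        cvec z) ν := by
    change (shearLinear Θ Ω a b *ᵥ shearTerm Θ Ω a b z) ν = _
    rw [shearTerm_eq, Matrix.mulVec_mulVec, Matrix.mulVec_mulVec, shearLinear,
      mul_assoc (shearMat Θ Ω a b), map_ofReal_metricRoot_inv_mul hΘ]
  rw [h1]
  exact h

theorem contraction_shear (hΩ : 0 < Ω) (ha : 0 < a) (hab : 4 * a ^ 2 - b ^ 2 = Ω ^ 2)
    (hΘ : Θᵀ = -Θ) (ν ρ : Fin d) :
    symbolContraction Θ Ω a ν ρ +
        2 * a * ∑ σ, shearLinear Θ Ω a b ν σ * shearLinear Θ Ω a b ρ σ =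
      -(2 * a * (metricInv Θ Ω ν ρ : ℂ)) -
        Ω ^ 2 / 2 * (2 * a + b) * ((Θ * metricG Θ Ω * Θ) ν ρ : ℝ) -
        Complex.I * Ω ^ 2 / 2 * Θ ν ρ := by
  have hΩ' : (Ω : ℂ) ≠ 0 := by exact_mod_cast hΩ.ne'
  have h := congrFun (congrFun (contraction_eq hΩ ha hab hΘ) ν) ρ
  have h1 : ∑ σ, shearLinear Θ Ω a b ν σ * shearLinear Θ Ω a b ρ σ =
      (shearMat Θ Ω a b * (metricG Θ Ω).map Complex.ofReal * (shearMat Θ Ω a b)ᵀ) ν ρ := by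
    change (shearLinear Θ Ω a b * (shearLinear Θ Ω a b)ᵀ) ν ρ = _
    rw [shearLinear, Matrix.transpose_mul, ← Matrix.transpose_map, mul_assoc,
      ← mul_assoc (((metricRoot Θ Ω)⁻¹).map Complex.ofReal), map_ofReal_metricRoot_inv_mul hΘ,
      mul_assoc]
  have h2 : (((Θ * metricG Θ Ω * Θ) ν ρ : ℝ) : ℂ) =
      4 / Ω ^ 2 * ((metricG Θ Ω).map Complex.ofReal - 1) ν ρ := by
    rw [mul_assoc, mul_metricG_mul hΩ hΘ]
    by_cases hνρ : ν = ρ <;> simp [hνρ]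
  rw [h1, h2]
  simp only [Matrix.add_apply, Matrix.sub_apply, Matrix.neg_apply, Matrix.smul_apply,
    smul_eq_mul, Matrix.map_apply] at h ⊢
  rw [h]
  field_simp
  ring

/-- The two parts of `shearTerm` are orthogonal because `gΘ` is skew. The `|z|²` contributions
cancel, and `4a² - b² + (2a - b)² = 4a(2a - b)` leaves the coefficient `2a - b`. -/
theorem exponent_shear (hΩ : 0 < Ω) (ha : 0 < a) (hab : 4 * a ^ 2 - b ^ 2 = Ω ^ 2)
    (hΘ : Θᵀ = -Θ) (z : Rd d) :
    ((-(Ω ^ 2 / (4 * a)) * ‖z‖ ^ 2 : ℝ) : ℂ) + a * ∑ i, shearTerm Θ Ω a b z i ^ 2 =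
      ((-((2 * a - b) * ⟪z, matVec (metricG Θ Ω) z⟫_ℝ) : ℝ) : ℂ) := by
  have h : ∑ i, shearTerm Θ Ω a b z i ^ 2 =
      (((Ω ^ 2 / (4 * a)) ^ 2 * ‖rootVec Θ Ω (matVec Θ z)‖ ^ 2 -
        (b / (2 * a) - 1) ^ 2 * ‖rootVec Θ Ω z‖ ^ 2 : ℝ) : ℂ) -
        2 * Complex.I * ((Ω ^ 2 / (4 * a) * (b / (2 * a) - 1) *
          ⟪rootVec Θ Ω (matVec Θ z), rootVec Θ Ω z⟫_ℝ : ℝ) : ℂ) := by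
    rw [sq_norm_eq_sum, sq_norm_eq_sum, real_inner_eq_sum]
    push_cast
    simp only [Finset.mul_sum]
    rw [← Finset.sum_sub_distrib, ← Finset.sum_sub_distrib]
    refine Finset.sum_congr rfl fun i _ => ?_
    rw [shearTerm]
    linear_combination ((b / (2 * a) - 1) * (rootVec Θ Ω z i : ℂ)) ^ 2 * Complex.I_sq
  rw [h, inner_rootVec_skew hΘ, mul_zero, Complex.ofReal_zero, mul_zero, sub_zero,
    norm_sq_rootVec_skew hΩ hΘ, norm_sq_rootVec hΘ]
  norm_cast
  field_simp
  linear_combination 4 * ⟪z, matVec (metricG Θ Ω) z⟫_ℝ * hab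

theorem integral_traceIntegrand_shear (hΩ : 0 < Ω) (ha : 0 < a)
    (hab : 4 * a ^ 2 - b ^ 2 = Ω ^ 2) (hΘ : Θᵀ = -Θ) (f : BStar d) (μ : Fin k → Fin d)
    (z : Rd d) :
    ∫ κ, traceIntegrand Θ Ω a b f μ (z - (1 / 2 : ℝ) • matVec Θ κ) κ =
      ((Real.sqrt (4 * Real.pi * a) ^ d * Real.sqrt (metricG Θ Ω).det : ℝ) : ℂ) *
        (f.toFun z * ((Real.exp (-((2 * a - b) * ⟪z, matVec (metricG Θ Ω) z⟫_ℝ)) : ℝ) : ℂ) *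
          wick (fun i => -(2 * a - b) * z (μ i) +
              Complex.I * Ω ^ 2 * (matVec (Θ * metricG Θ Ω) z (μ i) : ℂ))
            (fun i j => -(2 * a * (metricInv Θ Ω (μ i) (μ j) : ℂ)) -
              Ω ^ 2 / 2 * (2 * a + b) * ((Θ * metricG Θ Ω * Θ) (μ i) (μ j) : ℝ) -
              Complex.I * Ω ^ 2 / 2 * Θ (μ i) (μ j)) Finset.univ) := by
  have ha' : (a : ℂ) ≠ 0 := by exact_mod_cast ha.ne'
  have hc : (0 : ℝ) < 1 / (4 * a) := by positivity
  simp only [traceIntegrand_shear hΘ ha]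
  -- Substituting `y = (1 + ½ΩΘ)κ` makes the Gaussian round, and the Jacobian is `√det g`.
  rw [integral_const_mul, integral_comp_matVec (isUnit_det_metricRoot hΘ)
    (fun y => wick (fun i => Complex.I * Ω ^ 2 * b / (4 * a) * (matVec Θ z (μ i) : ℂ) +
            ∑ σ, shearLinear Θ Ω a b (μ i) σ * (y σ : ℂ))
          (fun i j => symbolContraction Θ Ω a (μ i) (μ j)) Finset.univ *
          gauss (1 / (4 * a)) (shearTerm Θ Ω a b z) y),
    integral_wick_gauss hc, integral_gauss hc, ← sqrt_det_metricG hΘ]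
  have h2 : ∀ w : ℂ, w / (2 * ((1 / (4 * a) : ℝ) : ℂ)) = 2 * a * w := fun w => by
    push_cast
    field_simp
    ring
  have h4 : ∀ w : ℂ, w / (4 * ((1 / (4 * a) : ℝ) : ℂ)) = a * w := fun w => by
    push_cast
    field_simp
  simp only [h2, h4, linear_shear hΩ ha hab hΘ, contraction_shear hΩ ha hab hΘ]
  have h5 : Real.pi / (1 / (4 * a)) = 4 * Real.pi * a := by field_simp
  rw [h5, Complex.ofReal_exp (-((2 * a - b) * _)), ← exponent_shear hΩ ha hab hΘ,
    Complex.exp_add, Complex.ofReal_exp]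
  push_cast
  ring

theorem integral_traceIntegrand (hΩ : 0 < Ω) (ha : 0 < a)
    (hab : 4 * a ^ 2 - b ^ 2 = Ω ^ 2) (hΘ : Θᵀ = -Θ) (f : BStar d) (μ : Fin k → Fin d) :
    ∫ x, ∫ κ, traceIntegrand Θ Ω a b f μ x κ =
      ((Real.sqrt (4 * Real.pi * a) ^ d * Real.sqrt (metricG Θ Ω).det : ℝ) : ℂ) *
        ∫ z, f.toFun z * ((Real.exp (-((2 * a - b) * ⟪z, matVec (metricG Θ Ω) z⟫_ℝ)) : ℝ) : ℂ) *
          wick (fun i => -(2 * a - b) * z (μ i) +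
              Complex.I * Ω ^ 2 * (matVec (Θ * metricG Θ Ω) z (μ i) : ℂ))
            (fun i j => -(2 * a * (metricInv Θ Ω (μ i) (μ j) : ℂ)) -
              Ω ^ 2 / 2 * (2 * a + b) * ((Θ * metricG Θ Ω * Θ) (μ i) (μ j) : ℝ) -
              Complex.I * Ω ^ 2 / 2 * Θ (μ i) (μ j)) Finset.univ := by
  rw [integral_integral_shear (continuous_traceIntegrand f μ) (integrable_traceIntegrand hΩ ha f μ)
    (τ := fun κ => (1 / 2 : ℝ) • matVec Θ κ) (by fun_prop), ← integral_const_mul]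
  exact integral_congr_ae
    (Eventually.of_forall fun z => integral_traceIntegrand_shear hΩ ha hab hΘ f μ z)

end TraceIntegral

/-! ### The trace formula -/

section TraceFormula

variable {d k : ℕ} {Θ : Matrix (Fin d) (Fin d) ℝ} {Ω t : ℝ}

theorem integral_moyal_kernelTime (hΩ : 0 < Ω) (ht : 0 < t) (f : BStar d) (μ : Fin k → Fin d) :
    ∫ x, moyal Θ f.toFun (nablaProd Θ Ω (List.ofFn μ) (kernelTime d Ω t x)) x =
      ((Real.sqrt (mehlerB Ω (Real.exp (-2 * Ω * t)) / (2 * Real.pi)) ^ d *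
        (((2 * Real.pi) ^ d)⁻¹ *
          Real.sqrt (Real.pi / mehlerA Ω (Real.exp (-2 * Ω * t))) ^ d) : ℝ) : ℂ) *
        ∫ x, ∫ κ, traceIntegrand Θ Ω (mehlerA Ω (Real.exp (-2 * Ω * t)))
          (mehlerB Ω (Real.exp (-2 * Ω * t))) f μ x κ := by
  have hq := Real.exp_pos (-2 * Ω * t)
  have hq1 := exp_neg_lt_one hΩ ht
  have ha := mehlerA_pos hΩ hq hq1
  have hab := four_mul_mehlerA_sq_sub (Ω := Ω) hq hq1
  simp only [kernelTime, mehlerKernel, moyal_eq]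
  generalize mehlerA Ω (Real.exp (-2 * Ω * t)) = a at *
  generalize mehlerB Ω (Real.exp (-2 * Ω * t)) = b at *
  rw [← integral_const_mul]
  refine integral_congr_ae (Eventually.of_forall fun x => ?_)
  simp only
  rw [← integral_const_mul]
  refine integral_congr_ae (Eventually.of_forall fun κ => ?_)
  simp only [map_smul, _root_.smul_apply, smul_eq_mul]
  have hl : (List.finRange k).toFinset = Finset.univ := by ext; simp
  rw [List.ofFn_eq_map, hatS_nablaProd_gauss Θ Ω ha _ μ (List.pairwise_lt_finRange k), hl,
    traceIntegrand]
  have h := hatS_kernel ha hab x κ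
  rw [Complex.ofReal_mul (Real.sqrt _ ^ d) (Real.exp _),
    Complex.ofReal_mul (Real.sqrt _ ^ d) (_ * _)]
  linear_combination ((Real.sqrt (b / (2 * Real.pi)) ^ d : ℝ) : ℂ) * moyalWeight Θ f x κ *
    (wick (fun i => symbol Θ Ω a (fun j => ((b * x j : ℝ) : ℂ)) κ (μ i))
      (fun i j => symbolContraction Θ Ω a (μ i) (μ j)) Finset.univ) * h

/-- The widths `a` of the transformed kernel and `1/(4a)` of the `κ`-integral contribute `√(π/a)
√(4πa) = 2π` per dimension, which cancels the normalisation of the Fourier transform. -/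
theorem kernel_constant {a b : ℝ} (ha : 0 < a) (hb : 0 < b) (d : ℕ) :
    Real.sqrt (b / (2 * Real.pi)) ^ d * (((2 * Real.pi) ^ d)⁻¹ * Real.sqrt (Real.pi / a) ^ d) *
      Real.sqrt (4 * Real.pi * a) ^ d = (b / (2 * Real.pi)) ^ ((d : ℝ) / 2) := by
  have hπ := Real.pi_pos
  have h1 : Real.sqrt (Real.pi / a) * Real.sqrt (4 * Real.pi * a) = 2 * Real.pi := by
    rw [← Real.sqrt_mul (by positivity),
      show Real.pi / a * (4 * Real.pi * a) = (2 * Real.pi) ^ 2 by field_simp; ring,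
      Real.sqrt_sq (by positivity)]
  have h2 : (b / (2 * Real.pi)) ^ ((d : ℝ) / 2) = Real.sqrt (b / (2 * Real.pi)) ^ d := by
    rw [Real.sqrt_eq_rpow, ← Real.rpow_natCast, ← Real.rpow_mul (by positivity)]
    congr 1
    ring
  rw [h2, mul_assoc, mul_assoc, ← mul_pow, h1, inv_mul_cancel₀ (by positivity), mul_one]

theorem Zfac_eq (hΩ : 0 < Ω) (ht : 0 < t) (z : Rd d) (ν : Fin d) :
    Zfac Θ Ω t z ν = -(2 * (mehlerA Ω (Real.exp (-2 * Ω * t)) : ℂ) -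
        mehlerB Ω (Real.exp (-2 * Ω * t))) * z ν +
      Complex.I * Ω ^ 2 * (matVec (Θ * metricG Θ Ω) z ν : ℂ) := by
  rw [Zfac, ← two_mul_mehlerA_sub hΩ ht]
  push_cast
  ring

theorem Nfac_eq (hΩ : 0 < Ω) (ht : 0 < t) (hΘ : Θᵀ = -Θ) (ν ρ : Fin d) :
    Nfac Θ Ω t ν ρ = -(2 * (mehlerA Ω (Real.exp (-2 * Ω * t)) : ℂ) * (metricInv Θ Ω ν ρ : ℂ)) -
        Ω ^ 2 / 2 * (2 * (mehlerA Ω (Real.exp (-2 * Ω * t)) : ℂ) +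
          mehlerB Ω (Real.exp (-2 * Ω * t))) * ((Θ * metricG Θ Ω * Θ) ν ρ : ℝ) -
        Complex.I * Ω ^ 2 / 2 * Θ ν ρ := by
  have h1 := two_mul_mehlerA_sub hΩ ht
  have h2 := two_mul_mehlerA_add hΩ ht
  rw [Nfac, inv_metricG hΘ]
  generalize mehlerA Ω (Real.exp (-2 * Ω * t)) = a at *
  generalize mehlerB Ω (Real.exp (-2 * Ω * t)) = b at *
  have h3 : -(1 / 2 * Ω * (coth (Ω * t) + Real.tanh (Ω * t)) * metricInv Θ Ω ν ρ)
      - 1 / 2 * Ω ^ 3 * coth (Ω * t) * (Θ * metricG Θ Ω * Θ) ν ρ =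
      -(2 * a * metricInv Θ Ω ν ρ) -
        Ω ^ 2 / 2 * (2 * a + b) * (Θ * metricG Θ Ω * Θ) ν ρ := by
    linear_combination (1 / 2 * metricInv Θ Ω ν ρ) * (h1 + h2) +
      (1 / 2 * Ω ^ 2 * (Θ * metricG Θ Ω * Θ) ν ρ) * h2
  rw [h3]
  push_cast
  ring

theorem exists_norm_Zfac_le (Θ : Matrix (Fin d) (Fin d) ℝ) (Ω t : ℝ) (μ : Fin k → Fin d) :
    ∃ K : ℝ, 1 ≤ K ∧ ∀ (z : Rd d) i, ‖Zfac Θ Ω t z (μ i)‖ ≤ K * (1 + ‖z‖) := by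
  obtain ⟨K, hK, h⟩ := exists_norm_affine_le (d := d) (k := k) 0
    fun i j => ((-(Ω * Real.tanh (Ω * t)) : ℝ) : ℂ) * (if j = μ i then 1 else 0) +
      Complex.I * Ω ^ 2 * (Θ * metricG Θ Ω) (μ i) j
  refine ⟨K, hK, fun z i => le_of_eq_of_le (congrArg norm ?_) (h z i)⟩
  simp only [Zfac, matVec, Matrix.mulVec, dotProduct, Pi.zero_apply, zero_add, add_mul,
    Finset.sum_add_distrib, mul_ite, ite_mul, mul_one, mul_zero, zero_mul, Finset.sum_ite_eq',
    Finset.mem_univ, if_true]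
  push_cast
  simp only [Finset.mul_sum]
  congr 1
  · ring
  · exact Finset.sum_congr rfl fun j _ => by ring

theorem continuous_Zfac (ν : Fin d) : Continuous fun z => Zfac Θ Ω t z ν := by
  unfold Zfac
  fun_prop

/-- The Gaussian in `⟨z, gz⟩` is a round one pulled back by an invertible matrix, hence a Schwartz
function that dominates the polynomial growth of the product. Integrability is what allows the sum
over pairings to leave the integral. -/
theorem integrable_traceFormula_term (hΩ : 0 < Ω) (ht : 0 < t) (hΘ : Θᵀ = -Θ) (f : BStar d)
    (μ : Fin k → Fin d) (s : Finset (Fin k)) :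
    Integrable fun z : Rd d => f.toFun z *
      ((Real.exp (-(Ω * Real.tanh (Ω * t) * ⟪z, matVec (metricG Θ Ω) z⟫_ℝ)) : ℝ) : ℂ) *
        ∏ i ∈ s, Zfac Θ Ω t z (μ i) := by
  obtain ⟨M, hM0, hM⟩ := f.exists_norm_le
  obtain ⟨K, hK, hKb⟩ := exists_norm_Zfac_le Θ Ω t μ
  have hc : 0 < Ω * Real.tanh (Ω * t) := by
    rw [Real.tanh_eq_sinh_div_cosh]
    exact mul_pos hΩ (div_pos (Real.sinh_pos_iff.2 (mul_pos hΩ ht)) (Real.cosh_pos _))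
  have hB : IsUnit (((metricRoot Θ Ω)⁻¹)ᵀ).det := by
    rw [Matrix.det_transpose]
    exact Matrix.isUnit_nonsing_inv_det _ (isUnit_det_metricRoot hΘ)
  let φ : 𝓢(Rd d, ℂ) := SchwartzMap.compCLMOfContinuousLinearEquiv ℂ
    (matCLE ((metricRoot Θ Ω)⁻¹)ᵀ hB) (gauss (Ω * Real.tanh (Ω * t)) 0)
  have hφ : ∀ z, ((Real.exp (-(Ω * Real.tanh (Ω * t) * ⟪z, matVec (metricG Θ Ω) z⟫_ℝ)) : ℝ) : ℂ) =
      φ z := fun z => by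
    rw [SchwartzMap.compCLMOfContinuousLinearEquiv_apply, Function.comp_apply, gauss_apply hc,
      matCLE_apply, ← norm_sq_rootVec hΘ, Complex.ofReal_exp, rootVec]
    simp
  simp only [hφ]
  have hf := f.smooth.continuous
  have hZ := fun i => continuous_Zfac (Θ := Θ) (Ω := Ω) (t := t) (μ i)
  refine Integrable.mono' ((integrable_one_add_norm_pow_mul φ k).const_mul (M * K ^ k))
    (Continuous.aestronglyMeasurable (by fun_prop)) (Eventually.of_forall fun z => ?_)
  have hp : ‖∏ i ∈ s, Zfac Θ Ω t z (μ i)‖ ≤ (K * (1 + ‖z‖)) ^ k := by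
    rw [norm_prod]
    have h1 : 1 ≤ K * (1 + ‖z‖) :=
      one_le_mul_of_one_le_of_one_le hK (by linarith [norm_nonneg z])
    calc _ ≤ ∏ _i ∈ s, K * (1 + ‖z‖) :=
          Finset.prod_le_prod (fun _ _ => norm_nonneg _) fun i _ => hKb z i
      _ = (K * (1 + ‖z‖)) ^ s.card := Finset.prod_const _
      _ ≤ _ := pow_le_pow_right₀ h1 (by simpa using s.card_le_univ)
  rw [norm_mul, norm_mul]
  calc _ ≤ M * ‖φ z‖ * (K * (1 + ‖z‖)) ^ k := by
        gcongr
        exact hM z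
    _ = _ := by rw [mul_pow]; ring

theorem traceFormula_eq (hΩ : 0 < Ω) (ht : 0 < t) (hΘ : Θᵀ = -Θ) (f : BStar d)
    (μ : Fin k → Fin d) :
    traceFormula Θ Ω t f μ =
      (((Ω / (2 * Real.pi * Real.sinh (2 * Ω * t))) ^ ((d : ℝ) / 2) : ℝ) : ℂ) *
        ((Real.sqrt (metricG Θ Ω).det : ℝ) : ℂ) * ∫ z : Rd d, f.toFun z *
          ((Real.exp (-(Ω * Real.tanh (Ω * t) * ⟪z, matVec (metricG Θ Ω) z⟫_ℝ)) : ℝ) : ℂ) *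
          wick (fun i => Zfac Θ Ω t z (μ i)) (fun i j => Nfac Θ Ω t (μ i) (μ j)) Finset.univ := by
  simp only [wick_univ, Finset.mul_sum]
  rw [integral_finsetSum, Finset.mul_sum, traceFormula]
  · refine Finset.sum_congr rfl fun σ _ => ?_
    rw [← integral_const_mul, ← integral_const_mul]
    refine integral_congr_ae (Eventually.of_forall fun z => ?_)
    simp only
    ring
  · intro σ _
    refine ((integrable_traceFormula_term hΩ ht hΘ f μ
      (Finset.univ.filter fun i => σ i = i)).mul_const
      (∏ i ∈ Finset.univ.filter (fun i => i < σ i), Nfac Θ Ω t (μ i) (μ (σ i)))).congr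
      (Eventually.of_forall fun z => ?_)
    simp only
    ring

theorem integral_moyal_eq_traceFormula (hΩ : 0 < Ω) (ht : 0 < t) (hΘ : Θᵀ = -Θ) (f : BStar d)
    (μ : Fin k → Fin d) :
    ∫ x, moyal Θ f.toFun (nablaProd Θ Ω (List.ofFn μ) (kernelTime d Ω t x)) x =
      traceFormula Θ Ω t f μ := by
  have hq := Real.exp_pos (-2 * Ω * t)
  have hq1 := exp_neg_lt_one hΩ ht
  have ha := mehlerA_pos hΩ hq hq1
  rw [integral_moyal_kernelTime hΩ ht, traceFormula_eq hΩ ht hΘ,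
    integral_traceIntegrand hΩ ha (four_mul_mehlerA_sq_sub hq hq1) hΘ, ← mul_assoc,
    two_mul_mehlerA_sub hΩ ht]
  simp only [← Zfac_eq hΩ ht, ← Nfac_eq hΩ ht hΘ]
  congr 1
  rw [← Complex.ofReal_mul, ← Complex.ofReal_mul, ← mul_assoc,
    kernel_constant ha (mehlerB_pos hΩ hq hq1), mehlerB_eq hΩ ht, div_div,
    mul_comm (Real.sinh _)]

end TraceFormula

theorem mainTheorem7 {d : ℕ} (Θ : Matrix (Fin d) (Fin d) ℝ) (hΘ : Θᵀ = -Θ) (hdet : IsUnit Θ.det)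
    (Ω t : ℝ) (hΩ : 0 < Ω) (ht : 0 < t) :
    (∀ (f : BStar d) (k : ℕ) (μ : Fin k → Fin d),
      ∃ T : L2 d →L[ℂ] L2 d,
        tracedOp Θ Ω t f μ = T.toLinearMap.toPMap ⊤ ∧ HasTrace T (traceFormula Θ Ω t f μ)) ∧
    HasTrace (expNeg (oscillator d Ω) t) ((((2 * Real.sinh (Ω * t)) ^ d)⁻¹ : ℝ) : ℂ) := by
  refine ⟨fun f k μ => ?_, ?_⟩
  · rw [← integral_moyal_eq_traceFormula hΩ ht hΘ]
    exact exists_tracedOp_eq_hasTrace Θ hΩ ht f μ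
  · rw [expNeg_oscillator hΩ ht.le]
    exact hasTrace_mehlerSemigroup hΩ ht

end
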